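/- \textbf{Setting.} Let $X$ be a finite-dimensional real inner product space and $A:X\to X$ a symmetric, strictly positive definite operator. (If $A$ is only positive semidefinite on $\mathbb R^N$, take for $X$ the range of $A$.) Let $V_0:X\to\mathbb R$ be $C^2$ and bounded below. For a family $(\dot C_t)_{t\ge 0}$ of positive operators on $X$ with $\int_0^\infty \dot C_s\,ds=A^{-1}$ write $C_t=\int_0^t\dot C_s\,ds$ and $C_\infty=\int_0^\infty\dot C_s\,ds$. Let $\mathsf E_C$ be the expectation, in the variable $\zeta$, for the centred Gaussian measure on $X$ with covariance $C$. Define for $t\in[0,\infty]$ $$V_t(\varphi)=-\log \mathsf E_{C_t}\big[e^{-V_0(\varphi+\zeta)}\big],$$ the probability measures $\nu_0$ and $\nu_t$ ($0\le t<\infty$), $$\mathbb E_{\nu_0}[F]\propto\mathsf E_{C_\infty}\big[e^{-V_0(\zeta)}F(\zeta)\big],\qquad \mathbb E_{\nu_t}[F]=e^{V_\infty(0)}\,\mathsf E_{C_\infty-C_t}\big[e^{-V_t(\zeta)}F(\zeta)\big],$$ the rescaling $D_t=(\mathrm{id}-AC_t)^{-1/2}$, and the rescaled renormalised measure $\hat\nu_t$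 by $\mathbb E_{\hat\nu_t}[F(\varphi)]=\mathbb E_{\nu_t}[F(D_t\varphi)]$. Consider the flow $$\partial_t S_t(\varphi)=\tfrac12\,D_t\,\dot C_t\,\nabla V_t\big(D_t^{-1}S_t(\varphi)\big)\quad(t\ge 0),\qquad S_0(\varphi)=\varphi .$$ \textbf{Theorem.} (i) Let $\dot C_t=(tA+\mathrm{id})^{-2}$ and suppose that there is a function $t\mapsto\dot\lambda_t\in\mathbb R$, integrable on $[0,t]$ for every $t\ge0$, such that, as quadratic forms, $$\dot C_t\,\mathrm{Hess}\,V_t(\varphi)\,\dot C_t-\tfrac12\ddot C_t\ \ge\ \dot\lambda_t\,\dot C_t\qquad\text{for all }\varphi\in X,\ t>0 .$$ Put $\lambda_t=\int_0^t\dot\lambda_s\,ds$. Then the flow $S_t:X\to X$ exists for all $t\ge0$ and is unique; for every $t\ge 0$ the map $S_t$ is a bijection of $X$, its inverse $\hat S_t=S_t^{-1}:X\to X$ is differentiable and transports $\hat\nu_t$ to $\nu_0$, that is $\mathbb E_{\nu_0}[F(\varphi)]=\mathbb E_{\hat\nu_t}[F(\hat S_t(\varphi))]$; and $$|\nabla\hat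 S_t(\varphi)f|^2\ \le\ e^{-\lambda_t}\,\big|\sqrt{1+tA}\,f\big|^2=e^{-\lambda_t}\,(f,(1+tA)f)\qquad\text{for all }\varphi,f\in X .$$ (ii) Let $\dot C_t=e^{-tA}$ and suppose that there is a function $t\mapsto\dot\mu_t\in\mathbb R$, integrable on $[0,t]$ for every $t\ge0$, such that, as quadratic forms, $$\dot C_t^{1/2}\,\mathrm{Hess}\,V_t(\varphi)\,\dot C_t^{1/2}\ \ge\ \dot\mu_t\,\mathrm{id}\qquad\text{for all }\varphi\in X,\ t>0 .$$ Put $\mu_t=\int_0^t\dot\mu_s\,ds$. Then the flow $S_t:X\to X$ exists for all $t\ge0$ and is unique; for every $t\ge0$ the map $S_t$ is a bijection of $X$, its inverse $\hat S_t$ is differentiable and transports $\hat\nu_t$ to $\nu_0$; and $\hat S_t$ is $e^{-\mu_t/2}$-Lipschitz, with $|\nabla\hat S_t(\varphi)f|^2\le \big(e^{-\mu_t/2}\big)^2|f|^2$ for all $\varphi,f\in X$. -/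

import Mathlib

open MeasureTheory ProbabilityTheory Set
open scoped RealInnerProductSpace Gradient

namespace PolchinskiFlow

noncomputable section

variable {X : Type*} [NormedAddCommGroup X] [InnerProductSpace ℝ X] [FiniteDimensional ℝ X]

open Classical in
/-- Square root of a symmetric positive semidefinite operator, through an orthonormal basis of
eigenvectors (the value `0` is used when the operator is not symmetric). -/
def opSqrt (T : X →L[ℝ] X) : X →L[ℝ] X :=
  if h : (T : X →ₗ[ℝ] X).IsSymmetric then
    ∑ i, √(h.eigenvalues rfl i) •
      InnerProductSpace.rankOne ℝ (h.eigenvectorBasis rfl i) (h.eigenvectorBasis rfl i)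
  else 0

/-- The centred Gaussian measure with (positive semidefinite, possibly degenerate) covariance `C`:
the law of `C ^ (1/2) Z` for a standard Gaussian vector `Z` of `X`. -/
def gaussian [MeasurableSpace X] (C : X →L[ℝ] X) : Measure X :=
  (stdGaussian X).map (opSqrt C)

/-- The covariance `C_t = ∫₀ᵗ Ċ_s ds`. -/
def cov (Cdot : ℝ → X →L[ℝ] X) (t : ℝ) : X →L[ℝ] X :=
  ∫ s in (0 : ℝ)..t, Cdot s

/-- The full covariance `C_∞ = ∫₀^∞ Ċ_s ds`. -/
def covInf (Cdot : ℝ → X →L[ℝ] X) : X →L[ℝ] X :=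
  ∫ s in Ioi (0 : ℝ), Cdot s

/-- `φ ↦ - log E_C [exp (- V₀ (φ + ζ))]`, with `ζ` Gaussian of covariance `C`. -/
def smoothedPotential [MeasurableSpace X] (C : X →L[ℝ] X) (V₀ : X → ℝ) (φ : X) : ℝ :=
  - Real.log (∫ ζ, Real.exp (- V₀ (φ + ζ)) ∂(gaussian C))

/-- The renormalised potential `V_t`. -/
def renormPotential [MeasurableSpace X] (Cdot : ℝ → X →L[ℝ] X) (V₀ : X → ℝ) (t : ℝ) : X → ℝ :=
  smoothedPotential (cov Cdot t) V₀

/-- The Hessian of `V`, as an operator: the derivative of the gradient. -/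
def hess (V : X → ℝ) (φ : X) : X →L[ℝ] X :=
  fderiv ℝ (∇ V) φ

/-- The measure `ν₀`, with density proportional to `exp (- V₀)` with respect to the Gaussian
measure of covariance `C_∞`. -/
def initialMeasure [MeasurableSpace X] (Cdot : ℝ → X →L[ℝ] X) (V₀ : X → ℝ) : Measure X :=
  (gaussian (covInf Cdot)).tilted (fun φ => - V₀ φ)

/-- The renormalised measure `ν_t`, with density `exp (V_∞(0) - V_t)` with respect to the Gaussian
measure of covariance `C_∞ - C_t`. -/
def renormMeasure [MeasurableSpace X] (Cdot : ℝ → X →L[ℝ] X) (V₀ : X → ℝ) (t : ℝ) : Measure X :=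
  (gaussian (covInf Cdot - cov Cdot t)).withDensity fun ζ =>
    ENNReal.ofReal
      (Real.exp (smoothedPotential (covInf Cdot) V₀ 0) * Real.exp (- renormPotential Cdot V₀ t ζ))

/-- The rescaling `D_t = (1 - A C_t) ^ (-1/2)`. -/
def rescaling (A : X →L[ℝ] X) (Cdot : ℝ → X →L[ℝ] X) (t : ℝ) : X →L[ℝ] X :=
  Ring.inverse (opSqrt (1 - A * cov Cdot t))

/-- The rescaled renormalised measure `ν̂_t`, i.e. `E_ν̂_t [F (φ)] = E_ν_t [F (D_t φ)]`. -/
def rescaledMeasure [MeasurableSpace X] (A : X →L[ℝ] X) (Cdot : ℝ → X →L[ℝ] X) (V₀ : X → ℝ)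
    (t : ℝ) : Measure X :=
  (renormMeasure Cdot V₀ t).map (rescaling A Cdot t)

/-- `S` is the flow started from the identity of
`∂_t S_t(φ) = (1/2) D_t Ċ_t ∇V_t (D_t⁻¹ S_t(φ))`, for `t ≥ 0` (one-sided derivative at `t = 0`). -/
structure IsTransportFlow [MeasurableSpace X] (A : X →L[ℝ] X) (Cdot : ℝ → X →L[ℝ] X) (V₀ : X → ℝ)
    (S : ℝ → X → X) : Prop where
  init : ∀ φ, S 0 φ = φ
  evol : ∀ φ, ∀ t, 0 ≤ t →
    HasDerivWithinAt (fun s => S s φ)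
      ((1 / 2 : ℝ) • rescaling A Cdot t
        (Cdot t (∇ (renormPotential Cdot V₀ t) (Ring.inverse (rescaling A Cdot t) (S t φ)))))
      (Ici 0) t

/-- `Shat t` is the inverse of the time-`t` map of the flow, a differentiable bijection of `X`,
and it transports `ν̂_t` to `ν₀`. -/
structure IsInverseTransport [MeasurableSpace X] (A : X →L[ℝ] X) (Cdot : ℝ → X →L[ℝ] X)
    (V₀ : X → ℝ) (S Shat : ℝ → X → X) (t : ℝ) : Prop where
  left_inv : Function.LeftInverse (Shat t) (S t)
  right_inv : Function.RightInverse (Shat t) (S t)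
  differentiable : Differentiable ℝ (Shat t)
  transport : (rescaledMeasure A Cdot V₀ t).map (Shat t) = initialMeasure Cdot V₀

/-- The decomposition `Ċ_t = (tA + 1)⁻²`. -/
def resolventCdot (A : X →L[ℝ] X) (t : ℝ) : X →L[ℝ] X :=
  Ring.inverse ((t • A + 1) ^ 2)

/-- The decomposition `Ċ_t = exp (-tA)`. -/
def heatCdot (A : X →L[ℝ] X) (t : ℝ) : X →L[ℝ] X :=
  NormedSpace.exp (-(t • A))

end

end PolchinskiFlow

/-! In an eigenbasis of `A` the operators `Ċ_t`, `C_t` and `D_t` are diagonal, so their identities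
reduce to scalar ones, and `e^{-V_t}` is the heat extension `heatExp` of the bounded positive C²
function `F = e^{-V₀}` along the eigenvalues of `C_t`.

Contraction. Let `w` be the difference of two solutions and `N(t) = |w|² + t (w, Bw)`, where `B = A`
for the resolvent decomposition and `B = 0` for the heat decomposition. In both cases `(1 + tB) D_t
Ċ_t = D_t⁻¹`. Hence `N'` equals `(w, Bw)` plus `(D_t⁻¹w, Hess V_t D_t⁻¹w)`, with the Hessian
averaged over a segment, and the hypothesis, tested on a suitable vector, says `N' ≥ k N`. By
`mul_exp_integral_le`, `N(t) ≥ e^{∫k} |w(0)|²`: the flow expands, so its inverse obeys the stated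
bounds. `IsExpandingField` records what this part of the argument needs.

Transport. Up to a constant independent of `t`, the rescaled measure has Lebesgue density `e^{-(x,
Ax)/2} e^{-V_t(D_t⁻¹x)}`. Liouville's formula and the heat equation make this density along a
trajectory, times the Jacobian of the flow, constant in time (`hasDerivAt_rescaledDensity_mul_det`);
the change of variables formula concludes.

The work lies in assuming no growth bound on `V₀` or its derivatives. Regularity at time zero:
`exists_localization` cuts `F` off near a point. The far part contributes `O(t)` to gradient and
Hessian, so both are continuous up to `t = 0`. Global existence: a Gaussian average is log-convex up
to the quadratic form of `C_t⁻¹`, so `Hess V_t ≤ C_t⁻¹`. With the lower bound on `V_t` this gives a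
gradient of linear growth for `t ≥ ε` (`exists_gradient_heatPotential_le`); the initial interval is
handled by local existence. Surjectivity: read backwards, the expansion estimate bounds the distance
to a reference trajectory, which gives solutions with prescribed final value (`exists_backward`). -/

namespace PolchinskiFlow

open Filter Topology

set_option linter.unusedSectionVars false
set_option maxSynthPendingDepth 3

/-! ### Functional calculus in a fixed orthonormal basis. -/

section DiagonalOperators

variable {X : Type*} [NormedAddCommGroup X] [InnerProductSpace ℝ X]
  {ι : Type*} [Fintype ι] (e : OrthonormalBasis ι ℝ X)

/-- The operator with eigenvectors `e i` and eigenvalues `g i`. -/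
noncomputable def diagOp (g : ι → ℝ) : X →L[ℝ] X :=
  ∑ i, g i • InnerProductSpace.rankOne ℝ (e i) (e i)

lemma diagOp_apply (g : ι → ℝ) (x : X) : diagOp e g x = ∑ i, (g i * ⟪e i, x⟫) • e i := by
  simp [diagOp, smul_smul]

lemma inner_diagOp (g : ι → ℝ) (x : X) (i : ι) : ⟪e i, diagOp e g x⟫ = g i * ⟪e i, x⟫ := by
  classical
  simp [diagOp_apply, inner_sum, inner_smul_right, orthonormal_iff_ite.mp e.orthonormal]

lemma ext_coord {x y : X} (h : ∀ i, ⟪e i, x⟫ = ⟪e i, y⟫) : x = y := by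
  apply e.repr.injective
  ext i
  simpa [OrthonormalBasis.repr_apply_apply] using h i

lemma inner_eq_sum_coord (x y : X) : ⟪x, y⟫ = ∑ i, ⟪e i, x⟫ * ⟪e i, y⟫ := by
  rw [← e.sum_inner_mul_inner x y]
  exact Finset.sum_congr rfl fun i _ => by rw [real_inner_comm]

lemma norm_sq_eq_sum_coord (x : X) : ‖x‖ ^ 2 = ∑ i, ⟪e i, x⟫ ^ 2 := by
  rw [← real_inner_self_eq_norm_sq, inner_eq_sum_coord e]
  exact Finset.sum_congr rfl fun i _ => by ring

lemma inner_diagOp_right (g : ι → ℝ) (x y : X) :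
    ⟪x, diagOp e g y⟫ = ∑ i, g i * (⟪e i, x⟫ * ⟪e i, y⟫) := by
  rw [inner_eq_sum_coord e]
  exact Finset.sum_congr rfl fun i _ => by rw [inner_diagOp]; ring

lemma inner_diagOp_comm (g : ι → ℝ) (x y : X) : ⟪diagOp e g x, y⟫ = ⟪x, diagOp e g y⟫ := by
  rw [real_inner_comm, inner_diagOp_right, inner_diagOp_right]
  exact Finset.sum_congr rfl fun i _ => by ring

lemma diagOp_diagOp (g h : ι → ℝ) (x : X) : diagOp e g (diagOp e h x) = diagOp e (g * h) x := by
  refine ext_coord e fun i => ?_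
  simp [inner_diagOp, mul_assoc]

lemma diagOp_mul (g h : ι → ℝ) : diagOp e g * diagOp e h = diagOp e (g * h) := by
  ext x
  exact diagOp_diagOp e g h x

lemma diagOp_one : diagOp e 1 = 1 := by
  ext x
  exact ext_coord e fun i => by simp [inner_diagOp]

lemma diagOp_add (g h : ι → ℝ) : diagOp e g + diagOp e h = diagOp e (g + h) := by
  simp [diagOp, Finset.sum_add_distrib, add_smul]

lemma diagOp_sub (g h : ι → ℝ) : diagOp e g - diagOp e h = diagOp e (g - h) := by
  simp [diagOp, Finset.sum_sub_distrib, sub_smul]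

lemma diagOp_smul (r : ℝ) (g : ι → ℝ) : r • diagOp e g = diagOp e (r • g) := by
  simp [diagOp, Finset.smul_sum, smul_smul]

lemma diagOp_neg (g : ι → ℝ) : -diagOp e g = diagOp e (-g) := by
  simp [diagOp]

lemma diagOp_pow (g : ι → ℝ) (n : ℕ) : diagOp e g ^ n = diagOp e (g ^ n) := by
  induction n with
  | zero => simp [diagOp_one]
  | succ n ih => rw [pow_succ, pow_succ, ih, diagOp_mul]

lemma inverse_diagOp {g : ι → ℝ} (hg : ∀ i, g i ≠ 0) :
    Ring.inverse (diagOp e g) = diagOp e g⁻¹ := by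
  have h1 : diagOp e g * diagOp e g⁻¹ = 1 := by
    rw [diagOp_mul, ← diagOp_one e]; congr 1; ext i; simp [hg i]
  have h2 : diagOp e g⁻¹ * diagOp e g = 1 := by
    rw [diagOp_mul, ← diagOp_one e]; congr 1; ext i; simp [hg i]
  exact Ring.inverse_unit ⟨_, _, h1, h2⟩

/-- `g ↦ diagOp e g` as a continuous linear map. -/
noncomputable def diagCLM : (ι → ℝ) →L[ℝ] (X →L[ℝ] X) :=
  ∑ i, (ContinuousLinearMap.proj (R := ℝ) (φ := fun _ : ι => ℝ) i).smulRight
    (InnerProductSpace.rankOne ℝ (e i) (e i))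

lemma diagCLM_apply (g : ι → ℝ) : diagCLM e g = diagOp e g := by
  simp [diagCLM, diagOp]

lemma continuous_diagOp : Continuous (diagOp e) := by
  rw [show diagOp e = ⇑(diagCLM e) from funext fun g => (diagCLM_apply e g).symm]
  exact (diagCLM e).continuous

lemma hasDerivAt_diagOp {g : ℝ → ι → ℝ} {g' : ι → ℝ} {t : ℝ}
    (h : ∀ i, HasDerivAt (fun s => g s i) (g' i) t) :
    HasDerivAt (fun s => diagOp e (g s)) (diagOp e g') t := by
  have := (diagCLM e).hasFDerivAt.comp_hasDerivAt t (hasDerivAt_pi.2 h)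
  simpa [Function.comp_def, diagCLM_apply] using this

lemma integral_diagOp [CompleteSpace X] {μ : Measure ℝ} {g : ℝ → ι → ℝ}
    (h : ∀ i, Integrable (fun s => g s i) μ) :
    ∫ s, diagOp e (g s) ∂μ = diagOp e fun i => ∫ s, g s i ∂μ := by
  simp only [diagOp]
  rw [integral_finsetSum _ fun i _ => (h i).smul_const _]
  exact Finset.sum_congr rfl fun i _ => integral_smul_const _ _

/-- The exponential series converges coordinatewise in `ι → ℝ` and is pushed through the continuous
linear map `diagCLM`. -/
lemma exp_diagOp [CompleteSpace X] (g : ι → ℝ) :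
    NormedSpace.exp (diagOp e g) = diagOp e fun i => Real.exp (g i) := by
  rw [NormedSpace.exp_eq_tsum ℝ]
  have h1 : ∀ n : ℕ, ((n.factorial : ℝ)⁻¹) • diagOp e g ^ n
      = diagCLM e (((n.factorial : ℝ)⁻¹) • g ^ n) := fun n => by
    rw [diagCLM_apply, diagOp_pow, diagOp_smul]
  have h2 : HasSum (fun n : ℕ => ((n.factorial : ℝ)⁻¹) • g ^ n) fun i => Real.exp (g i) := by
    refine Pi.hasSum.2 fun i => ?_
    have := NormedSpace.exp_series_hasSum_exp' (𝕂 := ℝ) (g i)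
    rw [← Real.exp_eq_exp_ℝ] at this
    simpa using this
  simp only [h1]
  rw [((diagCLM e).hasSum h2).tsum_eq, diagCLM_apply]

lemma norm_diagOp_apply_le {g : ι → ℝ} {b : ℝ} (hb : 0 ≤ b) (hg : ∀ i, |g i| ≤ b) (x : X) :
    ‖diagOp e g x‖ ≤ b * ‖x‖ := by
  refine abs_le_of_sq_le_sq' ?_ (by positivity) |>.2
  rw [mul_pow, norm_sq_eq_sum_coord e, norm_sq_eq_sum_coord e, Finset.mul_sum]
  refine Finset.sum_le_sum fun i _ => ?_
  rw [inner_diagOp, mul_pow]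
  exact mul_le_mul_of_nonneg_right (sq_le_sq' (by linarith [abs_le.1 (hg i)]) (abs_le.1 (hg i)).2)
    (sq_nonneg _)

lemma diagOp_isSymmetric (g : ι → ℝ) : (diagOp e g : X →ₗ[ℝ] X).IsSymmetric :=
  fun x y => inner_diagOp_comm e g x y

/-- The square root computed through any eigenbasis agrees with `opSqrt`. -/
lemma opSqrt_diagOp [FiniteDimensional ℝ X] (g : ι → ℝ) :
    opSqrt (diagOp e g) = diagOp e fun i => √(g i) := by
  have hs := diagOp_isSymmetric e g
  rw [opSqrt, dif_pos hs]
  set b := hs.eigenvectorBasis rfl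
  set l := hs.eigenvalues rfl
  have key : ∀ i, diagOp e (fun i => √(g i)) (b i) = √(l i) • b i := by
    intro i
    have hb : diagOp e g (b i) = l i • b i := hs.apply_eigenvectorBasis rfl i
    refine ext_coord e fun j => ?_
    have := congrArg (fun x => ⟪e j, x⟫) hb
    simp only [inner_diagOp, inner_smul_right] at this ⊢
    -- If `e j` and `b i` are not orthogonal, comparing coordinates forces `g j = l i`; otherwise
    -- both sides vanish. Repeated eigenvalues thus need no separate treatment.
    by_cases h0 : ⟪e j, b i⟫ = 0
    · simp [h0]
    · rw [mul_right_cancel₀ h0 this]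
  change diagOp b (fun i => √(l i)) = _
  ext x
  rw [diagOp_apply]
  conv_rhs => rw [← b.sum_repr x]
  simp only [map_sum, map_smul, key, OrthonormalBasis.repr_apply_apply, smul_smul]
  exact Finset.sum_congr rfl fun i _ => by rw [mul_comm]

lemma det_diagOp (g : ι → ℝ) : (diagOp e g).det = ∏ i, g i := by
  classical
  rw [ContinuousLinearMap.det, ← LinearMap.det_toMatrix e.toBasis]
  have : LinearMap.toMatrix e.toBasis e.toBasis (diagOp e g : X →ₗ[ℝ] X) = Matrix.diagonal g := by
    ext i j
    rw [LinearMap.toMatrix_apply]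
    simp only [OrthonormalBasis.coe_toBasis, ContinuousLinearMap.coe_coe,
      OrthonormalBasis.coe_toBasis_repr_apply, OrthonormalBasis.repr_apply_apply]
    rw [inner_diagOp, orthonormal_iff_ite.mp e.orthonormal]
    by_cases h : i = j
    · subst h; simp
    · simp [h]
  rw [this, Matrix.det_diagonal]

/-- A symmetric positive definite operator is diagonal in an orthonormal basis. -/
lemma exists_eq_diagOp [FiniteDimensional ℝ X] {A : X →L[ℝ] X}
    (hA : ∀ x y : X, ⟪A x, y⟫ = ⟪x, A y⟫) (hpos : ∀ x : X, x ≠ 0 → 0 < ⟪x, A x⟫) :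
    ∃ (b : OrthonormalBasis (Fin (Module.finrank ℝ X)) ℝ X) (a : Fin (Module.finrank ℝ X) → ℝ),
      (∀ i, 0 < a i) ∧ A = diagOp b a := by
  have hs : (A : X →ₗ[ℝ] X).IsSymmetric := hA
  refine ⟨hs.eigenvectorBasis rfl, hs.eigenvalues rfl, fun i => ?_, ?_⟩
  · have h1 := hs.apply_eigenvectorBasis rfl i
    have h2 := hpos _ ((hs.eigenvectorBasis rfl).orthonormal.ne_zero i)
    rw [← ContinuousLinearMap.coe_coe, h1, inner_smul_right, real_inner_self_eq_norm_sq] at h2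
    simpa using h2
  · ext x
    rw [diagOp_apply]
    conv_lhs => rw [← (hs.eigenvectorBasis rfl).sum_repr x]
    simp only [map_sum, map_smul, OrthonormalBasis.repr_apply_apply]
    refine Finset.sum_congr rfl fun i _ => ?_
    rw [← ContinuousLinearMap.coe_coe, hs.apply_eigenvectorBasis rfl i]
    simp [smul_smul, mul_comm]

end DiagonalOperators

/-! ### Lebesgue densities of Gaussian measures. -/

section GaussianDensity

variable {X : Type*} [NormedAddCommGroup X] [InnerProductSpace ℝ X] [FiniteDimensional ℝ X]
  [MeasurableSpace X] [BorelSpace X]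

lemma integrable_exp_neg_mul_norm_sq {a : ℝ} (ha : 0 < a) :
    Integrable (fun y : X => Real.exp (-a * ‖y‖ ^ 2)) := by
  have := (GaussianFourier.integrable_cexp_neg_mul_sq_norm_add (V := X) (b := (a : ℂ))
    (by simpa using ha) 0 0).norm
  refine this.congr (Eventually.of_forall fun y => ?_)
  simp only [Complex.norm_exp]
  congr 1
  norm_cast
  simp

variable (X) in
/-- The normalising constant of the standard Gaussian density. -/
noncomputable def gaussNorm : ℝ := (∫ v : X, Real.exp (-(1 / 2) * ‖v‖ ^ 2))⁻¹

lemma gaussNorm_pos : 0 < gaussNorm X := by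
  rw [gaussNorm, inv_pos]
  exact integral_exp_pos (integrable_exp_neg_mul_norm_sq (by norm_num))

/-- Both measures are finite and have the same characteristic function. -/
lemma stdGaussian_eq_withDensity :
    stdGaussian X = (volume : Measure X).withDensity
      fun v => ENNReal.ofReal (gaussNorm X * Real.exp (-(1 / 2) * ‖v‖ ^ 2)) := by
  have hint : Integrable (fun v : X => gaussNorm X * Real.exp (-(1 / 2) * ‖v‖ ^ 2)) :=
    (integrable_exp_neg_mul_norm_sq (by norm_num)).const_mul _
  have : IsFiniteMeasure ((volume : Measure X).withDensity
      fun v => ENNReal.ofReal (gaussNorm X * Real.exp (-(1 / 2) * ‖v‖ ^ 2))) :=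
    isFiniteMeasure_withDensity_ofReal hint.2
  refine Measure.ext_of_charFun ?_
  funext t
  rw [charFun_stdGaussian, charFun_apply, integral_withDensity_eq_integral_toReal_smul
    (by fun_prop) (by simp)]
  have h1 : ∀ w : X, ∫ v : X, Complex.exp (-(1 / 2 : ℂ) * ‖v‖ ^ 2 + Complex.I * ⟪w, v⟫)
      = (Real.pi / (1 / 2 : ℂ)) ^ (Module.finrank ℝ X / 2 : ℂ)
        * Complex.exp (-‖w‖ ^ 2 / 2) := fun w => by
    rw [GaussianFourier.integral_cexp_neg_mul_sq_norm_add (by norm_num)]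
    congr 2
    rw [Complex.I_sq]
    ring
  -- At frequency zero the Fourier integral is the inverse of `gaussNorm X`, so the power of `2π`
  -- cancels without being evaluated.
  have h0 := h1 0
  have hN : ((gaussNorm X : ℝ) : ℂ) = (∫ v : X, Complex.exp (-(1 / 2 : ℂ) * ‖v‖ ^ 2))⁻¹ := by
    rw [gaussNorm, Complex.ofReal_inv, ← integral_complex_ofReal]
    congr 2
    funext v
    push_cast
    rfl
  have hN0 : (∫ v : X, Complex.exp (-(1 / 2 : ℂ) * ‖v‖ ^ 2)) ≠ 0 := by
    intro h
    rw [h, inv_zero] at hN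
    exact gaussNorm_pos.ne' (by exact_mod_cast hN)
  simp only [inner_zero_left, Complex.ofReal_zero, mul_zero, add_zero, norm_zero] at h0
  have h2 : ∀ v : X, (ENNReal.ofReal (gaussNorm X * Real.exp (-(1 / 2) * ‖v‖ ^ 2))).toReal •
      Complex.exp (⟪v, t⟫ * Complex.I)
      = (gaussNorm X : ℂ) * Complex.exp (-(1 / 2 : ℂ) * ‖v‖ ^ 2 + Complex.I * ⟪t, v⟫) := by
    intro v
    rw [ENNReal.toReal_ofReal (mul_nonneg gaussNorm_pos.le (Real.exp_pos _).le),
      Complex.exp_add, Complex.real_smul, real_inner_comm]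
    push_cast
    ring_nf
  simp only [h2]
  rw [integral_const_mul, h1, hN, h0]
  rw [h0] at hN0
  simp only [ne_eq, OfNat.ofNat_ne_zero, not_false_eq_true, zero_pow, neg_zero, zero_div,
    Complex.exp_zero, mul_one] at hN0 ⊢
  field_simp

variable {ι : Type*} [Fintype ι] (e : OrthonormalBasis ι ℝ X)

/-- The density at `y` of the Gaussian measure centred at `z` whose covariance has eigenvalues
`c` in the basis `e`. -/
noncomputable def heatKernel (c : ι → ℝ) (z y : X) : ℝ :=
  gaussNorm X * (∏ i, √(c i))⁻¹ *
    Real.exp (-(1 / 2) * ∑ i, (⟪e i, y⟫ - ⟪e i, z⟫) ^ 2 / c i)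

lemma heatKernel_pos {c : ι → ℝ} (hc : ∀ i, 0 < c i) (z y : X) : 0 < heatKernel e c z y := by
  have : 0 < ∏ i, √(c i) := Finset.prod_pos fun i _ => Real.sqrt_pos.2 (hc i)
  have := gaussNorm_pos (X := X)
  unfold heatKernel
  positivity

lemma continuous_heatKernel (c : ι → ℝ) (z : X) : Continuous (heatKernel e c z) := by
  unfold heatKernel
  fun_prop

/-- The substitution `y = z + C^{1/2} ξ` has Jacobian `∏ √(c i)` and turns `‖ξ‖²` into the quadratic
form of `C⁻¹` at `y - z`. -/
lemma map_affine_stdGaussian {c : ι → ℝ} (hc : ∀ i, 0 < c i) (z : X) :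
    (stdGaussian X).map (fun ξ => z + diagOp e (fun i => √(c i)) ξ) =
      (volume : Measure X).withDensity fun y => ENNReal.ofReal (heatKernel e c z y) := by
  have hP : 0 < ∏ i, √(c i) := Finset.prod_pos fun i _ => Real.sqrt_pos.2 (hc i)
  set L := diagOp e fun i => √(c i) with hL
  have hdet : LinearMap.det (L : X →ₗ[ℝ] X) = ∏ i, √(c i) := det_diagOp e _
  refine Measure.ext_of_lintegral _ fun g hg => ?_
  have hm : Measurable fun y => ENNReal.ofReal (heatKernel e c z y) :=
    (continuous_heatKernel e c z).measurable.ennreal_ofReal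
  rw [lintegral_map hg (by fun_prop), stdGaussian_eq_withDensity,
    lintegral_withDensity_eq_lintegral_mul _ (by fun_prop) (by fun_prop),
    lintegral_withDensity_eq_lintegral_mul _ hm hg]
  have h1 : ∀ ξ : X, ENNReal.ofReal (gaussNorm X * Real.exp (-(1 / 2) * ‖ξ‖ ^ 2)) =
      ENNReal.ofReal (∏ i, √(c i)) * ENNReal.ofReal (heatKernel e c z (z + L ξ)) := by
    intro ξ
    rw [← ENNReal.ofReal_mul hP.le, heatKernel, norm_sq_eq_sum_coord e]
    congr 1
    have : ∀ i, (⟪e i, z + L ξ⟫ - ⟪e i, z⟫) ^ 2 / c i = ⟪e i, ξ⟫ ^ 2 := by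
      intro i
      rw [inner_add_right, hL, inner_diagOp, add_sub_cancel_left, mul_pow,
        Real.sq_sqrt (hc i).le]
      field_simp [(hc i).ne']
    simp only [this]
    field_simp
  simp only [Pi.mul_apply, h1]
  set G : X → ENNReal := fun y => ENNReal.ofReal (heatKernel e c z y) * g y with hG
  have hGm : Measurable G := hm.mul hg
  have h2 : ∫⁻ ξ : X, G (z + L ξ) = ENNReal.ofReal |(∏ i, √(c i))⁻¹| * ∫⁻ y, G y := by
    have h3 := lintegral_map (μ := (volume : Measure X)) (f := fun w => G (z + w)) (g := L)
      (by fun_prop) (by fun_prop)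
    rw [← h3, show ⇑L = ⇑(L : X →ₗ[ℝ] X) from rfl,
      Measure.map_linearMap_addHaar_eq_smul_addHaar volume (by rw [hdet]; exact hP.ne'),
      lintegral_smul_measure, hdet, lintegral_add_left_eq_self, smul_eq_mul]
  calc _ = ENNReal.ofReal (∏ i, √(c i)) * ∫⁻ ξ : X, G (z + L ξ) := by
        rw [← lintegral_const_mul _ (by fun_prop)]
        simp only [hG, mul_assoc]
    _ = _ := by
        rw [h2, ← mul_assoc, ← ENNReal.ofReal_mul hP.le, abs_of_pos (inv_pos.2 hP),
          mul_inv_cancel₀ hP.ne', ENNReal.ofReal_one, one_mul]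

lemma integral_affine_stdGaussian {E : Type*} [NormedAddCommGroup E] [NormedSpace ℝ E]
    {c : ι → ℝ} (hc : ∀ i, 0 < c i) (z : X) {f : X → E} (hf : Continuous f) :
    ∫ ξ, f (z + diagOp e (fun i => √(c i)) ξ) ∂stdGaussian X =
      ∫ y, heatKernel e c z y • f y := by
  rw [← integral_map (φ := fun ξ => z + diagOp e (fun i => √(c i)) ξ) (by fun_prop)
    hf.aestronglyMeasurable, map_affine_stdGaussian e hc,
    integral_withDensity_eq_integral_toReal_smul
      (continuous_heatKernel e c z).measurable.ennreal_ofReal (by simp)]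
  simp only [ENNReal.toReal_ofReal (heatKernel_pos e hc z _).le]

lemma integral_gaussian_diagOp {E : Type*} [NormedAddCommGroup E] [NormedSpace ℝ E]
    (c : ι → ℝ) {f : X → E} (hf : Continuous f) :
    ∫ ζ, f ζ ∂gaussian (diagOp e c) =
      ∫ ξ, f (diagOp e (fun i => √(c i)) ξ) ∂stdGaussian X := by
  rw [gaussian, opSqrt_diagOp, integral_map (by fun_prop) hf.aestronglyMeasurable]

end GaussianDensity

/-! ### Derivatives and uniform bounds of the heat kernel in covariance and centre. -/

section HeatKernelBounds

variable {X : Type*} [NormedAddCommGroup X] [InnerProductSpace ℝ X] [FiniteDimensional ℝ X]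
  [MeasurableSpace X] [BorelSpace X] {ι : Type*} [Fintype ι] (e : OrthonormalBasis ι ℝ X)

/-- Since `(1 + r)^n ≤ e^{nr}`, completing the square absorbs the polynomial into half of the
Gaussian exponent. -/
lemma integrable_one_add_norm_pow_mul_exp {a : ℝ} (ha : 0 < a) (C : ℝ) (n : ℕ) :
    Integrable (fun y : X => C * ((1 + ‖y‖) ^ n * Real.exp (-a * ‖y‖ ^ 2))) := by
  refine Integrable.const_mul ?_ C
  have hi := (integrable_exp_neg_mul_norm_sq (X := X) (half_pos ha)).const_mul
    (Real.exp (n ^ 2 / (2 * a)))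
  refine hi.mono' (by fun_prop) (Eventually.of_forall fun y => ?_)
  rw [Real.norm_of_nonneg (by positivity)]
  have h1 : (1 + ‖y‖) ^ n ≤ Real.exp (n * ‖y‖) := by
    rw [mul_comm, Real.exp_mul, Real.rpow_natCast]
    exact pow_le_pow_left₀ (by positivity) (by linarith [Real.add_one_le_exp ‖y‖]) n
  calc (1 + ‖y‖) ^ n * Real.exp (-a * ‖y‖ ^ 2)
      ≤ Real.exp (n * ‖y‖) * Real.exp (-a * ‖y‖ ^ 2) := by gcongr
    _ = Real.exp (n * ‖y‖ - a * ‖y‖ ^ 2) := by rw [← Real.exp_add]; ring_nf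
    _ ≤ Real.exp (n ^ 2 / (2 * a) + -(a / 2) * ‖y‖ ^ 2) := by
        apply Real.exp_le_exp.2
        have : n ^ 2 / (2 * a) + -(a / 2) * ‖y‖ ^ 2 - (n * ‖y‖ - a * ‖y‖ ^ 2)
          = (a / 2) * (‖y‖ - n / a) ^ 2 := by field_simp; ring
        have h : 0 ≤ (a / 2) * (‖y‖ - n / a) ^ 2 := by positivity
        linarith
    _ = _ := by rw [Real.exp_add]

/-- Covariances with eigenvalues in `(r, b)` and centres of norm less than `b`. -/
def heatBox (X ι : Type*) [NormedAddCommGroup X] (r b : ℝ) : Set ((ι → ℝ) × X) :=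
  {q | (∀ i, r < q.1 i ∧ q.1 i < b) ∧ ‖q.2‖ < b}

lemma isOpen_heatBox (r b : ℝ) : IsOpen (heatBox X ι r b) := by
  have : heatBox X ι r b =
      (⋂ i, {q : (ι → ℝ) × X | r < q.1 i ∧ q.1 i < b}) ∩ {q | ‖q.2‖ < b} := by
    ext q; simp [heatBox]
  rw [this]
  refine (isOpen_iInter_of_finite fun i => ?_).inter (isOpen_lt (by fun_prop) (by fun_prop))
  have hi : Continuous fun q : (ι → ℝ) × X => q.1 i := by fun_prop
  exact (isOpen_lt continuous_const hi).inter (isOpen_lt hi continuous_const)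

lemma exists_mem_heatBox {c : ι → ℝ} (hc : ∀ i, 0 < c i) (z : X) :
    ∃ r b : ℝ, 0 < r ∧ 0 < b ∧ (c, z) ∈ heatBox X ι r b := by
  obtain ⟨r, hr, hrc⟩ : ∃ r : ℝ, 0 < r ∧ ∀ i, r < c i := by
    rcases isEmpty_or_nonempty ι with h | h
    · exact ⟨1, one_pos, fun i => h.elim i⟩
    · obtain ⟨j, hj⟩ := Finite.exists_min c
      exact ⟨c j / 2, half_pos (hc j), fun i => by linarith [hc j, hj i]⟩
  refine ⟨r, ‖c‖ + ‖z‖ + 1, hr, by positivity, fun i => ⟨hrc i, ?_⟩, ?_⟩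
  · have := (le_abs_self _).trans (norm_le_pi_norm c i)
    have := norm_nonneg z
    linarith
  · have := norm_nonneg c
    change ‖z‖ < _
    linarith

/-- The logarithmic gradient of the heat kernel with respect to the centre. -/
noncomputable def heatScore (c : ι → ℝ) (z y : X) : X := diagOp e c⁻¹ (y - z)

lemma inner_heatScore (c : ι → ℝ) (z y : X) (i : ι) :
    ⟪e i, heatScore e c z y⟫ = (⟪e i, y⟫ - ⟪e i, z⟫) / c i := by
  simp [heatScore, inner_diagOp, inner_sub_right, div_eq_inv_mul, mul_sub]

lemma norm_heatScore_le {r b : ℝ} (hr : 0 < r) (hb : 0 < b) {q : (ι → ℝ) × X}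
    (hq : q ∈ heatBox X ι r b) (y : X) :
    ‖heatScore e q.1 q.2 y‖ ≤ (r⁻¹ * (1 + b)) * (1 + ‖y‖) := by
  have h1 : ‖heatScore e q.1 q.2 y‖ ≤ r⁻¹ * ‖y - q.2‖ := by
    refine norm_diagOp_apply_le e (by positivity) (fun i => ?_) _
    have h := (hq.1 i).1
    rw [Pi.inv_apply, abs_of_pos (inv_pos.2 (hr.trans h))]
    exact inv_anti₀ hr h.le
  have h2 : ‖y - q.2‖ ≤ (1 + b) * (1 + ‖y‖) := by
    have := norm_sub_le y q.2
    have := hq.2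
    nlinarith [norm_nonneg y]
  calc _ ≤ r⁻¹ * ((1 + b) * (1 + ‖y‖)) := h1.trans (by gcongr)
    _ = _ := by ring

/-- Dominated differentiation in covariance and centre needs one majorant for the whole box. The
lower bound `r` on the eigenvalues controls the normalisation, the upper bound `b` the rate of
decay. -/
lemma heatKernel_le {r b : ℝ} (hr : 0 < r) (hb : 0 < b) {q : (ι → ℝ) × X}
    (hq : q ∈ heatBox X ι r b) (y : X) :
    heatKernel e q.1 q.2 y ≤
      (gaussNorm X * (∏ _i : ι, √r)⁻¹ * Real.exp (b / 2)) *
        Real.exp (-(1 / (4 * b)) * ‖y‖ ^ 2) := by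
  have hN := gaussNorm_pos (X := X)
  have hs : 0 < √r := Real.sqrt_pos.2 hr
  have h1 : ∏ _i : ι, √r ≤ ∏ i, √(q.1 i) :=
    Finset.prod_le_prod (fun _ _ => hs.le) fun i _ => Real.sqrt_le_sqrt (hq.1 i).1.le
  have h0 : 0 < ∏ _i : ι, √r := Finset.prod_pos fun _ _ => hs
  have h2 : b⁻¹ * ‖y - q.2‖ ^ 2 ≤ ∑ i, (⟪e i, y⟫ - ⟪e i, q.2⟫) ^ 2 / q.1 i := by
    rw [norm_sq_eq_sum_coord e, Finset.mul_sum]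
    refine Finset.sum_le_sum fun i _ => ?_
    rw [inner_sub_right, div_eq_inv_mul]
    gcongr
    · exact hr.trans (hq.1 i).1
    · exact (hq.1 i).2.le
  have h3 : ‖y‖ ^ 2 ≤ 2 * ‖y - q.2‖ ^ 2 + 2 * b ^ 2 := by
    have h4 : ‖y‖ ≤ ‖y - q.2‖ + b := by
      have := norm_sub_norm_le y q.2
      linarith [hq.2]
    nlinarith [norm_nonneg y, norm_nonneg (y - q.2), sq_nonneg (‖y - q.2‖ - b)]
  have h5 : -(1 / 2) * ∑ i, (⟪e i, y⟫ - ⟪e i, q.2⟫) ^ 2 / q.1 i ≤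
      b / 2 + -(1 / (4 * b)) * ‖y‖ ^ 2 := by
    have h6 : -(1 / 2) * (b⁻¹ * ‖y - q.2‖ ^ 2) ≤ b / 2 + -(1 / (4 * b)) * ‖y‖ ^ 2 := by
      have : b / 2 + -(1 / (4 * b)) * ‖y‖ ^ 2 - -(1 / 2) * (b⁻¹ * ‖y - q.2‖ ^ 2)
        = (1 / (4 * b)) * (2 * ‖y - q.2‖ ^ 2 + 2 * b ^ 2 - ‖y‖ ^ 2) := by
        field_simp; ring
      have h7 : 0 ≤ (1 / (4 * b)) * (2 * ‖y - q.2‖ ^ 2 + 2 * b ^ 2 - ‖y‖ ^ 2) :=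
        mul_nonneg (by positivity) (by linarith)
      linarith
    linarith
  rw [mul_assoc, ← Real.exp_add]
  unfold heatKernel
  gcongr

lemma continuous_heatScore (c : ι → ℝ) (z : X) : Continuous (heatScore e c z) := by
  unfold heatScore
  fun_prop

/-- The logarithmic derivative of the heat kernel in the eigenvalues and the centre. -/
noncomputable def heatLogDeriv (q : (ι → ℝ) × X) (y : X) : (ι → ℝ) × X →L[ℝ] ℝ :=
  ∑ i, ((1 / 2 * (⟪e i, heatScore e q.1 q.2 y⟫ ^ 2 - (q.1 i)⁻¹)) •
      (ContinuousLinearMap.proj (R := ℝ) (φ := fun _ : ι => ℝ) i ∘L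
        ContinuousLinearMap.fst ℝ (ι → ℝ) X) +
    ⟪e i, heatScore e q.1 q.2 y⟫ • (innerSL ℝ (e i) ∘L ContinuousLinearMap.snd ℝ (ι → ℝ) X))

lemma heatLogDeriv_apply (q : (ι → ℝ) × X) (y : X) (d : (ι → ℝ) × X) :
    heatLogDeriv e q y d = ∑ i, 1 / 2 * (⟪e i, heatScore e q.1 q.2 y⟫ ^ 2 - (q.1 i)⁻¹) * d.1 i
      + ⟪heatScore e q.1 q.2 y, d.2⟫ := by
  rw [inner_eq_sum_coord e, ← Finset.sum_add_distrib]
  simp [heatLogDeriv]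

/-- Taking logarithms turns the normalising product into a sum, so the kernel is a constant times
`exp ψ`. This form holds only where the eigenvalues are positive, hence the detour through eventual
equality. -/
lemma hasFDerivAt_heatKernel {q : (ι → ℝ) × X} (hq : ∀ i, 0 < q.1 i) (y : X) :
    HasFDerivAt (fun p : (ι → ℝ) × X => heatKernel e p.1 p.2 y)
      (heatKernel e q.1 q.2 y • heatLogDeriv e q y) q := by
  have hev : ∀ᶠ p : (ι → ℝ) × X in 𝓝 q, ∀ i, 0 < p.1 i :=
    eventually_all.2 fun i => (continuous_apply i |>.comp continuous_fst).continuousAt.eventually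
      (lt_mem_nhds (hq i))
  set ψ : (ι → ℝ) × X → ℝ := fun p =>
    ∑ i, (-(1 / 2) * Real.log (p.1 i) + -(1 / 2) * ((⟪e i, y⟫ - ⟪e i, p.2⟫) ^ 2 * (p.1 i)⁻¹)) with hψ
  have hk : ∀ p : (ι → ℝ) × X, (∀ i, 0 < p.1 i) →
      heatKernel e p.1 p.2 y = gaussNorm X * Real.exp (ψ p) := by
    intro p hp
    simp only [hψ]
    rw [Finset.sum_add_distrib, Real.exp_add, Real.exp_sum, heatKernel, mul_assoc,
      ← Finset.prod_inv_distrib, ← Finset.mul_sum]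
    congr 2
    refine Finset.prod_congr rfl fun i _ => ?_
    rw [Real.sqrt_eq_rpow, ← Real.rpow_neg (hp i).le, Real.rpow_def_of_pos (hp i)]
    ring_nf
  have hd : HasFDerivAt ψ (heatLogDeriv e q y) q := by
    unfold heatLogDeriv
    refine HasFDerivAt.fun_sum fun i _ => ?_
    have h1 : HasFDerivAt (fun p : (ι → ℝ) × X => p.1 i)
        (ContinuousLinearMap.proj (R := ℝ) (φ := fun _ : ι => ℝ) i ∘L
          ContinuousLinearMap.fst ℝ (ι → ℝ) X) q :=
      (ContinuousLinearMap.proj (R := ℝ) (φ := fun _ : ι => ℝ) i ∘L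
          ContinuousLinearMap.fst ℝ (ι → ℝ) X).hasFDerivAt
    have h2 : HasFDerivAt (fun p : (ι → ℝ) × X => ⟪e i, p.2⟫)
        (innerSL ℝ (e i) ∘L ContinuousLinearMap.snd ℝ (ι → ℝ) X) q :=
      (innerSL ℝ (e i) ∘L ContinuousLinearMap.snd ℝ (ι → ℝ) X).hasFDerivAt
    have h3 := ((h1.log (hq i).ne').const_mul (-(1 / 2))).add
      (((((h2.const_sub ⟪e i, y⟫).pow 2).mul
        ((hasFDerivAt_inv (hq i).ne').comp q h1))).const_mul (-(1 / 2)))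
    refine h3.congr_fderiv ?_
    refine ContinuousLinearMap.ext fun d => ?_
    have := (hq i).ne'
    simp [inner_heatScore]
    field_simp
    ring
  have := (hd.exp.const_mul (gaussNorm X)).congr_of_eventuallyEq
    (hev.mono fun p hp => hk p hp)
  rwa [smul_smul, ← hk q hq] at this

lemma hasFDerivAt_heatKernel_center {c : ι → ℝ} (hc : ∀ i, 0 < c i) (z y : X) :
    HasFDerivAt (fun x => heatKernel e c x y)
      (heatKernel e c z y • innerSL ℝ (heatScore e c z y)) z := by
  have h := (hasFDerivAt_heatKernel e (q := (c, z)) hc y).comp z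
    ((hasFDerivAt_const c z).prodMk (hasFDerivAt_id z))
  refine h.congr_fderiv (ContinuousLinearMap.ext fun d => ?_)
  simp [heatLogDeriv_apply]

lemma hasFDerivAt_heatScore_center (c : ι → ℝ) (z y : X) :
    HasFDerivAt (fun x => heatScore e c x y) (-diagOp e c⁻¹) z := by
  have := (diagOp e c⁻¹).hasFDerivAt.comp z ((hasFDerivAt_id z).const_sub y)
  refine this.congr_fderiv (ContinuousLinearMap.ext fun d => ?_)
  simp

/-- The second logarithmic coefficient of the heat kernel: the Hessian in the centre is
`heatKernel • heatWeight`. -/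
noncomputable def heatWeight (c : ι → ℝ) (z y : X) : X →L[ℝ] X :=
  InnerProductSpace.rankOne ℝ (heatScore e c z y) (heatScore e c z y) - diagOp e c⁻¹

lemma inner_heatWeight (c : ι → ℝ) (z y : X) (i : ι) :
    ⟪e i, heatWeight e c z y (e i)⟫ = ⟪e i, heatScore e c z y⟫ ^ 2 - (c i)⁻¹ := by
  simp [heatWeight, inner_sub_right, inner_diagOp, inner_smul_right, real_inner_comm, sq]

end HeatKernelBounds

/-! ### Heat extensions: differentiation under the integral and the heat equation. -/

section HeatIntegrals

variable {X : Type*} [NormedAddCommGroup X] [InnerProductSpace ℝ X] [FiniteDimensional ℝ X]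
  [MeasurableSpace X] [BorelSpace X] {ι : Type*} [Fintype ι] (e : OrthonormalBasis ι ℝ X)

/-- This is the majorant for all kernel integrals below: bounded `F`, a coefficient of at most
quadratic growth, and the Gaussian bound `heatKernel_le`. -/
lemma heatKernel_smul_le {E : Type*} [NormedAddCommGroup E] [NormedSpace ℝ E]
    {r b : ℝ} (hr : 0 < r) (hb : 0 < b) {F : X → ℝ} {M : ℝ} (hF : ∀ y, |F y| ≤ M)
    {D : ℝ} {q : (ι → ℝ) × X} (hq : q ∈ heatBox X ι r b) (y : X) {G : E}
    (hG : ‖G‖ ≤ D * (1 + ‖y‖) ^ 2) :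
    ‖(heatKernel e q.1 q.2 y * F y) • G‖ ≤
      (gaussNorm X * (∏ _i : ι, √r)⁻¹ * Real.exp (b / 2) * M * D) *
        ((1 + ‖y‖) ^ 2 * Real.exp (-(1 / (4 * b)) * ‖y‖ ^ 2)) := by
  have h1 := heatKernel_le e hr hb hq y
  have h0 := (heatKernel_pos e (fun i => hr.trans (hq.1 i).1) q.2 y).le
  rw [norm_smul, norm_mul, Real.norm_of_nonneg h0, Real.norm_eq_abs]
  calc heatKernel e q.1 q.2 y * |F y| * ‖G‖
      ≤ ((gaussNorm X * (∏ _i : ι, √r)⁻¹ * Real.exp (b / 2)) *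
        Real.exp (-(1 / (4 * b)) * ‖y‖ ^ 2)) * M * (D * (1 + ‖y‖) ^ 2) := by
        have hM : 0 ≤ M := (abs_nonneg _).trans (hF y)
        have := h0.trans h1
        exact mul_le_mul (mul_le_mul h1 (hF y) (abs_nonneg _) this) hG (norm_nonneg _)
          (mul_nonneg this hM)
    _ = _ := by ring

/-- On the box the inverse eigenvalues are at most `r⁻¹`, so the score grows linearly and the other
two coefficients quadratically. One quadratic bound is kept for all three. -/
lemma exists_bound_heat_coefficients {r b : ℝ} (hr : 0 < r) (hb : 0 < b) :
    ∃ D : ℝ, 1 ≤ D ∧ ∀ q ∈ heatBox X ι r b, ∀ y : X,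
      ‖heatScore e q.1 q.2 y‖ ≤ D * (1 + ‖y‖) ^ 2 ∧
      ‖heatWeight e q.1 q.2 y‖ ≤ D * (1 + ‖y‖) ^ 2 ∧
      ‖heatLogDeriv e q y‖ ≤ D * (1 + ‖y‖) ^ 2 := by
  set B : ℝ := r⁻¹ * (1 + b) with hB
  have hB0 : 0 < B := by positivity
  set N : ℝ := ∑ i, (1 / 2 * (B ^ 2 + r⁻¹) *
    ‖(ContinuousLinearMap.proj (R := ℝ) (φ := fun _ : ι => ℝ) i ∘L
        ContinuousLinearMap.fst ℝ (ι → ℝ) X)‖ +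
      B * ‖(innerSL ℝ (e i) ∘L ContinuousLinearMap.snd ℝ (ι → ℝ) X)‖) with hN
  have hN0 : 0 ≤ N := Finset.sum_nonneg fun i _ => by positivity
  have hr' : 0 < r⁻¹ := inv_pos.2 hr
  refine ⟨1 + B + B ^ 2 + r⁻¹ + N, by nlinarith, fun q hq y => ?_⟩
  have hS := norm_heatScore_le e hr hb hq y
  have h1 : 1 ≤ (1 + ‖y‖) := by linarith [norm_nonneg y]
  have h2 : (1 + ‖y‖) ≤ (1 + ‖y‖) ^ 2 := by nlinarith
  have h3 : 1 ≤ (1 + ‖y‖) ^ 2 := h1.trans h2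
  have hS2 : ‖heatScore e q.1 q.2 y‖ ≤ B * (1 + ‖y‖) ^ 2 := hS.trans (by gcongr)
  have hSs : ‖heatScore e q.1 q.2 y‖ ^ 2 ≤ B ^ 2 * (1 + ‖y‖) ^ 2 := by
    rw [← mul_pow]; gcongr
  have hinv : ∀ i, |(q.1 i)⁻¹| ≤ r⁻¹ := fun i => by
    have h := (hq.1 i).1
    rw [abs_of_pos (inv_pos.2 (hr.trans h))]
    exact inv_anti₀ hr h.le
  refine ⟨hS2.trans ?_, ?_, ?_⟩
  · gcongr
    nlinarith
  · have hd : ‖diagOp e (q.1)⁻¹‖ ≤ r⁻¹ :=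
      ContinuousLinearMap.opNorm_le_bound _ hr'.le fun x =>
        norm_diagOp_apply_le e hr'.le hinv x
    calc ‖heatWeight e q.1 q.2 y‖ ≤ ‖heatScore e q.1 q.2 y‖ ^ 2 + r⁻¹ := by
          refine (norm_sub_le _ _).trans (add_le_add ?_ hd)
          rw [InnerProductSpace.norm_rankOne, sq]
      _ ≤ B ^ 2 * (1 + ‖y‖) ^ 2 + r⁻¹ * (1 + ‖y‖) ^ 2 := by
          gcongr
          exact le_mul_of_one_le_right hr'.le h3
      _ ≤ _ := by
          rw [← add_mul]
          exact mul_le_mul_of_nonneg_right (by nlinarith) (by positivity)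
  · have hc : ∀ i, |⟪e i, heatScore e q.1 q.2 y⟫| ≤ ‖heatScore e q.1 q.2 y‖ := fun i => by
      simpa using abs_real_inner_le_norm (e i) (heatScore e q.1 q.2 y)
    calc ‖heatLogDeriv e q y‖ ≤ N * (1 + ‖y‖) ^ 2 := by
          unfold heatLogDeriv
          rw [hN, Finset.sum_mul]
          refine norm_sum_le_of_le _ fun i _ => (norm_add_le _ _).trans ?_
          rw [norm_smul, norm_smul, add_mul]
          refine add_le_add ?_ ?_
          · rw [mul_right_comm]
            refine mul_le_mul_of_nonneg_right ?_ (norm_nonneg _)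
            rw [norm_mul, Real.norm_eq_abs, Real.norm_eq_abs, mul_assoc, abs_of_pos (by norm_num)]
            refine mul_le_mul_of_nonneg_left ?_ (by norm_num)
            calc _ ≤ |⟪e i, heatScore e q.1 q.2 y⟫ ^ 2| + |(q.1 i)⁻¹| := abs_sub _ _
              _ ≤ B ^ 2 * (1 + ‖y‖) ^ 2 + r⁻¹ * (1 + ‖y‖) ^ 2 := by
                refine add_le_add ?_ ((hinv i).trans (le_mul_of_one_le_right hr'.le h3))
                rw [abs_pow]
                exact (pow_le_pow_left₀ (abs_nonneg _) (hc i) 2).trans hSs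
              _ = _ := by ring
          · rw [mul_right_comm]
            refine mul_le_mul_of_nonneg_right ?_ (norm_nonneg _)
            exact (hc i).trans hS2
      _ ≤ _ := by gcongr; nlinarith

/-- The heat extension of `F`. -/
noncomputable def heatInt (F : X → ℝ) (c : ι → ℝ) (z : X) : ℝ :=
  ∫ y, heatKernel e c z y * F y

/-- The spatial gradient of the heat extension of `F`. -/
noncomputable def heatGrad (F : X → ℝ) (c : ι → ℝ) (z : X) : X :=
  ∫ y, (heatKernel e c z y * F y) • heatScore e c z y

/-- The spatial Hessian of the heat extension of `F`. -/
noncomputable def heatHess (F : X → ℝ) (c : ι → ℝ) (z : X) : X →L[ℝ] X :=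
  ∫ y, (heatKernel e c z y * F y) • heatWeight e c z y

variable {F : X → ℝ} (hFc : Continuous F) {M : ℝ} (hF : ∀ y, |F y| ≤ M)

lemma continuous_heatWeight (c : ι → ℝ) (z : X) : Continuous (heatWeight e c z) := by
  have := continuous_heatScore e c z
  unfold heatWeight
  simp only [InnerProductSpace.rankOne_def]
  refine Continuous.sub ?_ continuous_const
  have h1 : Continuous fun p : X × X =>
      (ContinuousLinearMap.smulRightL ℝ X X (innerSL ℝ p.1)) p.2 := by fun_prop
  exact h1.comp (this.prodMk this)

lemma continuous_heatLogDeriv (q : (ι → ℝ) × X) : Continuous (heatLogDeriv e q) := by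
  have := continuous_heatScore e q.1 q.2
  unfold heatLogDeriv
  fun_prop

include hFc hF

lemma integrable_heat {E : Type*} [NormedAddCommGroup E] [NormedSpace ℝ E]
    [FiniteDimensional ℝ E] {c : ι → ℝ} (hc : ∀ i, 0 < c i) (z : X) {G : X → E}
    (hG : Continuous G) {D : ℝ} (hD : ∀ y, ‖G y‖ ≤ D * (1 + ‖y‖) ^ 2) :
    Integrable fun y => (heatKernel e c z y * F y) • G y := by
  obtain ⟨r, b, hr, hb, hq⟩ := exists_mem_heatBox hc z
  have hk := continuous_heatKernel e c z
  exact (integrable_one_add_norm_pow_mul_exp (by positivity) _ 2).mono'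
    (by fun_prop) (Eventually.of_forall fun y => heatKernel_smul_le e hr hb hF hq y (hD y))

lemma integrable_heat_one {c : ι → ℝ} (hc : ∀ i, 0 < c i) (z : X) :
    Integrable fun y => heatKernel e c z y * F y := by
  have := integrable_heat e hFc hF hc z (G := fun _ => (1 : ℝ)) continuous_const (D := 1)
    (fun y => by rw [norm_one, one_mul]; nlinarith [norm_nonneg y])
  simpa using this

lemma integrable_heat_coefficients {c : ι → ℝ} (hc : ∀ i, 0 < c i) (z : X) :
    (Integrable fun y => (heatKernel e c z y * F y) • heatScore e c z y) ∧
    (Integrable fun y => (heatKernel e c z y * F y) • heatWeight e c z y) ∧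
    (Integrable fun y => (heatKernel e c z y * F y) • heatLogDeriv e (c, z) y) := by
  obtain ⟨r, b, hr, hb, hq⟩ := exists_mem_heatBox hc z
  obtain ⟨D, -, hD⟩ := exists_bound_heat_coefficients e (X := X) hr hb
  exact ⟨integrable_heat e hFc hF hc z (continuous_heatScore e c z) fun y => (hD _ hq y).1,
    integrable_heat e hFc hF hc z (continuous_heatWeight e c z) fun y => (hD _ hq y).2.1,
    integrable_heat e hFc hF hc z (continuous_heatLogDeriv e (c, z)) fun y => (hD _ hq y).2.2⟩

/-- Joint derivative of the heat extension in the eigenvalues and the centre; the first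
component is the heat equation. -/
lemma hasFDerivAt_heatInt {c : ι → ℝ} (hc : ∀ i, 0 < c i) (z : X) :
    ∃ T : (ι → ℝ) × X →L[ℝ] ℝ,
      HasFDerivAt (fun p : (ι → ℝ) × X => heatInt e F p.1 p.2) T (c, z) ∧
      ∀ d, T d = ∑ i, 1 / 2 * ⟪e i, heatHess e F c z (e i)⟫ * d.1 i + ⟪heatGrad e F c z, d.2⟫ := by
  obtain ⟨r, b, hr, hb, hq⟩ := exists_mem_heatBox hc z
  obtain ⟨D, -, hD⟩ := exists_bound_heat_coefficients e (X := X) hr hb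
  obtain ⟨hi1, hi2, hi3⟩ := integrable_heat_coefficients e hFc hF hc z
  refine ⟨∫ y, (heatKernel e c z y * F y) • heatLogDeriv e (c, z) y, ?_, fun d => ?_⟩
  · refine hasFDerivAt_integral_of_dominated_of_fderiv_le
      (F := fun (p : (ι → ℝ) × X) y => heatKernel e p.1 p.2 y * F y)
      (F' := fun (p : (ι → ℝ) × X) y => (heatKernel e p.1 p.2 y * F y) • heatLogDeriv e p y)
      ((isOpen_heatBox r b).mem_nhds hq) (Eventually.of_forall fun p => ?_)
      (integrable_heat_one e hFc hF hc z) ?_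
      (Eventually.of_forall fun y p hp => heatKernel_smul_le e hr hb hF hp y (hD p hp y).2.2)
      (integrable_one_add_norm_pow_mul_exp (by positivity) _ 2)
      (Eventually.of_forall fun y p hp => ?_)
    · have := continuous_heatKernel e p.1 p.2
      exact (this.mul hFc).aestronglyMeasurable
    · exact hi3.aestronglyMeasurable
    · have := (hasFDerivAt_heatKernel e (fun i => hr.trans (hp.1 i).1) y).mul_const (F y)
      rwa [smul_smul, mul_comm (F y)] at this
  · rw [ContinuousLinearMap.integral_apply hi3]
    have h1 : ⟪heatGrad e F c z, d.2⟫ =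
        ∫ y, ⟪(heatKernel e c z y * F y) • heatScore e c z y, d.2⟫ := by
      rw [heatGrad, real_inner_comm, ← integral_inner hi1]
      exact integral_congr_ae (Eventually.of_forall fun y => real_inner_comm _ _)
    have h2 : ∀ i, ⟪e i, heatHess e F c z (e i)⟫ =
        ∫ y, ⟪e i, ((heatKernel e c z y * F y) • heatWeight e c z y) (e i)⟫ := by
      intro i
      rw [heatHess, ContinuousLinearMap.integral_apply hi2, ← integral_inner]
      exact hi2.apply_continuousLinearMap _
    have hi4 : ∀ i, Integrable fun y =>
        1 / 2 * ⟪e i, ((heatKernel e c z y * F y) • heatWeight e c z y) (e i)⟫ * d.1 i := fun i =>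
      (((hi2.apply_continuousLinearMap (e i)).const_inner (e i)).const_mul _).mul_const _
    have h3 : ∀ i, 1 / 2 * ⟪e i, heatHess e F c z (e i)⟫ * d.1 i =
        ∫ y, 1 / 2 * ⟪e i, ((heatKernel e c z y * F y) • heatWeight e c z y) (e i)⟫ * d.1 i := by
      intro i
      rw [integral_mul_const, integral_const_mul, h2]
    rw [h1, Finset.sum_congr rfl fun i _ => h3 i, ← integral_finsetSum _ fun i _ => hi4 i,
      ← integral_add (integrable_finsetSum _ fun i _ => hi4 i) (hi1.inner_const _)]
    -- The eigenvalue components of `heatLogDeriv` are half the diagonal entries of `heatWeight`;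
    -- this pointwise identity is the heat equation.
    refine integral_congr_ae (Eventually.of_forall fun y => ?_)
    simp only [_root_.smul_apply, heatLogDeriv_apply, inner_smul_right,
      inner_smul_left, inner_heatWeight, smul_eq_mul, mul_add, Finset.mul_sum]
    congr 1
    refine Finset.sum_congr rfl fun i _ => ?_
    ring

lemma hasFDerivAt_heatInt_center {c : ι → ℝ} (hc : ∀ i, 0 < c i) (z : X) :
    HasFDerivAt (heatInt e F c) (innerSL ℝ (heatGrad e F c z)) z := by
  obtain ⟨T, hT, hT'⟩ := hasFDerivAt_heatInt e hFc hF hc z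
  have h := hT.comp z ((hasFDerivAt_const c z).prodMk (hasFDerivAt_id z))
  refine h.congr_fderiv (ContinuousLinearMap.ext fun d => ?_)
  simp [hT']

/-- By the product rule, kernel times score has derivative kernel times `heatWeight` in the centre.
All derivatives fall on the kernel, so `F` need only be bounded and continuous. -/
lemma hasFDerivAt_heatGrad {c : ι → ℝ} (hc : ∀ i, 0 < c i) (z : X) :
    HasFDerivAt (heatGrad e F c) (heatHess e F c z) z := by
  obtain ⟨r, b, hr, hb, hq⟩ := exists_mem_heatBox hc z
  obtain ⟨D, -, hD⟩ := exists_bound_heat_coefficients e (X := X) hr hb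
  obtain ⟨hi1, hi2, hi3⟩ := integrable_heat_coefficients e hFc hF hc z
  have hs : {x : X | (c, x) ∈ heatBox X ι r b} ∈ 𝓝 z :=
    (Continuous.prodMk_right c).continuousAt.preimage_mem_nhds
      ((isOpen_heatBox r b).mem_nhds hq)
  refine hasFDerivAt_integral_of_dominated_of_fderiv_le
      (F := fun x y => (heatKernel e c x y * F y) • heatScore e c x y)
      (F' := fun x y => (heatKernel e c x y * F y) • heatWeight e c x y)
      hs (Eventually.of_forall fun x => ?_) hi1 hi2.aestronglyMeasurable
      (Eventually.of_forall fun y x hx => heatKernel_smul_le e hr hb hF hx y (hD _ hx y).2.1)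
      (integrable_one_add_norm_pow_mul_exp (by positivity) _ 2)
      (Eventually.of_forall fun y x hx => ?_)
  · exact (integrable_heat_coefficients e hFc hF hc x).1.aestronglyMeasurable
  · have := ((hasFDerivAt_heatKernel_center e hc x y).mul_const (F y)).smul
      (hasFDerivAt_heatScore_center e c x y)
    refine this.congr_fderiv (ContinuousLinearMap.ext fun d => ?_)
    simp only [heatWeight, _root_.add_apply, _root_.smul_apply,
      _root_.neg_apply, ContinuousLinearMap.smulRight_apply, smul_smul,
      _root_.sub_apply, InnerProductSpace.rankOne_apply, innerSL_apply_apply,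
      smul_eq_mul, smul_sub, smul_neg]
    rw [add_comm, ← sub_eq_add_neg]
    congr 2
    ring

lemma continuousAt_heat {E : Type*} [NormedAddCommGroup E] [NormedSpace ℝ E]
    [FiniteDimensional ℝ E] {G : (ι → ℝ) × X → X → E} (hG : ∀ q, Continuous (G q))
    {c : ι → ℝ} (hc : ∀ i, 0 < c i) (z : X) (hGc : ∀ y, ContinuousAt (fun q => G q y) (c, z))
    (hGb : ∀ r b : ℝ, 0 < r → 0 < b →
      ∃ D, ∀ q ∈ heatBox X ι r b, ∀ y, ‖G q y‖ ≤ D * (1 + ‖y‖) ^ 2) :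
    ContinuousAt (fun q : (ι → ℝ) × X => ∫ y, (heatKernel e q.1 q.2 y * F y) • G q y) (c, z) := by
  obtain ⟨r, b, hr, hb, hq⟩ := exists_mem_heatBox hc z
  obtain ⟨D, hD⟩ := hGb r b hr hb
  have hs := (isOpen_heatBox r b).mem_nhds hq
  refine continuousAt_of_dominated (Eventually.of_forall fun p => ?_)
    (bound := fun y => (gaussNorm X * (∏ _i : ι, √r)⁻¹ * Real.exp (b / 2) * M * D) *
        ((1 + ‖y‖) ^ 2 * Real.exp (-(1 / (4 * b)) * ‖y‖ ^ 2)))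
    (by filter_upwards [hs] with p hp using
      Eventually.of_forall fun y => heatKernel_smul_le e hr hb hF hp y (hD p hp y))
    (integrable_one_add_norm_pow_mul_exp (by positivity) _ 2)
    (Eventually.of_forall fun y => ?_)
  · have := continuous_heatKernel e p.1 p.2
    have := hG p
    exact ((by fun_prop : Continuous fun y => (heatKernel e p.1 p.2 y * F y) •
      G p y)).aestronglyMeasurable
  · exact ((hasFDerivAt_heatKernel e (q := (c, z)) hc y).continuousAt.mul
      continuousAt_const).smul (hGc y)

omit hFc hF in
lemma continuousAt_heatScore {c : ι → ℝ} (hc : ∀ i, 0 < c i) (z y : X) :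
    ContinuousAt (fun q : (ι → ℝ) × X => heatScore e q.1 q.2 y) (c, z) := by
  have h1 : ContinuousAt (fun q : (ι → ℝ) × X => (q.1)⁻¹) (c, z) :=
    continuousAt_pi.2 fun i =>
      ((continuous_apply i).comp continuous_fst).continuousAt.inv₀ (hc i).ne'
  exact (((continuous_diagOp e).continuousAt.comp h1).clm_apply
    (continuous_const.sub continuous_snd).continuousAt)

lemma continuousAt_heatGrad {c : ι → ℝ} (hc : ∀ i, 0 < c i) (z : X) :
    ContinuousAt (fun q : (ι → ℝ) × X => heatGrad e F q.1 q.2) (c, z) :=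
  continuousAt_heat e hFc hF (G := fun q y => heatScore e q.1 q.2 y)
    (fun q => continuous_heatScore e q.1 q.2) hc z
    (fun y => continuousAt_heatScore e hc z y) fun r b hr hb => by
      obtain ⟨D, -, hD⟩ := exists_bound_heat_coefficients e (X := X) hr hb
      exact ⟨D, fun q hq y => (hD q hq y).1⟩

lemma continuousAt_heatHess {c : ι → ℝ} (hc : ∀ i, 0 < c i) (z : X) :
    ContinuousAt (fun q : (ι → ℝ) × X => heatHess e F q.1 q.2) (c, z) := by
  refine continuousAt_heat e hFc hF (G := fun q y => heatWeight e q.1 q.2 y)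
    (fun q => continuous_heatWeight e q.1 q.2) hc z (fun y => ?_) fun r b hr hb => ?_
  · have h1 : ContinuousAt (fun q : (ι → ℝ) × X => (q.1)⁻¹) (c, z) :=
      continuousAt_pi.2 fun i =>
        ((continuous_apply i).comp continuous_fst).continuousAt.inv₀ (hc i).ne'
    have h2 : Continuous fun p : X × X =>
      (ContinuousLinearMap.smulRightL ℝ X X (innerSL ℝ p.1)) p.2 := by fun_prop
    have h3 := continuousAt_heatScore e hc z y
    have h4 := h2.continuousAt.comp (h3.prodMk h3)
    exact h4.sub ((continuous_diagOp e).continuousAt.comp h1)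
  · obtain ⟨D, -, hD⟩ := exists_bound_heat_coefficients e (X := X) hr hb
    exact ⟨D, fun q hq y => (hD q hq y).2.1⟩

end HeatIntegrals

/-! ### Behaviour as the covariance degenerates. -/

section SmallTime

variable {X : Type*} [NormedAddCommGroup X] [InnerProductSpace ℝ X] [FiniteDimensional ℝ X]
  [MeasurableSpace X] [BorelSpace X] {ι : Type*} [Fintype ι] (e : OrthonormalBasis ι ℝ X)

/-- The expectation of `f` under the Gaussian measure centred at `z` whose covariance has
eigenvalues `c`, possibly degenerate. -/
noncomputable def heatExp {E : Type*} [NormedAddCommGroup E] [NormedSpace ℝ E] (f : X → E)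
    (c : ι → ℝ) (z : X) : E :=
  ∫ ξ, f (z + diagOp e (fun i => √(c i)) ξ) ∂stdGaussian X

variable {E : Type*} [NormedAddCommGroup E] [NormedSpace ℝ E] [FiniteDimensional ℝ E]

lemma heatExp_eq_heatInt {F : X → ℝ} (hF : Continuous F) {c : ι → ℝ} (hc : ∀ i, 0 < c i) :
    heatExp e F c = heatInt e F c := by
  funext z
  exact integral_affine_stdGaussian e hc z hF

lemma heatExp_zero (f : X → E) : heatExp e f (0 : ι → ℝ) = f := by
  funext z
  have : diagOp e (fun _ : ι => (0 : ℝ)) = 0 := by simp [diagOp]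
  simp [heatExp, this]

/-- The law of `ξ` is fixed and the covariance enters only through the argument of `f`, so dominated
convergence also covers degenerate covariances, where no kernel exists. -/
lemma continuous_heatExp {f : X → E} (hf : Continuous f) {M : ℝ} (hM : ∀ y, ‖f y‖ ≤ M) :
    Continuous fun q : (ι → ℝ) × X => heatExp e f q.1 q.2 := by
  have hd : Continuous fun c : ι → ℝ => diagOp e (fun i => √(c i)) :=
    (continuous_diagOp e).comp (by fun_prop)
  refine continuous_of_dominated (bound := fun _ => M) (fun q => ?_)
    (fun q => Eventually.of_forall fun ξ => hM _) (integrable_const _)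
    (Eventually.of_forall fun ξ => ?_)
  · exact (hf.comp (by fun_prop)).aestronglyMeasurable
  · exact hf.comp (continuous_snd.add ((hd.comp continuous_fst).clm_apply continuous_const))

/-- Here the derivative falls on `f` rather than on the kernel. The price is a bounded derivative;
the gain is validity at zero covariance. -/
lemma hasFDerivAt_heatExp {f : X → E} (hf : ContDiff ℝ 1 f) {M M' : ℝ} (hM : ∀ y, ‖f y‖ ≤ M)
    (hM' : ∀ y, ‖fderiv ℝ f y‖ ≤ M') (c : ι → ℝ) (z : X) :
    HasFDerivAt (heatExp e f c) (heatExp e (fderiv ℝ f) c z) z := by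
  have hfc := hf.continuous
  have hfd : Continuous (fderiv ℝ f) := hf.continuous_fderiv one_ne_zero
  refine hasFDerivAt_integral_of_dominated_of_fderiv_le
    (F := fun x ξ => f (x + diagOp e (fun i => √(c i)) ξ))
    (F' := fun x ξ => fderiv ℝ f (x + diagOp e (fun i => √(c i)) ξ)) (bound := fun _ => M')
    univ_mem (Eventually.of_forall fun x => ?_) ?_ ?_
    (Eventually.of_forall fun ξ x _ => hM' _) (integrable_const _)
    (Eventually.of_forall fun ξ x _ => ?_)
  · exact (hfc.comp (by fun_prop)).aestronglyMeasurable
  · exact (integrable_const M).mono' (hfc.comp (by fun_prop)).aestronglyMeasurable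
      (Eventually.of_forall fun ξ => hM _)
  · exact (hfd.comp (by fun_prop)).aestronglyMeasurable
  · have := ((hf.differentiable one_ne_zero) (x + diagOp e (fun i => √(c i)) ξ)).hasFDerivAt
    have h2 := this.comp x ((hasFDerivAt_id x).add_const (diagOp e (fun i => √(c i)) ξ))
    simpa [Function.comp_def] using h2

lemma integrable_norm_pow_stdGaussian (n : ℕ) :
    Integrable (fun ξ : X => ‖ξ‖ ^ n) (stdGaussian X) := by
  have := (IsGaussian.memLp_id (stdGaussian X) (n : ENNReal) (by simp)).integrable_norm_pow'
  simpa using this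

/-- Stein-type integrals of a bounded function vanishing near the centre are small. -/
lemma norm_heatKernel_integral_le {F : X → ℝ} (hFc : Continuous F) {M : ℝ}
    (hF : ∀ y, |F y| ≤ M) {c : ι → ℝ} {t s : ℝ} (ht : 0 ≤ t)
    (hc : ∀ i, 0 < c i) (hct : ∀ i, c i ≤ t) {z : X} (hz : ∀ y, ‖y - z‖ ≤ 1 → F y = 0)
    {G : X → E} (hG : Continuous G)
    (hGs : ∀ ξ, ‖G (z + diagOp e (fun i => √(c i)) ξ)‖ ≤ s⁻¹ * (‖ξ‖ ^ 2 + 1)) :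
    ‖∫ y, (heatKernel e c z y * F y) • G y‖ ≤
      M * t ^ 2 * s⁻¹ * ∫ ξ : X, (‖ξ‖ ^ 6 + ‖ξ‖ ^ 4) ∂stdGaussian X := by
  have h1 := integral_affine_stdGaussian e hc z (f := fun y => F y • G y) (hFc.smul hG)
  simp only [smul_smul] at h1
  rw [← h1, ← integral_const_mul]
  have hM0 : 0 ≤ M := (abs_nonneg _).trans (hF 0)
  refine norm_integral_le_of_norm_le
    (((integrable_norm_pow_stdGaussian 6).add (integrable_norm_pow_stdGaussian 4)).const_mul _)
    (Eventually.of_forall fun ξ => ?_)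
  set v := diagOp e (fun i => √(c i)) ξ with hv
  have hvn : ‖v‖ ≤ √t * ‖ξ‖ := norm_diagOp_apply_le e (Real.sqrt_nonneg _) (fun i => by
    rw [abs_of_nonneg (Real.sqrt_nonneg _)]; exact Real.sqrt_le_sqrt (hct i)) ξ
  have hv4 : ‖v‖ ^ 4 ≤ t ^ 2 * ‖ξ‖ ^ 4 := by
    calc ‖v‖ ^ 4 ≤ (√t * ‖ξ‖) ^ 4 := by gcongr
      _ = (√t ^ 2) ^ 2 * ‖ξ‖ ^ 4 := by ring
      _ = _ := by rw [Real.sq_sqrt ht]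
  -- Where `F (z + v)` does not vanish, `1 ≤ ‖v‖⁴ ≤ t² ‖ξ‖⁴`. The fourth power leaves a factor `t`
  -- once the coefficient of size `s⁻¹` is paid for, `s` being a multiple of `t` in the application.
  have hFv : |F (z + v)| ≤ M * (t ^ 2 * ‖ξ‖ ^ 4) := by
    by_cases h : ‖v‖ ≤ 1
    · rw [hz (z + v) (by simpa using h), abs_zero]
      positivity
    · push Not at h
      refine (hF _).trans (le_mul_of_one_le_right hM0 (le_trans ?_ hv4))
      exact one_le_pow₀ h.le
  rw [norm_smul, Real.norm_eq_abs]
  calc |F (z + v)| * ‖G (z + v)‖ ≤ M * (t ^ 2 * ‖ξ‖ ^ 4) * (s⁻¹ * (‖ξ‖ ^ 2 + 1)) := by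
        refine mul_le_mul hFv (hGs ξ) (norm_nonneg _) (by positivity)
    _ = _ := by ring

lemma heatScore_affine {c : ι → ℝ} (hc : ∀ i, 0 < c i) (z ξ : X) :
    heatScore e c z (z + diagOp e (fun i => √(c i)) ξ) = diagOp e (fun i => (√(c i))⁻¹) ξ := by
  rw [heatScore, add_sub_cancel_left, diagOp_diagOp]
  congr 2
  ext i
  have := Real.sqrt_pos.2 (hc i)
  rw [Pi.mul_apply, Pi.inv_apply]
  nth_rw 1 [← Real.sq_sqrt (hc i).le]
  field_simp

/-- In the standardised variable the score is `C^{-1/2} ξ`, of order `s^{-1/2}`, and the weight is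
of order `s⁻¹`. For `s ≤ 1` one bound serves both. -/
lemma norm_heatScore_heatWeight_affine_le {c : ι → ℝ} {s : ℝ} (hs : 0 < s) (hs1 : s ≤ 1)
    (hsc : ∀ i, s ≤ c i) (z ξ : X) :
    ‖heatScore e c z (z + diagOp e (fun i => √(c i)) ξ)‖ ≤ s⁻¹ * (‖ξ‖ ^ 2 + 1) ∧
    ‖heatWeight e c z (z + diagOp e (fun i => √(c i)) ξ)‖ ≤ s⁻¹ * (‖ξ‖ ^ 2 + 1) := by
  have hc : ∀ i, 0 < c i := fun i => hs.trans_le (hsc i)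
  have hs0 : 0 < √s := Real.sqrt_pos.2 hs
  have h1 : ‖heatScore e c z (z + diagOp e (fun i => √(c i)) ξ)‖ ≤ (√s)⁻¹ * ‖ξ‖ := by
    rw [heatScore_affine e hc]
    refine norm_diagOp_apply_le e (by positivity) (fun i => ?_) _
    rw [abs_of_nonneg (by positivity)]
    exact inv_anti₀ hs0 (Real.sqrt_le_sqrt (hsc i))
  constructor
  · refine h1.trans (mul_le_mul (inv_anti₀ hs ?_) ?_ (norm_nonneg _) (by positivity))
    · exact Real.le_sqrt_of_sq_le (by nlinarith)
    · nlinarith [sq_nonneg (‖ξ‖ - 1), norm_nonneg ξ]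
  · have hd : ‖diagOp e c⁻¹‖ ≤ s⁻¹ := ContinuousLinearMap.opNorm_le_bound _ (by positivity)
      fun x => norm_diagOp_apply_le e (by positivity) (fun i => by
        rw [Pi.inv_apply, abs_of_pos (inv_pos.2 (hc i))]; exact inv_anti₀ hs (hsc i)) x
    refine (norm_sub_le _ _).trans ?_
    rw [InnerProductSpace.norm_rankOne, ← sq]
    have h2 : ‖heatScore e c z (z + diagOp e (fun i => √(c i)) ξ)‖ ^ 2 ≤ s⁻¹ * ‖ξ‖ ^ 2 := by
      refine (pow_le_pow_left₀ (norm_nonneg _) h1 2).trans_eq ?_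
      rw [mul_pow, inv_pow, Real.sq_sqrt hs.le]
    linarith

lemma gradient_eq_of_hasFDerivAt {f : X → ℝ} {g z : X} (h : HasFDerivAt f (innerSL ℝ g) z) :
    ∇ f z = g := by
  have h' : HasGradientAt f g z := by
    rw [hasGradientAt_iff_hasFDerivAt]
    exact h
  exact h'.gradient

lemma contDiff_gradient {f : X → ℝ} {n : ℕ} (hf : ContDiff ℝ (n + 1) f) :
    ContDiff ℝ n (∇ f) := by
  have h1 : ContDiff ℝ n (fderiv ℝ f) := hf.fderiv_right le_rfl
  exact (InnerProductSpace.toDual ℝ X).symm.contDiff.comp h1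

lemma innerSL_gradient {f : X → ℝ} (z : X) : innerSL ℝ (∇ f z) = fderiv ℝ f z := by
  ext v
  simp [gradient]

/-- For a `C²` function with compact support the expectations of the derivatives are the
derivatives of the expectation. -/
lemma heatExp_compactSupport {F : X → ℝ} (hF : ContDiff ℝ 2 F) (hs : HasCompactSupport F) :
    (∀ c : ι → ℝ, ∀ z, HasFDerivAt (heatExp e F c) (innerSL ℝ (heatExp e (∇ F) c z)) z) ∧
    (∀ c : ι → ℝ, ∀ z, HasFDerivAt (heatExp e (∇ F) c) (heatExp e (fderiv ℝ (∇ F)) c z) z) ∧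
    (Continuous fun q : (ι → ℝ) × X => heatExp e (∇ F) q.1 q.2) ∧
    Continuous fun q : (ι → ℝ) × X => heatExp e (fderiv ℝ (∇ F)) q.1 q.2 := by
  have hg : ContDiff ℝ 1 (∇ F) := contDiff_gradient (n := 1) (by exact_mod_cast hF)
  have hgs : HasCompactSupport (∇ F) :=
    (hs.fderiv (𝕜 := ℝ)).comp_left (g := (InnerProductSpace.toDual ℝ X).symm) (map_zero _)
  have hF1 : ContDiff ℝ 1 F := hF.of_le (by norm_num)
  have hfd : Continuous (fderiv ℝ F) := hF1.continuous_fderiv one_ne_zero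
  have hgd : Continuous (fderiv ℝ (∇ F)) := hg.continuous_fderiv one_ne_zero
  obtain ⟨M0, hM0⟩ := hs.exists_bound_of_continuous hF1.continuous
  obtain ⟨M1, hM1⟩ := (hs.fderiv (𝕜 := ℝ)).exists_bound_of_continuous hfd
  obtain ⟨M2, hM2⟩ := hgs.exists_bound_of_continuous hg.continuous
  obtain ⟨M3, hM3⟩ := (hgs.fderiv (𝕜 := ℝ)).exists_bound_of_continuous hgd
  refine ⟨fun c z => ?_, fun c z => hasFDerivAt_heatExp e hg hM2 hM3 c z,
    continuous_heatExp e hg.continuous hM2, continuous_heatExp e hgd hM3⟩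
  refine (hasFDerivAt_heatExp e hF1 hM0 hM1 c z).congr_fderiv ?_
  have hi : Integrable (fun ξ => ∇ F (z + diagOp e (fun i => √(c i)) ξ)) (stdGaussian X) :=
    (integrable_const M2).mono' (hg.continuous.comp (by fun_prop)).aestronglyMeasurable
      (Eventually.of_forall fun ξ => hM2 _)
  have := (innerSL ℝ (E := X)).integral_comp_comm hi
  exact (integral_congr_ae (Eventually.of_forall fun ξ => (innerSL_gradient _).symm)).trans this

end SmallTime

/-! ### Heat extensions along a covariance path, up to time zero. -/

section CovariancePaths

variable {X : Type*} [NormedAddCommGroup X] [InnerProductSpace ℝ X] [FiniteDimensional ℝ X]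
  [MeasurableSpace X] [BorelSpace X] {ι : Type*} [Fintype ι] (e : OrthonormalBasis ι ℝ X)

/-- Eigenvalues `c` of a covariance path started at zero, with positive derivatives `cd`
bounded by one. -/
structure IsCovPath (c cd : ℝ → ι → ℝ) : Prop where
  zero : ∀ i, c 0 i = 0
  deriv : ∀ t, 0 ≤ t → ∀ i, HasDerivAt (fun s => c s i) (cd t i) t
  cont : ∀ i, ContinuousOn (fun t => cd t i) (Ici 0)
  pos : ∀ t, 0 ≤ t → ∀ i, 0 < cd t i
  le_one : ∀ t, 0 ≤ t → ∀ i, cd t i ≤ 1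

namespace IsCovPath

variable {c cd : ℝ → ι → ℝ} (hc : IsCovPath c cd)
include hc

lemma continuousOn : ContinuousOn c (Ici 0) :=
  continuousOn_pi.2 fun i t ht => (hc.deriv t ht i).continuousAt.continuousWithinAt

lemma intervalIntegrable_deriv {t : ℝ} (ht : 0 ≤ t) (i : ι) :
    IntervalIntegrable (fun s => cd s i) volume 0 t :=
  ((hc.cont i).mono (by rw [uIcc_of_le ht]; exact Icc_subset_Ici_self)).intervalIntegrable

lemma integral_deriv {t : ℝ} (ht : 0 ≤ t) (i : ι) : ∫ s in (0 : ℝ)..t, cd s i = c t i := by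
  rw [intervalIntegral.integral_eq_sub_of_hasDerivAt (fun s hs => hc.deriv s
    (by rw [uIcc_of_le ht] at hs; exact hs.1) i) (hc.intervalIntegrable_deriv ht i), hc.zero,
    sub_zero]

lemma le_self {t : ℝ} (ht : 0 ≤ t) (i : ι) : c t i ≤ t := by
  rw [← hc.integral_deriv ht i]
  calc _ ≤ ∫ _s in (0 : ℝ)..t, (1 : ℝ) :=
        intervalIntegral.integral_mono_on ht (hc.intervalIntegrable_deriv ht i)
          intervalIntegrable_const fun s hs => hc.le_one s hs.1 i
    _ = t := by simp

/-- A continuous positive derivative is bounded below on `[0, T]`, and this integrates. With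
`le_self`, the eigenvalues are comparable to `t`. -/
lemma exists_mul_le (T : ℝ) :
    ∃ κ : ℝ, 0 < κ ∧ κ ≤ 1 ∧ ∀ t, 0 ≤ t → t ≤ T → ∀ i, κ * t ≤ c t i := by
  have h1 : ∀ i, ∃ κ : ℝ, 0 < κ ∧ ∀ t, 0 ≤ t → t ≤ T → κ ≤ cd t i := by
    intro i
    rcases lt_or_ge T 0 with hT | hT
    · exact ⟨1, one_pos, fun t h0 h1 => absurd (h0.trans h1) hT.not_ge⟩
    · obtain ⟨s, hs, hmin⟩ := isCompact_Icc.exists_isMinOn (nonempty_Icc.2 hT)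
        ((hc.cont i).mono Icc_subset_Ici_self)
      exact ⟨cd s i, hc.pos s hs.1 i, fun t h0 h1 => hmin ⟨h0, h1⟩⟩
  choose κ hκ0 hκ using h1
  obtain ⟨m, hm0, hm1, hm⟩ : ∃ m : ℝ, 0 < m ∧ m ≤ 1 ∧ ∀ i, m ≤ κ i := by
    rcases isEmpty_or_nonempty ι with h | h
    · exact ⟨1, one_pos, le_rfl, fun i => h.elim i⟩
    · obtain ⟨j, hj⟩ := Finite.exists_min κ
      exact ⟨min (κ j) 1, lt_min (hκ0 j) one_pos, min_le_right _ _,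
        fun i => (min_le_left _ _).trans (hj i)⟩
  refine ⟨m, hm0, hm1, fun t h0 h1 i => ?_⟩
  rw [← hc.integral_deriv h0 i]
  calc m * t = ∫ _s in (0 : ℝ)..t, m := by simp [mul_comm]
    _ ≤ _ := intervalIntegral.integral_mono_on h0 intervalIntegrable_const
        (hc.intervalIntegrable_deriv h0 i) fun s hs => (hm i).trans (hκ i s hs.1 (hs.2.trans h1))

lemma apply_pos {t : ℝ} (ht : 0 < t) (i : ι) : 0 < c t i := by
  obtain ⟨κ, h0, -, h⟩ := hc.exists_mul_le t
  exact (mul_pos h0 ht).trans_le (h t ht.le le_rfl i)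

lemma apply_zero : c 0 = 0 := funext hc.zero

variable {F : X → ℝ} (hF : ContDiff ℝ 2 F) {M : ℝ} (hM : ∀ y, |F y| ≤ M)
include hF hM

lemma gradient_heatExp {t : ℝ} (ht : 0 < t) :
    ∇ (heatExp e F (c t)) = heatGrad e F (c t) := by
  funext z
  rw [heatExp_eq_heatInt e hF.continuous (hc.apply_pos ht)]
  exact gradient_eq_of_hasFDerivAt
    (hasFDerivAt_heatInt_center e hF.continuous hM (hc.apply_pos ht) z)

lemma fderiv_gradient_heatExp {t : ℝ} (ht : 0 < t) (z : X) :
    fderiv ℝ (∇ (heatExp e F (c t))) z = heatHess e F (c t) z := by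
  rw [hc.gradient_heatExp e hF hM ht]
  exact (hasFDerivAt_heatGrad e hF.continuous hM (hc.apply_pos ht) z).fderiv

lemma hasFDerivAt_heatExp_path {t : ℝ} (ht : 0 ≤ t) (z : X) :
    HasFDerivAt (heatExp e F (c t)) (innerSL ℝ (∇ (heatExp e F (c t)) z)) z := by
  rcases ht.eq_or_lt with rfl | ht
  · rw [hc.apply_zero, heatExp_zero, innerSL_gradient]
    exact (hF.differentiable (by norm_num) z).hasFDerivAt
  · rw [hc.gradient_heatExp e hF hM ht, heatExp_eq_heatInt e hF.continuous (hc.apply_pos ht)]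
    exact hasFDerivAt_heatInt_center e hF.continuous hM (hc.apply_pos ht) z

lemma hasFDerivAt_gradient_heatExp {t : ℝ} (ht : 0 ≤ t) (z : X) :
    HasFDerivAt (∇ (heatExp e F (c t))) (fderiv ℝ (∇ (heatExp e F (c t))) z) z := by
  rcases ht.eq_or_lt with rfl | ht
  · rw [hc.apply_zero, heatExp_zero]
    exact ((contDiff_gradient (n := 1) (by exact_mod_cast hF)).differentiable
      (by norm_num) z).hasFDerivAt
  · rw [hc.fderiv_gradient_heatExp e hF hM ht, hc.gradient_heatExp e hF hM ht]
    exact hasFDerivAt_heatGrad e hF.continuous hM (hc.apply_pos ht) z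

/-- Near time zero the derivatives of the heat extension of a bounded `C²` function are close
to those of a localised function. -/
lemma exists_localization (z₀ : X) : ∃ F₁ : X → ℝ, ContDiff ℝ 2 F₁ ∧ HasCompactSupport F₁ ∧
    ∃ K : ℝ, ∀ t, 0 ≤ t → t ≤ 1 → ∀ z, ‖z - z₀‖ < 1 →
      ‖∇ (heatExp e F (c t)) z - heatExp e (∇ F₁) (c t) z‖ ≤ K * t ∧
      ‖fderiv ℝ (∇ (heatExp e F (c t))) z - heatExp e (fderiv ℝ (∇ F₁)) (c t) z‖ ≤ K * t := by
  -- For `‖z - z₀‖ < 1` the unit ball about `z` lies in the ball of radius `‖z₀‖ + 2` about the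
  -- origin, where the bump equals one. The far part `F₂` therefore vanishes near every such `z`.
  let χ : ContDiffBump (0 : X) := ⟨‖z₀‖ + 2, ‖z₀‖ + 3, by positivity, by linarith⟩
  set F₁ : X → ℝ := fun y => χ y * F y with hF₁
  have hF1 : ContDiff ℝ 2 F₁ := χ.contDiff.mul hF
  have hs1 : HasCompactSupport F₁ := χ.hasCompactSupport.mul_right
  obtain ⟨M₁, hM₁⟩ := hs1.exists_bound_of_continuous hF1.continuous
  set F₂ : X → ℝ := fun y => F y - F₁ y with hF₂
  have hF2 : Continuous F₂ := hF.continuous.sub hF1.continuous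
  have hM₂ : ∀ y, |F₂ y| ≤ M := fun y => by
    have h : F₂ y = (1 - χ y) * F y := by simp only [hF₂, hF₁]; ring
    rw [h, abs_mul]
    have h0 := χ.nonneg (x := y)
    have h1 := χ.le_one (x := y)
    have h2 : |1 - χ y| ≤ 1 := abs_le.2 ⟨by linarith, by linarith⟩
    calc _ ≤ 1 * |F y| := by gcongr
      _ ≤ M := by rw [one_mul]; exact hM y
  have hχ : ∀ y, ‖y‖ ≤ ‖z₀‖ + 2 → F y = F₁ y := fun y hy => by
    simp only [hF₁]
    rw [χ.one_of_mem_closedBall (by simpa [χ] using hy), one_mul]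
  obtain ⟨κ, hκ0, hκ1, hκ⟩ := hc.exists_mul_le 1
  obtain ⟨hE1, hE2, -, -⟩ := heatExp_compactSupport e hF1 hs1 (ι := ι)
  refine ⟨F₁, hF1, hs1, M * κ⁻¹ * ∫ ξ : X, (‖ξ‖ ^ 6 + ‖ξ‖ ^ 4) ∂stdGaussian X,
    fun t ht ht1 z hz => ?_⟩
  have hzn : ‖z‖ < ‖z₀‖ + 1 := by
    have := norm_sub_norm_le z z₀
    linarith
  rcases ht.eq_or_lt with rfl | ht
  · have hev : F =ᶠ[𝓝 z] F₁ := by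
      have : {y : X | ‖y‖ < ‖z₀‖ + 2} ∈ 𝓝 z :=
        (isOpen_lt continuous_norm continuous_const).mem_nhds (by
          change ‖z‖ < _; linarith)
      filter_upwards [this] with y hy using hχ y (le_of_lt hy)
    have hev1 : ∇ F =ᶠ[𝓝 z] ∇ F₁ := by
      filter_upwards [hev.fderiv (𝕜 := ℝ)] with y hy
      simp only [gradient, hy]
    rw [hc.apply_zero, heatExp_zero, heatExp_zero, heatExp_zero, hev1.eq_of_nhds,
      hev1.fderiv_eq]
    simp
  · have hct := hc.apply_pos ht
    have hkt : ∀ i, κ * t ≤ c t i := hκ t ht.le ht1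
    have hs0 : 0 < κ * t := mul_pos hκ0 ht
    have hs1' : κ * t ≤ 1 := mul_le_one₀ hκ1 ht.le ht1
    have hz0 : ∀ y, ‖y - z‖ ≤ 1 → F₂ y = 0 := fun y hy => by
      simp only [hF₂]
      rw [hχ y, sub_self]
      have := norm_sub_norm_le y z
      linarith
    have hsum : ∀ y, heatKernel e (c t) z y * F y =
        heatKernel e (c t) z y * F₁ y + heatKernel e (c t) z y * F₂ y := fun y => by
      simp only [hF₂]; ring
    obtain ⟨i1, i2, -⟩ := integrable_heat_coefficients e hF1.continuous hM₁ hct z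
    obtain ⟨j1, j2, -⟩ := integrable_heat_coefficients e hF2 hM₂ hct z
    have hg1 : heatExp e (∇ F₁) (c t) = heatGrad e F₁ (c t) := by
      funext x
      have h1 := hE1 (c t) x
      rw [heatExp_eq_heatInt e hF1.continuous hct] at h1
      rw [← gradient_eq_of_hasFDerivAt h1, gradient_eq_of_hasFDerivAt
        (hasFDerivAt_heatInt_center e hF1.continuous hM₁ hct x)]
    have hg2 : heatExp e (fderiv ℝ (∇ F₁)) (c t) z = heatHess e F₁ (c t) z := by
      have h1 := hE2 (c t) z
      rw [hg1] at h1
      exact h1.unique (hasFDerivAt_heatGrad e hF1.continuous hM₁ hct z)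
    have hK : M * t ^ 2 * (κ * t)⁻¹ * ∫ ξ : X, (‖ξ‖ ^ 6 + ‖ξ‖ ^ 4) ∂stdGaussian X =
        (M * κ⁻¹ * ∫ ξ : X, (‖ξ‖ ^ 6 + ‖ξ‖ ^ 4) ∂stdGaussian X) * t := by
      field_simp
    rw [hc.fderiv_gradient_heatExp e hF hM ht, hc.gradient_heatExp e hF hM ht, hg2, hg1, ← hK]
    constructor
    · have : heatGrad e F (c t) z - heatGrad e F₁ (c t) z = heatGrad e F₂ (c t) z := by
        rw [sub_eq_iff_eq_add', heatGrad, heatGrad, heatGrad, ← integral_add i1 j1]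
        simp only [hsum, add_smul]
      rw [this]
      exact norm_heatKernel_integral_le e hF2 hM₂ ht.le hct (hc.le_self ht.le) hz0
        (continuous_heatScore e _ _)
        fun ξ => (norm_heatScore_heatWeight_affine_le e hs0 hs1' hkt z ξ).1
    · have : heatHess e F (c t) z - heatHess e F₁ (c t) z = heatHess e F₂ (c t) z := by
        rw [sub_eq_iff_eq_add', heatHess, heatHess, heatHess, ← integral_add i2 j2]
        simp only [hsum, add_smul]
      rw [this]
      exact norm_heatKernel_integral_le e hF2 hM₂ ht.le hct (hc.le_self ht.le) hz0
        (continuous_heatWeight e _ _)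
        fun ξ => (norm_heatScore_heatWeight_affine_le e hs0 hs1' hkt z ξ).2

omit hF hM in
lemma continuousOn_path_comp {E : Type*} [TopologicalSpace E] {f : (ι → ℝ) × X → E} {p : ℝ × X}
    (hp : 0 ≤ p.1) (hf : ContinuousAt f (c p.1, p.2)) :
    ContinuousWithinAt (fun p : ℝ × X => f (c p.1, p.2)) (Ici 0 ×ˢ univ) p := by
  have h1 : ContinuousWithinAt (fun p : ℝ × X => c p.1) (Ici 0 ×ˢ univ) p :=
    ContinuousWithinAt.comp (t := Ici 0) (hc.continuousOn p.1 hp)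
      continuous_fst.continuousWithinAt fun q hq => hq.1
  exact ContinuousAt.comp_continuousWithinAt (f := fun p : ℝ × X => (c p.1, p.2)) hf
    (h1.prodMk continuous_snd.continuousWithinAt)

omit hF hM in
-- The error `K t` vanishes at time zero, so continuity at `(0, z₀)` passes from the localised
-- object to the original one.
lemma continuousWithinAt_of_localization {E : Type*} [NormedAddCommGroup E] {f g : ℝ → X → E}
    {z₀ : X} (hg : ContinuousWithinAt (fun p : ℝ × X => g p.1 p.2) (Ici 0 ×ˢ univ) (0, z₀))
    {K : ℝ} (h : ∀ t, 0 ≤ t → t ≤ 1 → ∀ z, ‖z - z₀‖ < 1 → ‖f t z - g t z‖ ≤ K * t) :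
    ContinuousWithinAt (fun p : ℝ × X => f p.1 p.2) (Ici 0 ×ˢ univ) (0, z₀) := by
  have h0 : f 0 z₀ = g 0 z₀ := by
    have := h 0 le_rfl zero_le_one z₀ (by simp)
    rw [mul_zero, norm_le_zero_iff, sub_eq_zero] at this
    exact this
  have h1 : Tendsto (fun p : ℝ × X => f p.1 p.2 - g p.1 p.2) (𝓝[Ici 0 ×ˢ univ] (0, z₀))
      (𝓝 0) := by
    refine squeeze_zero_norm' (a := fun p : ℝ × X => K * p.1) ?_ ?_
    · have ho : {p : ℝ × X | p.1 < 1 ∧ ‖p.2 - z₀‖ < 1} ∈ 𝓝 ((0 : ℝ), z₀) :=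
        ((isOpen_lt continuous_fst continuous_const).inter
          (isOpen_lt ((continuous_snd.sub continuous_const).norm) continuous_const)).mem_nhds
          (by simp)
      filter_upwards [self_mem_nhdsWithin, mem_nhdsWithin_of_mem_nhds ho] with p hp hp1
      exact h p.1 hp.1 hp1.1.le p.2 hp1.2
    · have : Continuous fun p : ℝ × X => K * p.1 := by fun_prop
      simpa using (this.tendsto (0, z₀)).mono_left nhdsWithin_le_nhds
  have h2 := h1.add hg
  simp only [sub_add_cancel, zero_add] at h2
  rw [ContinuousWithinAt]
  simpa [h0] using h2

lemma continuousOn_heatExp :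
    ContinuousOn (fun p : ℝ × X => heatExp e F (c p.1) p.2) (Ici 0 ×ˢ univ) := fun _ hp =>
  hc.continuousOn_path_comp hp.1 (continuous_heatExp e hF.continuous hM).continuousAt

/-- Positive times are covered by the kernel representation, time zero by localisation. -/
lemma continuousOn_gradient_heatExp :
    ContinuousOn (fun p : ℝ × X => ∇ (heatExp e F (c p.1)) p.2) (Ici 0 ×ˢ univ) := by
  rintro ⟨t, z⟩ hp
  rcases (show 0 ≤ t from hp.1).eq_or_lt with rfl | ht
  · obtain ⟨F₁, hF1, hs1, K, hK⟩ := hc.exists_localization e hF hM z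
    obtain ⟨-, -, h3, -⟩ := heatExp_compactSupport e hF1 hs1 (ι := ι)
    exact hc.continuousWithinAt_of_localization
      (g := fun t z => heatExp e (∇ F₁) (c t) z)
      (hc.continuousOn_path_comp hp.1 h3.continuousAt) fun t h0 h1 z hz => (hK t h0 h1 z hz).1
  · have h1 := hc.continuousOn_path_comp (p := (t, z)) hp.1
      (continuousAt_heatGrad e hF.continuous hM (hc.apply_pos ht) z)
    refine h1.congr_of_eventuallyEq ?_ (by simp only [hc.gradient_heatExp e hF hM ht])
    have ho : {p : ℝ × X | 0 < p.1} ∈ 𝓝 (t, z) :=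
      (isOpen_lt continuous_const continuous_fst).mem_nhds ht
    filter_upwards [mem_nhdsWithin_of_mem_nhds ho] with q hq
    simp only [hc.gradient_heatExp e hF hM hq]

lemma continuousOn_hessian_heatExp :
    ContinuousOn (fun p : ℝ × X => fderiv ℝ (∇ (heatExp e F (c p.1))) p.2) (Ici 0 ×ˢ univ) := by
  rintro ⟨t, z⟩ hp
  rcases (show 0 ≤ t from hp.1).eq_or_lt with rfl | ht
  · obtain ⟨F₁, hF1, hs1, K, hK⟩ := hc.exists_localization e hF hM z
    obtain ⟨-, -, -, h4⟩ := heatExp_compactSupport e hF1 hs1 (ι := ι)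
    exact hc.continuousWithinAt_of_localization (f := fun t z => fderiv ℝ (∇ (heatExp e F (c t))) z)
      (g := fun t z => heatExp e (fderiv ℝ (∇ F₁)) (c t) z)
      (hc.continuousOn_path_comp hp.1 h4.continuousAt) fun t h0 h1 z hz => (hK t h0 h1 z hz).2
  · have h1 := hc.continuousOn_path_comp (p := (t, z)) hp.1
      (continuousAt_heatHess e hF.continuous hM (hc.apply_pos ht) z)
    refine h1.congr_of_eventuallyEq ?_ (by simp only [hc.fderiv_gradient_heatExp e hF hM ht])
    have ho : {p : ℝ × X | 0 < p.1} ∈ 𝓝 (t, z) :=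
      (isOpen_lt continuous_const continuous_fst).mem_nhds ht
    filter_upwards [mem_nhdsWithin_of_mem_nhds ho] with q hq
    simp only [hc.fderiv_gradient_heatExp e hF hM hq]

/-- The heat equation along a differentiable curve. -/
lemma hasDerivAt_heatExp_curve {t : ℝ} (ht : 0 < t) {z : ℝ → X} {z' : X}
    (hz : HasDerivAt z z' t) :
    HasDerivAt (fun s => heatExp e F (c s) (z s))
      (1 / 2 * ∑ i, cd t i * ⟪e i, fderiv ℝ (∇ (heatExp e F (c t))) (z t) (e i)⟫ +
        ⟪∇ (heatExp e F (c t)) (z t), z'⟫) t := by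
  obtain ⟨T, hT, hT'⟩ := hasFDerivAt_heatInt e hF.continuous hM (hc.apply_pos ht) (z t)
  have h1 : HasDerivAt (fun s => (c s, z s)) (cd t, z') t :=
    (hasDerivAt_pi.2 fun i => hc.deriv t ht.le i).prodMk hz
  have h2 := HasFDerivAt.comp_hasDerivAt (f := fun s => (c s, z s)) t hT h1
  rw [hT'] at h2
  rw [hc.fderiv_gradient_heatExp e hF hM ht, hc.gradient_heatExp e hF hM ht, Finset.mul_sum]
  refine (h2.congr_of_eventuallyEq ?_).congr_deriv ?_
  · filter_upwards [lt_mem_nhds ht] with s hs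
    simp [heatExp_eq_heatInt e hF.continuous (hc.apply_pos hs)]
  · congr 1
    exact Finset.sum_congr rfl fun i _ => by ring

end IsCovPath

end CovariancePaths

/-! ### Log-convexity and gradient growth of the renormalised potential. -/

section RenormalisedPotential

variable {X : Type*} [NormedAddCommGroup X] [InnerProductSpace ℝ X] [FiniteDimensional ℝ X]
  [MeasurableSpace X] [BorelSpace X] {ι : Type*} [Fintype ι] (e : OrthonormalBasis ι ℝ X)

omit [FiniteDimensional ℝ X] [MeasurableSpace X] [BorelSpace X] in
lemma continuous_rankOne_self : Continuous fun x : X => InnerProductSpace.rankOne ℝ x x := by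
  have h : Continuous fun p : X × X =>
      (ContinuousLinearMap.smulRightL ℝ X X (innerSL ℝ p.1)) p.2 := by fun_prop
  exact h.comp (continuous_id.prodMk continuous_id)

/-- Cameron–Martin formula: the logarithm of the kernel is exactly quadratic in the centre. -/
lemma heatKernel_translate {c : ι → ℝ} (hc : ∀ i, 0 < c i) (z h y : X) :
    heatKernel e c (z + h) y = heatKernel e c z y *
      Real.exp (⟪heatScore e c z y, h⟫ - 1 / 2 * ⟪h, diagOp e c⁻¹ h⟫) := by
  rw [heatKernel, heatKernel, mul_assoc _ (Real.exp _), ← Real.exp_add]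
  congr 2
  rw [inner_eq_sum_coord e, inner_diagOp_right, Finset.mul_sum, Finset.mul_sum, Finset.mul_sum,
    ← Finset.sum_sub_distrib, ← Finset.sum_add_distrib]
  refine Finset.sum_congr rfl fun i _ => ?_
  rw [inner_heatScore, inner_add_right, Pi.inv_apply]
  have := (hc i).ne'
  field_simp
  ring

/-- Convexity of the logarithm of the heat extension up to the Gaussian quadratic form. -/
lemma heatInt_translate_ge {F : X → ℝ} (hFc : Continuous F) {M : ℝ} (hM : ∀ y, |F y| ≤ M)
    (hF0 : ∀ y, 0 < F y) {c : ι → ℝ} (hc : ∀ i, 0 < c i) (z h : X)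
    (hu : 0 < heatInt e F c z) :
    heatInt e F c z * Real.exp ((heatInt e F c z)⁻¹ * ⟪heatGrad e F c z, h⟫ -
      1 / 2 * ⟪h, diagOp e c⁻¹ h⟫) ≤ heatInt e F c (z + h) := by
  set u := heatInt e F c z with hu'
  set Q := 1 / 2 * ⟪h, diagOp e c⁻¹ h⟫ with hQ
  set m := u⁻¹ * ⟪heatGrad e F c z, h⟫ with hm
  have i0 := integrable_heat_one e hFc hM hc z
  have i1 := (integrable_heat_coefficients e hFc hM hc z).1
  have h1 : ⟪heatGrad e F c z, h⟫ =
      ∫ y, ⟪(heatKernel e c z y * F y) • heatScore e c z y, h⟫ := by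
    rw [heatGrad, real_inner_comm, ← integral_inner i1]
    exact integral_congr_ae (Eventually.of_forall fun y => real_inner_comm _ _)
  -- Jensen's inequality by a supporting line: `m` is the mean of the score against `h` under the
  -- weight kernel times `F`, normalised by `u`, so the tangent to the exponential at `m` integrates
  -- to a multiple of `u`.
  have hint : ∫ y, (heatKernel e c z y * F y * (1 - m) +
      ⟪(heatKernel e c z y * F y) • heatScore e c z y, h⟫) = u := by
    rw [integral_add (i0.mul_const _) (i1.inner_const h), integral_mul_const, ← h1]
    change u * (1 - m) + _ = u
    rw [hm]
    field_simp
    ring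
  calc u * Real.exp (m - Q) = ∫ y, Real.exp (m - Q) * (heatKernel e c z y * F y * (1 - m) +
      ⟪(heatKernel e c z y * F y) • heatScore e c z y, h⟫) := by
        rw [integral_const_mul, hint, mul_comm]
    _ ≤ ∫ y, heatKernel e c (z + h) y * F y := by
        refine integral_mono (((i0.mul_const _).add (i1.inner_const h)).const_mul _)
          (integrable_heat_one e hFc hM hc _) fun y => ?_
        change Real.exp (m - Q) * (heatKernel e c z y * F y * (1 - m) +
          ⟪(heatKernel e c z y * F y) • heatScore e c z y, h⟫) ≤ heatKernel e c (z + h) y * F y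
        rw [heatKernel_translate e hc, real_inner_smul_left]
        set x := ⟪heatScore e c z y, h⟫
        have hk := heatKernel_pos e hc z y
        have hx : Real.exp (m - Q) * (1 + (x - m)) ≤ Real.exp (x - Q) := by
          rw [show x - Q = (m - Q) + (x - m) by ring, Real.exp_add (m - Q)]
          gcongr
          linarith [Real.add_one_le_exp (x - m)]
        calc _ = (heatKernel e c z y * F y) * (Real.exp (m - Q) * (1 + (x - m))) := by ring
          _ ≤ (heatKernel e c z y * F y) * Real.exp (x - Q) := by
              have := hF0 y
              gcongr
          _ = _ := by ring

/-- Minus the logarithm of the heat extension. -/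
noncomputable def heatPotential (F : X → ℝ) (c : ι → ℝ) (z : X) : ℝ :=
  -Real.log (heatExp e F c z)

lemma heatExp_pos {F : X → ℝ} (hFc : Continuous F) {M : ℝ} (hM : ∀ y, |F y| ≤ M)
    (hF0 : ∀ y, 0 < F y) (c : ι → ℝ) (z : X) : 0 < heatExp e F c z := by
  have hcont : Continuous fun ξ => F (z + diagOp e (fun i => √(c i)) ξ) :=
    hFc.comp (by fun_prop)
  refine (integral_pos_iff_support_of_nonneg (fun ξ => (hF0 _).le)
    ((integrable_const M).mono' hcont.aestronglyMeasurable
      (Eventually.of_forall fun ξ => hM _))).2 ?_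
  have : Function.support (fun ξ => F (z + diagOp e (fun i => √(c i)) ξ)) = univ :=
    eq_univ_of_forall fun ξ => (hF0 _).ne'
  rw [this]
  simp

lemma heatExp_le {F : X → ℝ} (hFc : Continuous F) {M : ℝ} (hM : ∀ y, |F y| ≤ M)
    (c : ι → ℝ) (z : X) : heatExp e F c z ≤ M := by
  have hcont : Continuous fun ξ => F (z + diagOp e (fun i => √(c i)) ξ) :=
    hFc.comp (by fun_prop)
  calc heatExp e F c z ≤ ∫ _ξ : X, M ∂stdGaussian X :=
        integral_mono ((integrable_const M).mono' hcont.aestronglyMeasurable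
          (Eventually.of_forall fun ξ => hM _)) (integrable_const _)
          fun ξ => (le_abs_self _).trans (hM _)
    _ = M := by simp

namespace IsCovPath

variable {c cd : ℝ → ι → ℝ} (hc : IsCovPath c cd) {F : X → ℝ} (hF : ContDiff ℝ 2 F) {M : ℝ}
  (hM : ∀ y, |F y| ≤ M) (hF0 : ∀ y, 0 < F y)
include hc hF hM hF0

lemma hasFDerivAt_heatPotential {t : ℝ} (ht : 0 ≤ t) (z : X) :
    HasFDerivAt (heatPotential e F (c t))
      (innerSL ℝ (-(heatExp e F (c t) z)⁻¹ • ∇ (heatExp e F (c t)) z)) z := by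
  have h := ((hc.hasFDerivAt_heatExp_path e hF hM ht z).log
    (heatExp_pos e hF.continuous hM hF0 (c t) z).ne').neg
  refine h.congr_fderiv ?_
  rw [map_smul, neg_smul]

lemma gradient_heatPotential {t : ℝ} (ht : 0 ≤ t) :
    ∇ (heatPotential e F (c t)) =
      fun z => -(heatExp e F (c t) z)⁻¹ • ∇ (heatExp e F (c t)) z :=
  funext fun z => gradient_eq_of_hasFDerivAt (hc.hasFDerivAt_heatPotential e hF hM hF0 ht z)

lemma hasFDerivAt_gradient_heatPotential {t : ℝ} (ht : 0 ≤ t) (z : X) :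
    HasFDerivAt (∇ (heatPotential e F (c t)))
      (-(heatExp e F (c t) z)⁻¹ • fderiv ℝ (∇ (heatExp e F (c t))) z +
        ((heatExp e F (c t) z) ^ 2)⁻¹ • InnerProductSpace.rankOne ℝ
          (∇ (heatExp e F (c t)) z) (∇ (heatExp e F (c t)) z)) z := by
  rw [hc.gradient_heatPotential e hF hM hF0 ht]
  have hu := (heatExp_pos e hF.continuous hM hF0 (c t) z).ne'
  have h1 := (((hasFDerivAt_inv hu).comp z (hc.hasFDerivAt_heatExp_path e hF hM ht z)).neg).smul
    (hc.hasFDerivAt_gradient_heatExp e hF hM ht z)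
  refine h1.congr_fderiv (ContinuousLinearMap.ext fun d => ?_)
  simp [mul_comm, smul_smul]

lemma hess_heatPotential {t : ℝ} (ht : 0 ≤ t) (z : X) :
    hess (heatPotential e F (c t)) z =
      -(heatExp e F (c t) z)⁻¹ • fderiv ℝ (∇ (heatExp e F (c t))) z +
        ((heatExp e F (c t) z) ^ 2)⁻¹ • InnerProductSpace.rankOne ℝ
          (∇ (heatExp e F (c t)) z) (∇ (heatExp e F (c t)) z) :=
  (hc.hasFDerivAt_gradient_heatPotential e hF hM hF0 ht z).fderiv

lemma hasFDerivAt_gradient_heatPotential' {t : ℝ} (ht : 0 ≤ t) (z : X) :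
    HasFDerivAt (∇ (heatPotential e F (c t))) (hess (heatPotential e F (c t)) z) z :=
  (hc.hasFDerivAt_gradient_heatPotential e hF hM hF0 ht z).differentiableAt.hasFDerivAt

lemma continuousOn_gradient_heatPotential :
    ContinuousOn (fun p : ℝ × X => ∇ (heatPotential e F (c p.1)) p.2) (Ici 0 ×ˢ univ) := by
  have h1 := ((hc.continuousOn_heatExp e hF hM).inv₀ fun p _ =>
    (heatExp_pos e hF.continuous hM hF0 (c p.1) p.2).ne').neg.smul
    (hc.continuousOn_gradient_heatExp e hF hM)
  exact h1.congr fun p hp => by rw [hc.gradient_heatPotential e hF hM hF0 hp.1]; rfl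

lemma continuousOn_hess_heatPotential :
    ContinuousOn (fun p : ℝ × X => hess (heatPotential e F (c p.1)) p.2) (Ici 0 ×ˢ univ) := by
  have hu : ∀ p : ℝ × X, p ∈ Ici (0 : ℝ) ×ˢ univ → heatExp e F (c p.1) p.2 ≠ 0 := fun p _ =>
    (heatExp_pos e hF.continuous hM hF0 (c p.1) p.2).ne'
  have hg := hc.continuousOn_gradient_heatExp e hF hM
  have hcont := hc.continuousOn_heatExp e hF hM
  have h3 := continuous_rankOne_self.comp_continuousOn hg
  have h1 : ContinuousOn (fun p : ℝ × X => -(heatExp e F (c p.1) p.2)⁻¹ •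
      fderiv ℝ (∇ (heatExp e F (c p.1))) p.2) (Ici 0 ×ˢ univ) :=
    (hcont.inv₀ hu).neg.smul (hc.continuousOn_hessian_heatExp e hF hM)
  have h4 : ContinuousOn (fun p : ℝ × X => (heatExp e F (c p.1) p.2 ^ 2)⁻¹) (Ici 0 ×ˢ univ) :=
    (hcont.pow 2).inv₀ fun p hp => pow_ne_zero 2 (hu p hp)
  exact (h1.add (h4.smul h3)).congr fun p hp => hc.hess_heatPotential e hF hM hF0 hp.1 p.2

/-- The negative logarithm of `heatInt_translate_ge`, that is, `Hess V_t ≤ C_t⁻¹ ≤ s⁻¹` in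
integrated form. The constant involves no derivative of `F`. -/
lemma heatPotential_translate_le {t s : ℝ} (ht : 0 < t) (hs : 0 < s) (hsc : ∀ i, s ≤ c t i)
    (z h : X) :
    heatPotential e F (c t) (z + h) ≤ heatPotential e F (c t) z +
      ⟪∇ (heatPotential e F (c t)) z, h⟫ + 1 / 2 * (s⁻¹ * ‖h‖ ^ 2) := by
  have hct := hc.apply_pos ht
  have hu := heatExp_pos e hF.continuous hM hF0 (c t) z
  have hgr := congrFun (hc.gradient_heatExp e hF hM ht) z
  have key := heatInt_translate_ge e hF.continuous hM hF0 hct z h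
    (by rw [← heatExp_eq_heatInt e hF.continuous hct]; exact hu)
  rw [← hgr, ← heatExp_eq_heatInt e hF.continuous hct] at key
  have hl := Real.log_le_log (mul_pos hu (Real.exp_pos _)) key
  rw [Real.log_mul hu.ne' (Real.exp_pos _).ne', Real.log_exp] at hl
  have hq : ⟪h, diagOp e (c t)⁻¹ h⟫ ≤ s⁻¹ * ‖h‖ ^ 2 := by
    rw [inner_diagOp_right, norm_sq_eq_sum_coord e, Finset.mul_sum]
    refine Finset.sum_le_sum fun i _ => ?_
    rw [← sq]
    exact mul_le_mul_of_nonneg_right (inv_anti₀ hs (hsc i)) (sq_nonneg _)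
  have hgp : ⟪∇ (heatPotential e F (c t)) z, h⟫ =
      -((heatExp e F (c t) z)⁻¹ * ⟪∇ (heatExp e F (c t)) z, h⟫) := by
    rw [congrFun (hc.gradient_heatPotential e hF hM hF0 ht.le) z, neg_smul, inner_neg_left,
      real_inner_smul_left]
  rw [hgp, heatPotential, heatPotential]
  generalize Real.log (heatExp e F (c t) (z + h)) = a at hl ⊢
  generalize Real.log (heatExp e F (c t) z) = b at hl ⊢
  generalize (heatExp e F (c t) z)⁻¹ * ⟪∇ (heatExp e F (c t)) z, h⟫ = m at hl ⊢
  linarith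

/-- Away from time zero the gradient of the renormalised potential grows at most linearly. -/
lemma exists_gradient_heatPotential_le {ε T : ℝ} (hε : 0 < ε) :
    ∃ K : ℝ, 0 ≤ K ∧ ∀ t, ε ≤ t → t ≤ T → ∀ z,
      ‖∇ (heatPotential e F (c t)) z‖ ≤ K * (1 + ‖z‖) := by
  obtain ⟨κ, hκ0, -, hκ⟩ := hc.exists_mul_le T
  have hs : 0 < κ * ε := mul_pos hκ0 hε
  set L := (κ * ε)⁻¹ with hL
  have hL0 : 0 < L := inv_pos.2 hs
  have hsub : Icc ε T ×ˢ ({0} : Set X) ⊆ Ici 0 ×ˢ univ := fun p hp =>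
    ⟨hε.le.trans hp.1.1, mem_univ _⟩
  have hcomp : IsCompact (Icc ε T ×ˢ ({0} : Set X)) := isCompact_Icc.prod isCompact_singleton
  obtain ⟨B1, hB1⟩ := hcomp.exists_bound_of_continuousOn
    ((hc.continuousOn_gradient_heatPotential e hF hM hF0).mono hsub)
  have hVc : ContinuousOn (fun p : ℝ × X => heatPotential e F (c p.1) p.2) (Ici 0 ×ˢ univ) :=
    ((hc.continuousOn_heatExp e hF hM).log fun p _ =>
      (heatExp_pos e hF.continuous hM hF0 (c p.1) p.2).ne').neg
  obtain ⟨B0, hB0⟩ := hcomp.exists_bound_of_continuousOn (hVc.mono hsub)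
  set v := -Real.log M with hv
  have hV : ∀ t z, v ≤ heatPotential e F (c t) z := fun t z =>
    neg_le_neg (Real.log_le_log (heatExp_pos e hF.continuous hM hF0 (c t) z)
      (heatExp_le e hF.continuous hM (c t) z))
  set B := |B0| + |v| + |B1| + L with hB
  have hB' : 0 ≤ B := by positivity
  refine ⟨√(2 * L * B), Real.sqrt_nonneg _, fun t h0 h1 z => ?_⟩
  have ht : 0 < t := hε.trans_le h0
  have hsc : ∀ i, κ * ε ≤ c t i := fun i =>
    (mul_le_mul_of_nonneg_left h0 hκ0.le).trans (hκ t ht.le h1 i)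
  set g := ∇ (heatPotential e F (c t)) z with hg
  -- The step `-L⁻¹ g` lowers the potential by at least `‖g‖² / (2L)`, yet the potential stays above
  -- `v`.
  have e1 : ‖g‖ ^ 2 ≤ 2 * L * (heatPotential e F (c t) z - v) := by
    have h2 := hc.heatPotential_translate_le e hF hM hF0 ht hs hsc z (-(L⁻¹) • g)
    have h3 := hV t (z + -(L⁻¹) • g)
    rw [← hg, real_inner_smul_right, real_inner_self_eq_norm_sq, norm_smul, mul_pow,
      Real.norm_eq_abs, sq_abs, neg_sq] at h2
    have h4 : L⁻¹ * ‖g‖ ^ 2 / 2 ≤ heatPotential e F (c t) z - v := by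
      have : 1 / 2 * ((κ * ε)⁻¹ * ((L⁻¹) ^ 2 * ‖g‖ ^ 2)) = L⁻¹ * ‖g‖ ^ 2 / 2 := by
        rw [← hL]; field_simp
      linarith
    calc ‖g‖ ^ 2 = 2 * L * (L⁻¹ * ‖g‖ ^ 2 / 2) := by field_simp
      _ ≤ _ := by gcongr
  -- The quadratic upper bound based at the origin, where value and gradient are bounded by
  -- compactness in time. With `e1` the gradient grows linearly.
  have e2 : heatPotential e F (c t) z - v ≤ B * (1 + ‖z‖) ^ 2 := by
    have h2 := hc.heatPotential_translate_le e hF hM hF0 ht hs hsc 0 z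
    rw [zero_add] at h2
    have h3 := hB0 (t, 0) ⟨⟨h0, h1⟩, rfl⟩
    have h4 := hB1 (t, 0) ⟨⟨h0, h1⟩, rfl⟩
    have h5 := real_inner_le_norm (∇ (heatPotential e F (c t)) 0) z
    simp only [Real.norm_eq_abs] at h3
    have h6 := (le_abs_self _).trans h3
    have h7 := le_abs_self B0
    have h8 := neg_abs_le v
    have h9 := le_abs_self B1
    have h10 := norm_nonneg z
    have h11 : ‖∇ (heatPotential e F (c t)) 0‖ * ‖z‖ ≤ |B1| * ‖z‖ :=
      mul_le_mul_of_nonneg_right (h4.trans h9) h10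
    have h12 : 0 ≤ |B0| := abs_nonneg _
    have h13 : 0 ≤ |v| := abs_nonneg _
    have h14 : 0 ≤ |B1| := abs_nonneg _
    rw [← hL] at h2
    have h15 : 0 ≤ L * ‖z‖ := by positivity
    have h16 : 0 ≤ |B1| * ‖z‖ := by positivity
    have h17 : 0 ≤ (|B0| + |v| + |B1| + L) * (2 * ‖z‖) - |B1| * ‖z‖ := by
      have : 0 ≤ (|B0| + |v| + L) * ‖z‖ := by positivity
      nlinarith
    have h18 : 0 ≤ (|B0| + |v| + |B1|) * ‖z‖ ^ 2 := by positivity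
    have h19 : 0 ≤ L * ‖z‖ ^ 2 := by positivity
    nlinarith
  refine abs_le_of_sq_le_sq' ?_ (by positivity) |>.2
  rw [mul_pow, Real.sq_sqrt (by positivity)]
  calc ‖g‖ ^ 2 ≤ 2 * L * (B * (1 + ‖z‖) ^ 2) := e1.trans (by gcongr)
    _ = _ := by ring

end IsCovPath

end RenormalisedPotential

/-! ### Truncation by radial retraction. -/

section RadialRetraction

variable {E : Type*} [NormedAddCommGroup E] [NormedSpace ℝ E]

/-- The radial retraction onto the closed ball of radius `R`. -/
noncomputable def radial (R : ℝ) (x : E) : E := (R / max R ‖x‖) • x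

lemma radial_of_le {R : ℝ} (hR : 0 < R) {x : E} (hx : ‖x‖ ≤ R) : radial R x = x := by
  rw [radial, max_eq_left hx, div_self hR.ne', one_smul]

lemma radial_coeff_mem {R : ℝ} (hR : 0 < R) (x : E) :
    0 < R / max R ‖x‖ ∧ R / max R ‖x‖ ≤ 1 := by
  have : 0 < max R ‖x‖ := hR.trans_le (le_max_left _ _)
  exact ⟨div_pos hR this, (div_le_one this).2 (le_max_left _ _)⟩

lemma norm_radial_le_norm {R : ℝ} (hR : 0 < R) (x : E) : ‖radial R x‖ ≤ ‖x‖ := by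
  obtain ⟨h0, h1⟩ := radial_coeff_mem hR x
  rw [radial, norm_smul, Real.norm_of_nonneg h0.le]
  exact mul_le_of_le_one_left (norm_nonneg _) h1

lemma norm_radial_le {R : ℝ} (hR : 0 < R) (x : E) : ‖radial R x‖ ≤ R := by
  obtain ⟨h0, h1⟩ := radial_coeff_mem hR x
  have : 0 < max R ‖x‖ := hR.trans_le (le_max_left _ _)
  rw [radial, norm_smul, Real.norm_of_nonneg h0.le, div_mul_eq_mul_div, div_le_iff₀ this]
  exact mul_le_mul_of_nonneg_left (le_max_right _ _) hR.le

/-- The difference splits into a coefficient times `x - y` and a change of coefficient times `y`;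
each part costs at most `‖x - y‖`. -/
lemma lipschitzWith_radial {R : ℝ} (hR : 0 < R) : LipschitzWith 2 (radial R : E → E) := by
  refine LipschitzWith.of_dist_le_mul fun x y => ?_
  rw [dist_eq_norm, dist_eq_norm]
  have hx : 0 < max R ‖x‖ := hR.trans_le (le_max_left _ _)
  have hy : 0 < max R ‖y‖ := hR.trans_le (le_max_left _ _)
  obtain ⟨h0, h1⟩ := radial_coeff_mem hR x
  have e1 : radial R x - radial R y =
      (R / max R ‖x‖) • (x - y) + (R / max R ‖x‖ - R / max R ‖y‖) • y := by
    simp only [radial]; module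
  have e2 : |R / max R ‖x‖ - R / max R ‖y‖| * ‖y‖ ≤ ‖x - y‖ := by
    have h3 : R / max R ‖x‖ - R / max R ‖y‖ =
        R / max R ‖x‖ * ((max R ‖y‖ - max R ‖x‖) / max R ‖y‖) := by field_simp
    have h4 : |max R ‖y‖ - max R ‖x‖| ≤ ‖x - y‖ := by
      calc _ ≤ |‖y‖ - ‖x‖| := by
            have := abs_max_sub_max_le_abs ‖y‖ ‖x‖ R
            rwa [max_comm ‖y‖, max_comm ‖x‖] at this
        _ ≤ ‖y - x‖ := abs_norm_sub_norm_le _ _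
        _ = _ := norm_sub_rev _ _
    rw [h3, abs_mul, abs_of_pos h0, abs_div, abs_of_pos hy]
    calc R / max R ‖x‖ * (|max R ‖y‖ - max R ‖x‖| / max R ‖y‖) * ‖y‖
        ≤ 1 * (‖x - y‖ / max R ‖y‖) * max R ‖y‖ := by
          gcongr
          exact le_max_right _ _
      _ = _ := by field_simp
  calc ‖radial R x - radial R y‖
      ≤ R / max R ‖x‖ * ‖x - y‖ + |R / max R ‖x‖ - R / max R ‖y‖| * ‖y‖ := by
        rw [e1]
        refine (norm_add_le _ _).trans_eq ?_
        rw [norm_smul, norm_smul, Real.norm_of_nonneg h0.le, Real.norm_eq_abs]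
    _ ≤ 1 * ‖x - y‖ + ‖x - y‖ := by gcongr
    _ = (2 : NNReal) * ‖x - y‖ := by push_cast; ring

end RadialRetraction

/-! ### Ordinary differential equations with locally Lipschitz fields. -/

section DifferentialEquations

variable {E : Type*} [NormedAddCommGroup E] [NormedSpace ℝ E]

/-- `α` solves `α' = v(t, α)` on `[a, b]`. -/
def IsSolOn (v : ℝ → E → E) (a b : ℝ) (α : ℝ → E) : Prop :=
  ∀ t ∈ Icc a b, HasDerivWithinAt α (v t (α t)) (Icc a b) t

/-- The field `v` is Lipschitz on balls, uniformly for times in `[a, b]`, and continuous in time. -/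
structure IsLocLip (v : ℝ → E → E) (a b : ℝ) : Prop where
  lip : ∀ R : ℝ, ∃ K : NNReal, ∀ t ∈ Icc a b, LipschitzOnWith K (v t) (Metric.closedBall 0 R)
  cont : ∀ x, ContinuousOn (fun t => v t x) (Icc a b)

lemma IsSolOn.continuousOn {v : ℝ → E → E} {a b : ℝ} {α : ℝ → E} (h : IsSolOn v a b α) :
    ContinuousOn α (Icc a b) := fun t ht => (h t ht).continuousWithinAt

lemma IsSolOn.mono {v : ℝ → E → E} {a b a' b' : ℝ} {α : ℝ → E} (h : IsSolOn v a b α)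
    (hs : Icc a' b' ⊆ Icc a b) : IsSolOn v a' b' α := fun t ht => (h t (hs ht)).mono hs

lemma IsSolOn.hasDerivAt {v : ℝ → E → E} {a b : ℝ} {α : ℝ → E} (h : IsSolOn v a b α)
    {t : ℝ} (ht : t ∈ Ioo a b) : HasDerivAt α (v t (α t)) t :=
  (h t (Ioo_subset_Icc_self ht)).hasDerivAt (Icc_mem_nhds ht.1 ht.2)

lemma IsSolOn.hasDerivWithinAt_Ici {v : ℝ → E → E} {a b : ℝ} {α : ℝ → E}
    (h : IsSolOn v a b α) {t : ℝ} (ht : t ∈ Ico a b) :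
    HasDerivWithinAt α (v t (α t)) (Ici t) t :=
  (h t (Ico_subset_Icc_self ht)).mono_of_mem_nhdsWithin
    (mem_of_superset (Icc_mem_nhdsGE ht.2) (Icc_subset_Icc_left ht.1))

lemma IsSolOn.hasDerivWithinAt_Iic {v : ℝ → E → E} {a b : ℝ} {α : ℝ → E}
    (h : IsSolOn v a b α) {t : ℝ} (ht : t ∈ Ioc a b) :
    HasDerivWithinAt α (v t (α t)) (Iic t) t :=
  (h t (Ioc_subset_Icc_self ht)).mono_of_mem_nhdsWithin
    (mem_of_superset (Icc_mem_nhdsLE ht.1) (Icc_subset_Icc_right ht.2))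

lemma IsLocLip.mono {v : ℝ → E → E} {a b a' b' : ℝ} (h : IsLocLip v a b)
    (hs : Icc a' b' ⊆ Icc a b) : IsLocLip v a' b' :=
  ⟨fun R => (h.lip R).imp fun _ hK t ht => hK t (hs ht), fun x => (h.cont x).mono hs⟩

lemma IsLocLip.exists_bound {v : ℝ → E → E} {a b : ℝ} (h : IsLocLip v a b) (R : ℝ) :
    ∃ M : ℝ, 0 ≤ M ∧ ∀ t ∈ Icc a b, ∀ x, ‖x‖ ≤ R → ‖v t x‖ ≤ M := by
  obtain ⟨K, hK⟩ := h.lip R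
  obtain ⟨B, hB⟩ := isCompact_Icc.exists_bound_of_continuousOn (h.cont 0)
  refine ⟨|B| + K * |R|, by positivity, fun t ht x hx => ?_⟩
  have hR : 0 ≤ R := (norm_nonneg x).trans hx
  have h1 := (hK t ht).dist_le_mul x (by simpa using hx) 0 (by simpa using hR)
  rw [dist_eq_norm, dist_zero_right] at h1
  calc ‖v t x‖ = ‖v t 0 + (v t x - v t 0)‖ := by rw [add_sub_cancel]
    _ ≤ ‖v t 0‖ + ‖v t x - v t 0‖ := norm_add_le _ _
    _ ≤ |B| + K * |R| := by
        refine add_le_add ((hB t ht).trans (le_abs_self _)) (h1.trans ?_)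
        gcongr
        exact hx.trans (le_abs_self _)

lemma IsLocLip.lipschitzWith_radial {v : ℝ → E → E} {a b : ℝ} (h : IsLocLip v a b) {R : ℝ}
    (hR : 0 < R) :
    ∃ K : NNReal, ∀ t ∈ Icc a b, LipschitzWith K fun x => v t (radial R x) := by
  obtain ⟨K, hK⟩ := h.lip R
  refine ⟨K * 2, fun t ht => ?_⟩
  rw [← lipschitzOnWith_univ]
  exact (hK t ht).comp (lipschitzOnWith_univ.2 (PolchinskiFlow.lipschitzWith_radial hR))
    fun x _ => by simpa using norm_radial_le hR x

lemma IsLocLip.radial {v : ℝ → E → E} {a b : ℝ} (h : IsLocLip v a b) {R : ℝ} (hR : 0 < R) :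
    IsLocLip (fun t x => v t (radial R x)) a b := by
  obtain ⟨K, hK⟩ := h.lipschitzWith_radial hR
  exact ⟨fun _ => ⟨K, fun t ht => (hK t ht).lipschitzOnWith⟩, fun x => h.cont _⟩

/-- Existence for the field truncated at radius `R`. -/
lemma IsLocLip.exists_isSolOn_radial [CompleteSpace E] {v : ℝ → E → E} {a b : ℝ}
    (h : IsLocLip v a b) {R : ℝ} (hR : 0 < R) {t₀ : ℝ} (ht₀ : t₀ ∈ Icc a b) (x₀ : E) :
    ∃ α : ℝ → E, α t₀ = x₀ ∧ IsSolOn (fun t x => v t (PolchinskiFlow.radial R x)) a b α := by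
  obtain ⟨K, hK⟩ := h.lipschitzWith_radial hR
  obtain ⟨M, hM0, hM⟩ := h.exists_bound R
  have hab : a ≤ b := ht₀.1.trans ht₀.2
  -- The truncated field is bounded by `M`, so a ball of radius `M (b - a)` is never left and a
  -- single application covers the whole interval.
  have hPL : IsPicardLindelof (fun t x => v t (PolchinskiFlow.radial R x)) (⟨t₀, ht₀⟩ : Icc a b) x₀
      ⟨M * (b - a), mul_nonneg hM0 (sub_nonneg.2 hab)⟩ 0 ⟨M, hM0⟩ K :=
    { lipschitzOnWith := fun t ht => (hK t ht).lipschitzOnWith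
      continuousOn := fun x _ => h.cont _
      norm_le := fun t ht x _ => hM t ht _ (norm_radial_le hR x)
      mul_max_le := by
        simp only [NNReal.coe_zero, sub_zero]
        refine mul_le_mul_of_nonneg_left (max_le ?_ ?_) hM0
        · linarith [ht₀.1]
        · linarith [ht₀.2] }
  exact hPL.exists_eq_forall_mem_Icc_hasDerivWithinAt₀

/-- By compactness both curves stay in one ball, where the field is Lipschitz. Both time directions
are treated, since injectivity of the flow compares solutions at their final time. -/
lemma IsLocLip.eqOn {v : ℝ → E → E} {a b : ℝ} (h : IsLocLip v a b) {α β : ℝ → E}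
    (hα : IsSolOn v a b α) (hβ : IsSolOn v a b β) {t₀ : ℝ} (ht₀ : t₀ ∈ Icc a b)
    (h₀ : α t₀ = β t₀) : EqOn α β (Icc a b) := by
  obtain ⟨B1, hB1⟩ := isCompact_Icc.exists_bound_of_continuousOn hα.continuousOn
  obtain ⟨B2, hB2⟩ := isCompact_Icc.exists_bound_of_continuousOn hβ.continuousOn
  obtain ⟨K, hK⟩ := h.lip (max B1 B2)
  have s1 : ∀ t ∈ Icc a b, α t ∈ Metric.closedBall (0 : E) (max B1 B2) := fun t ht => by
    simpa using Or.inl (hB1 t ht)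
  have s2 : ∀ t ∈ Icc a b, β t ∈ Metric.closedBall (0 : E) (max B1 B2) := fun t ht => by
    simpa using Or.inr (hB2 t ht)
  have hr : Icc t₀ b ⊆ Icc a b := Icc_subset_Icc_left ht₀.1
  have hl : Icc a t₀ ⊆ Icc a b := Icc_subset_Icc_right ht₀.2
  have r1 : EqOn α β (Icc t₀ b) := by
    have hsub : Ico t₀ b ⊆ Icc a b := Ico_subset_Icc_self.trans hr
    exact ODE_solution_unique_of_mem_Icc_right (fun t ht => hK t (hsub ht))
      (hα.mono hr).continuousOn (fun t ht => (hα.mono hr).hasDerivWithinAt_Ici ht)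
      (fun t ht => s1 t (hsub ht)) (hβ.mono hr).continuousOn
      (fun t ht => (hβ.mono hr).hasDerivWithinAt_Ici ht) (fun t ht => s2 t (hsub ht)) h₀
  have r2 : EqOn α β (Icc a t₀) := by
    have hsub : Ioc a t₀ ⊆ Icc a b := Ioc_subset_Icc_self.trans hl
    exact ODE_solution_unique_of_mem_Icc_left (fun t ht => hK t (hsub ht))
      (hα.mono hl).continuousOn (fun t ht => (hα.mono hl).hasDerivWithinAt_Iic ht)
      (fun t ht => s1 t (hsub ht)) (hβ.mono hl).continuousOn
      (fun t ht => (hβ.mono hl).hasDerivWithinAt_Iic ht) (fun t ht => s2 t (hsub ht)) h₀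
  rw [← Icc_union_Icc_eq_Icc ht₀.1 ht₀.2]
  exact r2.union r1

/-- Global forward existence with bounds uniform over balls of initial data, when the field grows
at most linearly away from time zero. -/
lemma IsLocLip.exists_isSolOn [CompleteSpace E] {v : ℝ → E → E} {T : ℝ} (hT : 0 < T)
    (h : IsLocLip v 0 T)
    (hg : ∀ ε, 0 < ε → ∃ K : ℝ, 0 ≤ K ∧ ∀ t, ε ≤ t → t ≤ T → ∀ x, ‖v t x‖ ≤ K * (1 + ‖x‖))
    {ρ : ℝ} (hρ : 0 ≤ ρ) :
    ∃ R : ℝ, ∀ x₀ : E, ‖x₀‖ ≤ ρ →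
      ∃ α : ℝ → E, α 0 = x₀ ∧ IsSolOn v 0 T α ∧ ∀ t ∈ Icc 0 T, ‖α t‖ ≤ R := by
  have hr0 : 0 < ρ + 1 := by linarith
  obtain ⟨M, hM0, hM⟩ := h.exists_bound (ρ + 1)
  -- Short enough that `M ε ≤ 1`: up to time `ε`, where no growth bound is available, a point moves
  -- by at most one.
  set ε := min T (1 / (M + 1)) with hε
  have hε0 : 0 < ε := lt_min hT (by positivity)
  have hεT : ε ≤ T := min_le_left _ _
  have hMε : M * ε ≤ 1 := by
    calc M * ε ≤ M * (1 / (M + 1)) := by gcongr; exact min_le_right _ _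
      _ ≤ 1 := by rw [mul_one_div, div_le_one (by positivity)]; linarith
  obtain ⟨K, hK0, hK⟩ := hg ε hε0
  -- The first entry bounds the solution up to `ε`, the second afterwards by linear growth. Neither
  -- depends on `x₀`.
  set R := max (ρ + 1) (gronwallBound (ρ + 1) K K T) with hR
  have hR0 : 0 < R := hr0.trans_le (le_max_left _ _)
  refine ⟨R, fun x₀ hx₀ => ?_⟩
  have h0T : (0 : ℝ) ∈ Icc 0 T := ⟨le_rfl, hT.le⟩
  have h0ε : (0 : ℝ) ∈ Icc 0 ε := ⟨le_rfl, hε0.le⟩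
  have hsub : Icc 0 ε ⊆ Icc 0 T := Icc_subset_Icc_right hεT
  obtain ⟨y, hy0, hy⟩ := h.exists_isSolOn_radial hr0 h0T x₀
  obtain ⟨x, hx0, hx⟩ := h.exists_isSolOn_radial hR0 h0T x₀
  have hyb : ∀ t ∈ Icc 0 ε, ‖y t‖ ≤ ρ + 1 := fun t ht => by
    have h1 := norm_image_sub_le_of_norm_deriv_le_segment' hy
      (fun s hs => hM s (Ico_subset_Icc_self hs) _ (norm_radial_le hr0 _)) t (hsub ht)
    rw [hy0, sub_zero] at h1
    have h2 : M * t ≤ 1 := (mul_le_mul_of_nonneg_left ht.2 hM0).trans hMε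
    calc ‖y t‖ = ‖(y t - x₀) + x₀‖ := by rw [sub_add_cancel]
      _ ≤ ‖y t - x₀‖ + ‖x₀‖ := norm_add_le _ _
      _ ≤ ρ + 1 := by linarith
  -- On `[0, ε]` neither truncation acts along `y`, so `x` and `y` solve the same equation there.
  have hxy : EqOn x y (Icc 0 ε) := by
    refine ((h.radial hR0).mono hsub).eqOn (hx.mono hsub) (fun t ht => ?_) h0ε (hx0.trans hy0.symm)
    have h1 := (hy.mono hsub) t ht
    have h2 := hyb t ht
    simp only [radial_of_le hr0 h2] at h1
    simpa only [radial_of_le hR0 (h2.trans (le_max_left _ _))] using h1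
  have hxb : ∀ t ∈ Icc 0 T, ‖x t‖ ≤ R := by
    intro t ht
    rcases le_total t ε with h1 | h1
    · rw [hxy ⟨ht.1, h1⟩]
      exact (hyb t ⟨ht.1, h1⟩).trans (le_max_left _ _)
    · have hsub' : Icc ε T ⊆ Icc 0 T := Icc_subset_Icc_left hε0.le
      have h3 := norm_le_gronwallBound_of_norm_deriv_right_le (f := x)
        (f' := fun t => v t (PolchinskiFlow.radial R (x t))) (δ := ρ + 1) (K := K) (ε := K)
        (a := ε) (b := T)
        (hx.mono hsub').continuousOn (fun s hs => (hx.mono hsub').hasDerivWithinAt_Ici hs)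
        (by rw [hxy ⟨hε0.le, le_rfl⟩]; exact hyb ε ⟨hε0.le, le_rfl⟩)
        (fun s hs => by
          refine (hK s hs.1 hs.2.le _).trans ?_
          rw [mul_add, mul_one, add_comm]
          gcongr
          exact norm_radial_le_norm hR0 _) t ⟨h1, ht.2⟩
      refine h3.trans (le_trans ?_ (le_max_right _ _))
      exact gronwallBound_mono hr0.le hK0 hK0 (by linarith [ht.2])
  refine ⟨x, hx0, fun t ht => ?_, hxb⟩
  simpa only [radial_of_le hR0 (hxb t ht)] using hx t ht

/-- A logarithmic Gronwall inequality with an integrable coefficient. -/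
lemma mul_exp_integral_le {N N' k : ℝ → ℝ} {a b : ℝ} (hab : a ≤ b)
    (hN : ContinuousOn N (Icc a b)) (hpos : ∀ t ∈ Icc a b, 0 < N t)
    (hd : ∀ t ∈ Ioo a b, HasDerivAt N (N' t) t) (hk : IntervalIntegrable k volume a b)
    (hle : ∀ t ∈ Ioo a b, k t * N t ≤ N' t) :
    N a * Real.exp (∫ s in a..b, k s) ≤ N b := by
  -- Integrates `(log N)' ≥ k`. The inequality form requires integrability of `k` only, not of `N' /
  -- N`.
  have h1 := intervalIntegral.integral_le_sub_of_hasDeriv_right_of_le hab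
    (g := fun t => Real.log (N t)) (g' := fun t => N' t / N t) (φ := k)
    (hN.log fun t ht => (hpos t ht).ne')
    (fun t ht => ((hd t ht).log (hpos t (Ioo_subset_Icc_self ht)).ne').hasDerivWithinAt)
    ((intervalIntegrable_iff_integrableOn_Icc_of_le hab).1 hk)
    (fun t ht => (le_div_iff₀ (hpos t (Ioo_subset_Icc_self ht))).2 (hle t ht))
  have ha := hpos a ⟨le_rfl, hab⟩
  have hb := hpos b ⟨hab, le_rfl⟩
  calc N a * Real.exp (∫ s in a..b, k s)
      ≤ N a * Real.exp (Real.log (N b) - Real.log (N a)) := by gcongr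
    _ = N b := by rw [Real.exp_sub, Real.exp_log ha, Real.exp_log hb]; field_simp

end DifferentialEquations

/-! ### Expansion estimates; global solutions forwards and backwards. -/

section ExpandingFlows

variable {X : Type*} [NormedAddCommGroup X] [InnerProductSpace ℝ X] [FiniteDimensional ℝ X]

/-- A `C¹` time-dependent field `v` for `t ≥ 0`, growing at most linearly away from time zero and
expanding with rate `k` in the metric `1 + t B`. -/
structure IsExpandingField (v : ℝ → X → X) (Dv : ℝ → X → X →L[ℝ] X) (B : X →L[ℝ] X)
    (k : ℝ → ℝ) : Prop where
  cont : ContinuousOn (fun p : ℝ × X => v p.1 p.2) (Ici 0 ×ˢ univ)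
  deriv : ∀ t, 0 ≤ t → ∀ x, HasFDerivAt (v t) (Dv t x) x
  cont_deriv : ContinuousOn (fun p : ℝ × X => Dv p.1 p.2) (Ici 0 ×ˢ univ)
  growth : ∀ ε T : ℝ, 0 < ε → ∃ K : ℝ, 0 ≤ K ∧
    ∀ t, ε ≤ t → t ≤ T → ∀ x, ‖v t x‖ ≤ K * (1 + ‖x‖)
  symm : ∀ x y, ⟪B x, y⟫ = ⟪x, B y⟫
  nonneg : ∀ x, 0 ≤ ⟪x, B x⟫
  integrable : ∀ t, 0 ≤ t → IntervalIntegrable k volume 0 t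
  expand : ∀ t, 0 < t → ∀ x y, k t * (‖x - y‖ ^ 2 + t * ⟪x - y, B (x - y)⟫) ≤
    ⟪x - y, B (x - y)⟫ + 2 * ⟪(x - y) + t • B (x - y), v t x - v t y⟫

/-- The squared length in the metric `1 + t B`. -/
noncomputable def metricSq (B : X →L[ℝ] X) (t : ℝ) (w : X) : ℝ := ‖w‖ ^ 2 + t * ⟪w, B w⟫

namespace IsExpandingField

variable {v : ℝ → X → X} {Dv : ℝ → X → X →L[ℝ] X} {B : X →L[ℝ] X} {k : ℝ → ℝ}
  (h : IsExpandingField v Dv B k)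
include h

lemma norm_sq_le_metricSq {t : ℝ} (ht : 0 ≤ t) (w : X) : ‖w‖ ^ 2 ≤ metricSq B t w :=
  le_add_of_nonneg_right (mul_nonneg ht (h.nonneg w))

lemma metricSq_pos {t : ℝ} (ht : 0 ≤ t) {w : X} (hw : w ≠ 0) : 0 < metricSq B t w :=
  (pow_pos (norm_pos_iff.2 hw) 2).trans_le (h.norm_sq_le_metricSq ht w)

lemma hasDerivAt_metricSq {w : ℝ → X} {w' : X} {t : ℝ} (hw : HasDerivAt w w' t) :
    HasDerivAt (fun s => metricSq B s (w s))
      (⟪w t, B (w t)⟫ + 2 * ⟪w t + t • B (w t), w'⟫) t := by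
  have h1 := hw.norm_sq
  have h2 := hw.inner ℝ (B.hasFDerivAt.comp_hasDerivAt t hw)
  have h3 := h1.add ((hasDerivAt_id t).mul h2)
  refine h3.congr_deriv ?_
  have h4 : ⟪w', B (w t)⟫ = ⟪w t, B w'⟫ := by rw [real_inner_comm, h.symm]
  simp only [id, Function.comp_apply, inner_add_left, real_inner_smul_left, h.symm, h4]
  ring

lemma continuousOn_metricSq {w : ℝ → X} {s : Set ℝ} (hw : ContinuousOn w s) :
    ContinuousOn (fun t => metricSq B t (w t)) s := by
  unfold metricSq
  exact (hw.norm.pow 2).add (continuousOn_id.mul (hw.inner (B.continuous.comp_continuousOn hw)))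

lemma continuousOn_along {T : ℝ} {y : ℝ → X} (hy : ContinuousOn y (Icc 0 T)) :
    ContinuousOn (fun t => v t (y t)) (Icc 0 T) :=
  h.cont.comp (continuousOn_id.prodMk hy) fun _ ht => ⟨ht.1, mem_univ _⟩

lemma exists_deriv_bound (T R : ℝ) :
    ∃ K : NNReal, ∀ t ∈ Icc 0 T, ∀ x, ‖x‖ ≤ R → ‖Dv t x‖ ≤ K := by
  obtain ⟨C, hC⟩ := ((isCompact_Icc (a := (0 : ℝ)) (b := T)).prod
    (isCompact_closedBall (0 : X) R)).exists_bound_of_continuousOn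
      (h.cont_deriv.mono fun p hp => ⟨hp.1.1, mem_univ _⟩)
  refine ⟨‖C‖₊, fun t ht x hx => (hC (t, x) ⟨ht, by simpa using hx⟩).trans ?_⟩
  exact Real.le_norm_self C

lemma lipschitzOnWith {T R : ℝ} {K : NNReal}
    (hK : ∀ t ∈ Icc 0 T, ∀ x, ‖x‖ ≤ R → ‖Dv t x‖ ≤ K) :
    ∀ t ∈ Icc 0 T, LipschitzOnWith K (v t) (Metric.closedBall 0 R) := fun t ht =>
  (convex_closedBall 0 R).lipschitzOnWith_of_nnnorm_hasFDerivWithin_le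
    (fun x _ => (h.deriv t ht.1 x).hasFDerivWithinAt)
    fun x hx => by exact_mod_cast hK t ht x (by simpa using hx)

lemma isLocLip (T : ℝ) : IsLocLip v 0 T where
  lip R := by
    obtain ⟨K, hK⟩ := h.exists_deriv_bound T R
    exact ⟨K, h.lipschitzOnWith hK⟩
  cont x := h.continuousOn_along continuousOn_const

lemma exists_forward {T : ℝ} (hT : 0 < T) {ρ : ℝ} (hρ : 0 ≤ ρ) :
    ∃ R : ℝ, ∀ x₀ : X, ‖x₀‖ ≤ ρ →
      ∃ α : ℝ → X, α 0 = x₀ ∧ IsSolOn v 0 T α ∧ ∀ t ∈ Icc 0 T, ‖α t‖ ≤ R :=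
  (h.isLocLip T).exists_isSolOn hT (fun ε hε => h.growth ε T hε) hρ

/-- Two solutions separate at least at the rate `k`. -/
lemma metricSq_sub_ge {T : ℝ} (hT : 0 ≤ T) {x y : ℝ → X} (hx : IsSolOn v 0 T x)
    (hy : IsSolOn v 0 T y) :
    ‖x 0 - y 0‖ ^ 2 * Real.exp (∫ s in (0 : ℝ)..T, k s) ≤ metricSq B T (x T - y T) := by
  by_cases h0 : x 0 = y 0
  · rw [h0, sub_self, norm_zero, zero_pow two_ne_zero, zero_mul]
    exact (sq_nonneg _).trans (h.norm_sq_le_metricSq hT _)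
  -- Solutions that start apart never meet, so the logarithm of the metric is defined throughout.
  have hne : ∀ t ∈ Icc 0 T, x t - y t ≠ 0 := fun t ht he =>
    h0 ((h.isLocLip T).eqOn hx hy ht (sub_eq_zero.1 he) ⟨le_rfl, hT⟩)
  have key := mul_exp_integral_le (N := fun t => metricSq B t (x t - y t)) (k := k) hT
    (h.continuousOn_metricSq (hx.continuousOn.sub hy.continuousOn))
    (fun t ht => h.metricSq_pos ht.1 (hne t ht))
    (fun t ht => h.hasDerivAt_metricSq ((hx.hasDerivAt ht).sub (hy.hasDerivAt ht)))
    (h.integrable T hT) (fun t ht => h.expand t ht.1 _ _)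
  simpa [metricSq] using key

/-- Global backward existence, by comparison with a reference solution. -/
lemma exists_backward {T : ℝ} (hT : 0 ≤ T) {y : ℝ → X} (hy : IsSolOn v 0 T y) (x₁ : X) :
    ∃ x : ℝ → X, x T = x₁ ∧ IsSolOn v 0 T x := by
  by_cases h0 : x₁ - y T = 0
  · exact ⟨y, (sub_eq_zero.1 h0).symm, hy⟩
  have hTm : T ∈ Icc 0 T := ⟨hT, le_rfl⟩
  -- The equation for the difference to the reference solution. It has the zero solution, and
  -- truncating in `w` keeps the expansion estimate usable.
  set f : ℝ → X → X := fun t w => v t (y t + w) - v t (y t) with hf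
  obtain ⟨b, hb⟩ := isCompact_Icc.exists_bound_of_continuousOn hy.continuousOn
  have hfl : IsLocLip f 0 T := by
    refine ⟨fun R => ?_, fun x => ?_⟩
    · obtain ⟨K, hK⟩ := (h.isLocLip T).lip (b + R)
      refine ⟨K, fun t ht => LipschitzOnWith.of_dist_le_mul fun w hw w' hw' => ?_⟩
      have hm : ∀ w ∈ Metric.closedBall (0 : X) R, y t + w ∈ Metric.closedBall (0 : X) (b + R) :=
        fun w hw => by
          rw [mem_closedBall_zero_iff] at hw ⊢
          exact (norm_add_le _ _).trans (add_le_add (hb t ht) hw)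
      have := (hK t ht).dist_le_mul _ (hm w hw) _ (hm w' hw')
      simpa [hf, dist_eq_norm] using this
    · exact (h.continuousOn_along (hy.continuousOn.add continuousOn_const)).sub
        (h.continuousOn_along hy.continuousOn)
  -- The largest squared length a backward solution can reach at rate `-|k|`. Truncation at radius
  -- `√C` will therefore turn out to be inactive.
  set C := metricSq B T (x₁ - y T) * Real.exp (∫ s in (0 : ℝ)..T, |k s|) with hC
  have hC0 : 0 < C := mul_pos (h.metricSq_pos hT h0) (Real.exp_pos _)
  have hR : 0 < √C := Real.sqrt_pos.2 hC0
  obtain ⟨w, hwT, hw⟩ := hfl.exists_isSolOn_radial hR hTm (x₁ - y T)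
  have hz : IsSolOn (fun t x => f t (radial (√C) x)) 0 T fun _ => 0 := fun t _ => by
    have : f t (radial (√C) 0) = 0 := by simp [hf, radial]
    exact (hasDerivWithinAt_const _ _ _).congr_deriv this.symm
  have hne : ∀ t ∈ Icc 0 T, w t ≠ 0 := fun t ht he => by
    have := (hfl.radial hR).eqOn hw hz ht he hTm
    rw [hwT] at this
    exact h0 this
  have habs : ∀ s ∈ Icc 0 T, IntervalIntegrable (fun t => -|k t|) volume s T := fun s hs =>
    ((h.integrable T hT).mono_set (by
      rw [uIcc_of_le hT, uIcc_of_le hs.2]; exact Icc_subset_Icc_left hs.1)).abs.neg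
  have hbound : ∀ s ∈ Icc 0 T, ‖w s‖ ≤ √C := by
    intro s hs
    have hsub : Icc s T ⊆ Icc 0 T := Icc_subset_Icc_left hs.1
    have key := mul_exp_integral_le (N := fun t => metricSq B t (w t)) (k := fun t => -|k t|) hs.2
      (h.continuousOn_metricSq (hw.continuousOn.mono hsub))
      (fun t ht => h.metricSq_pos (hsub ht).1 (hne t (hsub ht)))
      (fun t ht => h.hasDerivAt_metricSq (hw.hasDerivAt ⟨hs.1.trans_lt ht.1, ht.2⟩))
      (habs s hs) (fun t ht => by
        have ht0 : 0 < t := hs.1.trans_lt ht.1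
        obtain ⟨hc0, hc1⟩ := radial_coeff_mem hR (w t)
        set c := √C / max (√C) ‖w t‖ with hc
        -- Truncation replaces `w` by `c w` with `0 < c ≤ 1`. Expansion for `c w`, divided by `c`,
        -- has rate `c k ≥ -|k|`, and `c (w, Bw) ≤ (w, Bw)` because `B` is nonnegative.
        have e := h.expand t ht0 (y t + c • w t) (y t)
        have hfe : f t (radial (√C) (w t)) = v t (y t + c • w t) - v t (y t) := rfl
        rw [add_sub_cancel_left, ← hfe, norm_smul, mul_pow, Real.norm_eq_abs, sq_abs, map_smul,
          real_inner_smul_left, real_inner_smul_right, smul_comm t c, ← smul_add,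
          real_inner_smul_left] at e
        have hb0 := h.nonneg (w t)
        set I := ⟪w t + t • B (w t), f t (radial (√C) (w t))⟫ with hI
        set b := ⟪w t, B (w t)⟫ with hbdef
        have hN : metricSq B t (w t) = ‖w t‖ ^ 2 + t * b := rfl
        have hN0 : 0 ≤ ‖w t‖ ^ 2 + t * b := by positivity
        have e2 : c * (k t * (‖w t‖ ^ 2 + t * b)) ≤ c * b + 2 * I := by
          have : c * (c * (k t * (‖w t‖ ^ 2 + t * b))) ≤ c * (c * b + 2 * I) := by
            calc _ = k t * (c ^ 2 * ‖w t‖ ^ 2 + t * (c * (c * b))) := by ring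
              _ ≤ _ := e
              _ = _ := by ring
          exact le_of_mul_le_mul_left this hc0
        have e3 : -|k t| * (‖w t‖ ^ 2 + t * b) ≤ c * (k t * (‖w t‖ ^ 2 + t * b)) := by
          rw [← mul_assoc]
          refine mul_le_mul_of_nonneg_right ?_ hN0
          have h1 := neg_abs_le (k t)
          have h2 := abs_nonneg (k t)
          nlinarith
        change -|k t| * metricSq B t (w t) ≤ _
        rw [hN]
        nlinarith)
    have h1 : metricSq B s (w s) ≤ C := by
      have hle : ∫ t in s..T, |k t| ≤ ∫ t in (0 : ℝ)..T, |k t| :=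
        intervalIntegral.integral_mono_interval hs.1 hs.2 le_rfl
          (Eventually.of_forall fun _ => abs_nonneg _) (h.integrable T hT).abs
      rw [intervalIntegral.integral_neg, Real.exp_neg, hwT,
        ← div_eq_mul_inv, div_le_iff₀ (Real.exp_pos _)] at key
      refine key.trans ?_
      rw [hC]
      gcongr
      exact (h.metricSq_pos hT h0).le
    exact Real.le_sqrt_of_sq_le ((h.norm_sq_le_metricSq hs.1 _).trans h1)
  refine ⟨fun t => y t + w t, by simp [hwT], fun t ht => ?_⟩
  have h1 := (hy t ht).add (hw t ht)
  have h2 : v t (y t) + f t (radial (√C) (w t)) = v t (y t + w t) := by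
    rw [radial_of_le hR (hbound t ht)]
    exact add_sub_cancel _ _
  exact h1.congr_deriv h2

/-- Global forward solutions. -/
lemma exists_global (x₀ : X) : ∃ α : ℝ → X, α 0 = x₀ ∧
    ∀ t, 0 ≤ t → HasDerivWithinAt α (v t (α t)) (Ici 0) t := by
  have h1 : ∀ T : ℝ, 0 < T → ∃ α : ℝ → X, α 0 = x₀ ∧ IsSolOn v 0 T α := fun T hT => by
    obtain ⟨R, hR⟩ := h.exists_forward hT (norm_nonneg x₀)
    obtain ⟨α, h0, hα, -⟩ := hR x₀ le_rfl
    exact ⟨α, h0, hα⟩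
  choose! β hβ0 hβ using h1
  -- Solutions with different horizons agree, so the glued curve coincides near `t` with the single
  -- solution `β (t + 2)`.
  have hagree : ∀ T s : ℝ, 0 ≤ s → s + 1 ≤ T → β (s + 1) s = β T s := fun T s hs hT => by
    have hs1 : (0 : ℝ) < s + 1 := by linarith
    have hT1 : 0 < T := hs1.trans_le hT
    exact (h.isLocLip (s + 1)).eqOn (hβ _ hs1) ((hβ T hT1).mono (Icc_subset_Icc_right hT))
      (t₀ := 0) ⟨le_rfl, hs1.le⟩ ((hβ0 _ hs1).trans (hβ0 T hT1).symm) ⟨hs, by linarith⟩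
  refine ⟨fun t => β (t + 1) t, by simpa using hβ0 1 one_pos, fun t ht => ?_⟩
  have ht2 : 0 < t + 2 := by linarith
  have h2 := hβ (t + 2) ht2 t ⟨ht, by linarith⟩
  have h3 : HasDerivWithinAt (β (t + 2)) (v t (β (t + 2) t)) (Ici 0) t :=
    h2.mono_of_mem_nhdsWithin (by
      have : Iic (t + 2) ∈ 𝓝 t := Iic_mem_nhds (by linarith)
      exact inter_mem_nhdsWithin _ this)
  rw [← hagree (t + 2) t ht (by linarith)] at h3
  refine h3.congr_of_eventuallyEq ?_ (hagree _ _ ht (by linarith))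
  filter_upwards [self_mem_nhdsWithin, mem_nhdsWithin_of_mem_nhds
    (Iio_mem_nhds (show t < t + 1 by linarith))] with s hs hs1
  exact hagree _ _ hs (by linarith [mem_Iio.1 hs1])

end IsExpandingField

end ExpandingFlows

/-! ### Derivative of the determinant. -/

section Determinant

variable {X : Type*} [NormedAddCommGroup X] [InnerProductSpace ℝ X] [FiniteDimensional ℝ X]
  {ι : Type*} [Fintype ι]

/-- The matrix of an operator in an orthonormal basis. -/
noncomputable def matrixOf (b : OrthonormalBasis ι ℝ X) (L : X →L[ℝ] X) : Matrix ι ι ℝ :=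
  Matrix.of fun i j => ⟪b i, L (b j)⟫

variable [DecidableEq ι]

lemma det_matrixOf (b : OrthonormalBasis ι ℝ X) (L : X →L[ℝ] X) :
    (matrixOf b L).det = L.det := by
  rw [ContinuousLinearMap.det, ← LinearMap.det_toMatrix b.toBasis]
  congr 1
  ext i j
  simp [matrixOf, LinearMap.toMatrix_apply, OrthonormalBasis.repr_apply_apply]

lemma matrixOf_one_add_smul (b : OrthonormalBasis ι ℝ X) (L : X →L[ℝ] X) (s : ℝ) :
    matrixOf b (1 + s • L) = 1 + s • matrixOf b L := by
  ext i j
  simp [matrixOf, inner_add_right, real_inner_smul_right, Matrix.one_apply,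
    b.inner_eq_ite]

lemma differentiable_det (b : OrthonormalBasis ι ℝ X) :
    Differentiable ℝ fun L : X →L[ℝ] X => L.det := by
  have : (fun L : X →L[ℝ] X => L.det) = fun L =>
      ∑ σ : Equiv.Perm ι, (Equiv.Perm.sign σ : ℝ) * ∏ i, ⟪b (σ i), L (b i)⟫ := by
    funext L
    rw [← det_matrixOf b, Matrix.det_apply']
    rfl
  rw [this]
  have h1 : ∀ i j, Differentiable ℝ fun L : X →L[ℝ] X => ⟪b i, L (b j)⟫ := fun i j =>
    (differentiable_const _).inner ℝ (ContinuousLinearMap.apply ℝ X (b j)).differentiable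
  fun_prop

/-- The trace is the linear coefficient of the polynomial `s ↦ det (1 + s M)`, whose remainder
carries a factor `s²`. -/
lemma fderiv_det_one (b : OrthonormalBasis ι ℝ X) (H : X →L[ℝ] X) :
    fderiv ℝ (fun L : X →L[ℝ] X => L.det) 1 H = ∑ i, ⟪b i, H (b i)⟫ := by
  have h1 : HasDerivAt (fun s : ℝ => (1 : X →L[ℝ] X) + s • H) H 0 := by
    simpa using ((hasDerivAt_id (0 : ℝ)).smul_const H).const_add (1 : X →L[ℝ] X)
  have h2 : HasFDerivAt (fun L : X →L[ℝ] X => L.det)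
      (fderiv ℝ (fun L : X →L[ℝ] X => L.det) 1) (1 + (0 : ℝ) • H) := by
    rw [zero_smul, add_zero]
    exact (differentiable_det b 1).hasFDerivAt
  have h3 := h2.comp_hasDerivAt (0 : ℝ) h1
  have h4 : ((fun L : X →L[ℝ] X => L.det) ∘ fun s : ℝ => (1 : X →L[ℝ] X) + s • H) = fun s =>
      1 + (matrixOf b H).trace * s + (Matrix.det (1 + (Polynomial.X : Polynomial ℝ) •
        (matrixOf b H).map Polynomial.C)).divX.divX.eval s * s ^ 2 := by
    funext s
    rw [Function.comp_apply, ← det_matrixOf b, matrixOf_one_add_smul, Matrix.det_one_add_smul]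
  rw [h4] at h3
  have h5 := ((((hasDerivAt_id (0 : ℝ)).const_mul (matrixOf b H).trace).const_add 1).add
    (((Matrix.det (1 + (Polynomial.X : Polynomial ℝ) •
        (matrixOf b H).map Polynomial.C)).divX.divX.hasDerivAt 0).mul
          ((hasDerivAt_id (0 : ℝ)).pow 2)))
  have h6 := h3.unique h5
  rw [h6]
  simp [Matrix.trace, matrixOf]

/-- Liouville's formula. -/
lemma hasDerivAt_det (b : OrthonormalBasis ι ℝ X) {J : ℝ → X →L[ℝ] X} {L : X →L[ℝ] X} {t : ℝ}
    (hJ : HasDerivAt J (L ∘L J t) t) (hdet : (J t).det ≠ 0) :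
    HasDerivAt (fun s => (J s).det) ((∑ i, ⟪b i, L (b i)⟫) * (J t).det) t := by
  -- Factoring out `J t` moves the computation to the identity: `det (J s) = det (J s ∘ K) det (J
  -- t)`.
  set K : X →L[ℝ] X := ↑((J t).toContinuousLinearEquivOfDetNeZero hdet).symm with hK
  have hJK : J t ∘L K = 1 := by
    ext x
    exact ((J t).toContinuousLinearEquivOfDetNeZero hdet).apply_symm_apply x
  have hKJ : K ∘L J t = 1 := by
    ext x
    exact ((J t).toContinuousLinearEquivOfDetNeZero hdet).symm_apply_apply x
  have h1 : HasDerivAt (fun s => J s ∘L K) L t := by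
    have := hJ.clm_comp (hasDerivAt_const t K)
    refine this.congr_deriv ?_
    rw [ContinuousLinearMap.comp_assoc, hJK]
    ext x; simp
  have h2 : HasFDerivAt (fun L : X →L[ℝ] X => L.det)
      (fderiv ℝ (fun L : X →L[ℝ] X => L.det) 1) (J t ∘L K) := by
    rw [hJK]
    exact (differentiable_det b 1).hasFDerivAt
  have h3 := (h2.comp_hasDerivAt t h1).mul_const (J t).det
  rw [fderiv_det_one b] at h3
  refine h3.congr_of_eventuallyEq (Eventually.of_forall fun s => ?_)
  change (J s).det = (J s ∘L K).det * (J t).det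
  have h4 : (J s ∘L K) ∘L J t = J s := by
    rw [ContinuousLinearMap.comp_assoc, hKJ]
    ext x; simp
  conv_lhs => rw [← h4]
  exact LinearMap.det_comp _ _

end Determinant

/-! ### The flow map: bijectivity, differentiability and the inverse. -/

section Flow

variable {X : Type*} [NormedAddCommGroup X] [InnerProductSpace ℝ X] [FiniteDimensional ℝ X]

/-- `S` is the flow of `v` from time zero. -/
structure IsFlow (v : ℝ → X → X) (S : ℝ → X → X) : Prop where
  init : ∀ x, S 0 x = x
  evol : ∀ x t, 0 ≤ t → HasDerivWithinAt (fun s => S s x) (v t (S t x)) (Ici 0) t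

variable {v : ℝ → X → X} {S : ℝ → X → X}

lemma IsFlow.isSolOn (hS : IsFlow v S) (x : X) (T : ℝ) : IsSolOn v 0 T fun s => S s x :=
  fun t ht => (hS.evol x t ht.1).mono fun _ hs => hs.1

lemma IsFlow.continuousOn (hS : IsFlow v S) (x : X) : ContinuousOn (fun s => S s x) (Ici 0) :=
  fun t ht => (hS.evol x t ht).continuousWithinAt

namespace IsExpandingField

variable {Dv : ℝ → X → X →L[ℝ] X} {B : X →L[ℝ] X} {k : ℝ → ℝ} (h : IsExpandingField v Dv B k)
include h

lemma exists_isFlow : ∃ S, IsFlow v S := by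
  choose α h0 hα using h.exists_global
  exact ⟨fun t x => α x t, h0, hα⟩

lemma isFlow_unique {S' : ℝ → X → X} (hS : IsFlow v S) (hS' : IsFlow v S') {t : ℝ} (ht : 0 ≤ t) :
    S' t = S t :=
  funext fun x => (h.isLocLip t).eqOn (hS'.isSolOn x t) (hS.isSolOn x t) (t₀ := 0) ⟨le_rfl, ht⟩
    ((hS'.init x).trans (hS.init x).symm) ⟨ht, le_rfl⟩

lemma injective_flow (hS : IsFlow v S) {t : ℝ} (ht : 0 ≤ t) : Function.Injective (S t) :=
  fun x y hxy => by
    have := (h.isLocLip t).eqOn (hS.isSolOn x t) (hS.isSolOn y t) (t₀ := t) ⟨ht, le_rfl⟩ hxy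
      ⟨le_rfl, ht⟩
    simpa [hS.init] using this

/-- The trajectory of the origin serves as reference solution for `exists_backward`. -/
lemma surjective_flow (hS : IsFlow v S) {t : ℝ} (ht : 0 ≤ t) : Function.Surjective (S t) :=
  fun x₁ => by
    obtain ⟨x, hx, hsol⟩ := h.exists_backward ht (hS.isSolOn 0 t) x₁
    refine ⟨x 0, ?_⟩
    rw [← hx]
    exact (h.isLocLip t).eqOn (hS.isSolOn (x 0) t) hsol (t₀ := 0) ⟨le_rfl, ht⟩ (hS.init _)
      ⟨ht, le_rfl⟩

lemma metricSq_flow_ge (hS : IsFlow v S) {t : ℝ} (ht : 0 ≤ t) (x y : X) :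
    ‖x - y‖ ^ 2 * Real.exp (∫ s in (0 : ℝ)..t, k s) ≤ metricSq B t (S t x - S t y) := by
  simpa [hS.init] using h.metricSq_sub_ge ht (hS.isSolOn x t) (hS.isSolOn y t)

/-- The variational equation. -/
lemma exists_variational {x₀ : X} (hS : IsFlow v S) {T : ℝ} (hT : 0 < T) :
    ∃ J : ℝ → X →L[ℝ] X, J 0 = 1 ∧ IsSolOn (fun t L => Dv t (S t x₀) ∘L L) 0 T J := by
  obtain ⟨K, hK⟩ := isCompact_Icc.exists_bound_of_continuousOn (s := Icc 0 T)
    (h.cont_deriv.comp (continuousOn_id.prodMk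
      ((hS.continuousOn x₀).mono fun t (ht : t ∈ Icc 0 T) => ht.1)) fun t ht => ⟨ht.1, mem_univ _⟩)
  have hK' : ∀ t ∈ Icc 0 T, ‖Dv t (S t x₀)‖ ≤ |K| := fun t ht => (hK t ht).trans (le_abs_self K)
  have hl : IsLocLip (fun t (L : X →L[ℝ] X) => Dv t (S t x₀) ∘L L) 0 T := by
    refine ⟨fun R => ⟨⟨|K|, abs_nonneg K⟩, fun t ht => ?_⟩, fun L => ?_⟩
    · refine LipschitzOnWith.of_dist_le_mul fun L _ L' _ => ?_
      rw [dist_eq_norm, dist_eq_norm, ← ContinuousLinearMap.comp_sub]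
      exact (ContinuousLinearMap.opNorm_comp_le _ _).trans
        (mul_le_mul_of_nonneg_right (hK' t ht) (norm_nonneg _))
    · exact (h.cont_deriv.comp (continuousOn_id.prodMk
        ((hS.continuousOn x₀).mono fun t (ht : t ∈ Icc 0 T) => ht.1))
          fun t ht => ⟨ht.1, mem_univ _⟩).clm_comp continuousOn_const
  obtain ⟨R, hR⟩ := hl.exists_isSolOn hT (fun ε hε => ⟨|K|, abs_nonneg K, fun t h1 h2 L =>
    (ContinuousLinearMap.opNorm_comp_le _ _).trans (by
      have := hK' t ⟨hε.le.trans h1, h2⟩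
      have h3 := norm_nonneg L
      exact mul_le_mul this (by linarith) h3 (abs_nonneg K))⟩)
    (norm_nonneg (1 : X →L[ℝ] X))
  obtain ⟨J, h0, hJ, -⟩ := hR 1 le_rfl
  exact ⟨J, h0, hJ⟩

/-- The flow is differentiable, with derivative given by the variational equation. -/
lemma hasFDerivAt_flow (hS : IsFlow v S) {T : ℝ} (hT : 0 ≤ T) {x₀ : X} {J : ℝ → X →L[ℝ] X}
    (hJ0 : J 0 = 1) (hJ : IsSolOn (fun t L => Dv t (S t x₀) ∘L L) 0 T J) :
    HasFDerivAt (S T) (J T) x₀ := by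
  rcases hT.eq_or_lt with rfl | hT0
  · rw [hJ0]
    exact (hasFDerivAt_id x₀).congr_of_eventuallyEq (Eventually.of_forall hS.init)
  -- One radius for all nearby trajectories makes the Lipschitz and uniform continuity constants
  -- common to them.
  obtain ⟨R, hR⟩ := h.exists_forward hT0 (show 0 ≤ ‖x₀‖ + 1 by positivity)
  have hball : ∀ x, ‖x‖ ≤ ‖x₀‖ + 1 → ∀ t ∈ Icc 0 T, ‖S t x‖ ≤ R := fun x hx t ht => by
    obtain ⟨α, h0, hα, hb⟩ := hR x hx
    have e : S t x = α t := (h.isLocLip T).eqOn (hS.isSolOn x T) hα (t₀ := 0) ⟨le_rfl, hT⟩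
      ((hS.init x).trans h0.symm) ht
    rw [e]
    exact hb t ht
  obtain ⟨K, hK⟩ := h.exists_deriv_bound T R
  have hlip := h.lipschitzOnWith hK
  have hdist : ∀ x, ‖x‖ ≤ ‖x₀‖ + 1 → ∀ t ∈ Icc 0 T,
      ‖S t x - S t x₀‖ ≤ ‖x - x₀‖ * Real.exp (K * T) := fun x hx t ht => by
    have := dist_le_of_trajectories_ODE_of_mem (v := v) (s := fun _ => Metric.closedBall 0 R)
      (fun t ht => hlip t (Ico_subset_Icc_self ht)) (hS.isSolOn x T).continuousOn
      (fun t ht => (hS.isSolOn x T).hasDerivWithinAt_Ici ht)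
      (fun t ht => by simpa using hball x hx t (Ico_subset_Icc_self ht))
      (hS.isSolOn x₀ T).continuousOn
      (fun t ht => (hS.isSolOn x₀ T).hasDerivWithinAt_Ici ht)
      (fun t ht => by simpa using hball x₀ (by linarith) t (Ico_subset_Icc_self ht)) le_rfl t ht
    rw [hS.init, hS.init, dist_eq_norm, dist_eq_norm] at this
    refine this.trans ?_
    have := ht.2
    gcongr
    linarith
  have huc : UniformContinuousOn (fun p : ℝ × X => Dv p.1 p.2)
      (Icc 0 T ×ˢ Metric.closedBall 0 R) :=
    (isCompact_Icc.prod (isCompact_closedBall _ _)).uniformContinuousOn_of_continuous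
      (h.cont_deriv.mono fun p hp => ⟨hp.1.1, mem_univ _⟩)
  rw [Metric.uniformContinuousOn_iff_le] at huc
  rw [hasFDerivAt_iff_isLittleO, Asymptotics.isLittleO_iff]
  intro ε hε
  set E := Real.exp (K * T) with hE
  set G := Real.exp ((K + 1 : ℝ) * T) with hG
  have hE0 : 0 < E := Real.exp_pos _
  have hG0 : 0 < G := Real.exp_pos _
  have hη : 0 < ε / (E * G) := by positivity
  -- `E` bounds the spreading of trajectories and `G` the Gronwall factor below; their product is
  -- divided out so that the final error is `ε ‖x - x₀‖`.
  set η := ε / (E * G) with hηd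
  obtain ⟨d, hd, hd'⟩ := huc η hη
  have hnear : ∀ᶠ x in 𝓝 x₀, ‖x - x₀‖ < min 1 (d / E) := by
    have : ContinuousAt (fun x : X => ‖x - x₀‖) x₀ := by fun_prop
    refine this.eventually (gt_mem_nhds ?_)
    simp only [sub_self, norm_zero]
    positivity
  filter_upwards [hnear] with x hx
  have hx1 : ‖x‖ ≤ ‖x₀‖ + 1 := by
    have := (norm_sub_norm_le x x₀).trans (hx.le.trans (min_le_left _ _))
    linarith
  have hx2 : ‖x - x₀‖ * E ≤ d := by
    have := hx.le.trans (min_le_right _ _)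
    rwa [le_div_iff₀ hE0] at this
  have hrem : ∀ t ∈ Icc 0 T, ‖v t (S t x) - v t (S t x₀) - Dv t (S t x₀) (S t x - S t x₀)‖ ≤
      η * (‖x - x₀‖ * E) := fun t ht => by
    have hs : Convex ℝ (Metric.closedBall (0 : X) R ∩ Metric.closedBall (S t x₀) d) :=
      (convex_closedBall _ _).inter (convex_closedBall _ _)
    have hm0 : S t x₀ ∈ Metric.closedBall (0 : X) R := by
      simpa using hball x₀ (by linarith) t ht
    have hm : S t x ∈ Metric.closedBall (0 : X) R := by
      simpa using hball x hx1 t ht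
    have := hs.norm_image_sub_le_of_norm_hasFDerivWithin_le' (f := v t) (f' := Dv t)
      (φ := Dv t (S t x₀)) (C := η)
      (fun y _ => (h.deriv t ht.1 y).hasFDerivWithinAt)
      (fun y hy => by
        have h1 := hd' (t, y) ⟨ht, hy.1⟩ (t, S t x₀) ⟨ht, hm0⟩ (by
          rw [Prod.dist_eq]
          simpa [hd.le] using hy.2)
        rwa [dist_eq_norm] at h1)
      ⟨hm0, by simpa using hd.le⟩ ⟨hm, by
        rw [mem_closedBall_iff_norm]
        exact (hdist x hx1 t ht).trans hx2⟩
    exact this.trans (mul_le_mul_of_nonneg_left (hdist x hx1 t ht) hη.le)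
  have hsolx := hS.isSolOn x T
  have hsol0 := hS.isSolOn x₀ T
  -- Gronwall for the linearisation error, which starts at zero and is forced by the Taylor
  -- remainder `hrem`. Using `K + 1` in place of `K` avoids the degenerate case of `gronwallBound`.
  have hg := norm_le_gronwallBound_of_norm_deriv_right_le
    (f := fun t => S t x - S t x₀ - J t (x - x₀))
    (f' := fun t => v t (S t x) - v t (S t x₀) - Dv t (S t x₀) (J t (x - x₀)))
    (δ := 0) (K := K + 1) (ε := η * (‖x - x₀‖ * E)) (a := 0) (b := T)
    ((hsolx.continuousOn.sub hsol0.continuousOn).sub (hJ.continuousOn.clm_apply continuousOn_const))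
    (fun t ht => ((hsolx.hasDerivWithinAt_Ici ht).sub (hsol0.hasDerivWithinAt_Ici ht)).sub (by
      simpa using (hJ.hasDerivWithinAt_Ici ht).clm_apply
        (hasDerivWithinAt_const t (Ici t) (x - x₀))))
    (by simp [hS.init, hJ0])
    (fun t ht => by
      have ht' := Ico_subset_Icc_self ht
      have e : v t (S t x) - v t (S t x₀) - Dv t (S t x₀) (J t (x - x₀)) =
          Dv t (S t x₀) (S t x - S t x₀ - J t (x - x₀)) +
          (v t (S t x) - v t (S t x₀) - Dv t (S t x₀) (S t x - S t x₀)) := by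
        rw [map_sub _ (S t x - S t x₀)]; abel
      rw [e]
      refine (norm_add_le _ _).trans (add_le_add ?_ (hrem t ht'))
      refine (ContinuousLinearMap.le_opNorm _ _).trans (mul_le_mul_of_nonneg_right ?_
        (norm_nonneg _))
      exact (hK t ht' _ (hball x₀ (by linarith) t ht')).trans (by linarith))
    T ⟨hT, le_rfl⟩
  have hK1 : (0 : ℝ) < K + 1 := by positivity
  refine hg.trans ?_
  rw [gronwallBound_of_K_ne_0 hK1.ne', sub_zero]
  beta_reduce
  rw [zero_mul, zero_add, ← hG]
  have h1 : 1 ≤ (K : ℝ) + 1 := by simp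
  have h2 : η * (‖x - x₀‖ * E) / (K + 1) ≤ η * (‖x - x₀‖ * E) :=
    div_le_self (by positivity) h1
  calc η * (‖x - x₀‖ * E) / (K + 1) * (G - 1)
      ≤ η * (‖x - x₀‖ * E) / (K + 1) * G := by
        refine mul_le_mul_of_nonneg_left (by linarith) (by positivity)
    _ ≤ η * (‖x - x₀‖ * E) * G := mul_le_mul_of_nonneg_right h2 hG0.le
    _ = ε * ‖x - x₀‖ := by
      rw [hηd]; field_simp

lemma exists_jacobian (hS : IsFlow v S) {T : ℝ} (hT : 0 < T) (x₀ : X) :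
    ∃ J : ℝ → X →L[ℝ] X, J 0 = 1 ∧ IsSolOn (fun t L => Dv t (S t x₀) ∘L L) 0 T J ∧
      ∀ t ∈ Icc 0 T, HasFDerivAt (S t) (J t) x₀ := by
  obtain ⟨J, h0, hJ⟩ := h.exists_variational (x₀ := x₀) hS hT
  exact ⟨J, h0, hJ, fun t ht => h.hasFDerivAt_flow hS ht.1 h0 (hJ.mono (Icc_subset_Icc_right ht.2))⟩

lemma differentiableAt_flow (hS : IsFlow v S) {t : ℝ} (ht : 0 ≤ t) (x₀ : X) :
    DifferentiableAt ℝ (S t) x₀ := by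
  obtain ⟨J, -, -, hJ⟩ := h.exists_jacobian hS (show 0 < t + 1 by linarith) x₀
  exact (hJ t ⟨ht, by linarith⟩).differentiableAt

/-- The separation estimate holds for difference quotients, as the metric is homogeneous of degree
two, and survives the limit. -/
lemma metricSq_fderiv_flow_ge (hS : IsFlow v S) {t : ℝ} (ht : 0 ≤ t) {x : X} {L : X →L[ℝ] X}
    (hL : HasFDerivAt (S t) L x) (f : X) :
    ‖f‖ ^ 2 * Real.exp (∫ s in (0 : ℝ)..t, k s) ≤ metricSq B t (L f) := by
  have h1 := (hL.hasLineDerivAt f).tendsto_slope_zero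
  have hc : Continuous (metricSq B t) := by
    unfold metricSq
    fun_prop
  refine ge_of_tendsto ((hc.tendsto _).comp h1) ?_
  filter_upwards [self_mem_nhdsWithin] with s (hs : s ≠ 0)
  have h2 := h.metricSq_flow_ge hS ht (x + s • f) x
  rw [add_sub_cancel_left, norm_smul, mul_pow, Real.norm_eq_abs, sq_abs] at h2
  rw [Function.comp_apply]
  have h3 : ∀ w : X, metricSq B t (s⁻¹ • w) = (s ^ 2)⁻¹ * metricSq B t w := fun w => by
    simp only [metricSq, norm_smul, mul_pow, Real.norm_eq_abs, sq_abs, map_smul,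
      real_inner_smul_left, real_inner_smul_right]
    ring
  rw [h3, inv_mul_eq_div, le_div_iff₀ (by positivity)]
  linarith

/-- The infinitesimal lower bound makes the derivative injective. -/
lemma det_fderiv_flow_ne_zero (hS : IsFlow v S) {t : ℝ} (ht : 0 ≤ t) {x : X} {L : X →L[ℝ] X}
    (hL : HasFDerivAt (S t) L x) : L.det ≠ 0 := by
  intro hdet
  have hinj : Function.Injective L := by
    rw [injective_iff_map_eq_zero]
    intro f hf
    have h1 := h.metricSq_fderiv_flow_ge hS ht hL f
    rw [hf] at h1
    simp only [metricSq, norm_zero, map_zero, inner_zero_right, mul_zero, add_zero] at h1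
    have h2 : ‖f‖ ^ 2 * Real.exp (∫ s in (0 : ℝ)..t, k s) ≤ 0 := by simpa using h1
    have h3 := Real.exp_pos (∫ s in (0 : ℝ)..t, k s)
    have h4 : ‖f‖ ^ 2 ≤ 0 := by nlinarith
    simpa using le_antisymm h4 (sq_nonneg _)
  have h5 : LinearMap.det (L : X →ₗ[ℝ] X) = 0 := hdet
  exact (LinearMap.bot_lt_ker_of_det_eq_zero h5).ne' (LinearMap.ker_eq_bot.2 hinj)

/-- Derivative and Lipschitz estimates for the inverse of the flow. -/
lemma metricSq_inverse_ge (hS : IsFlow v S) {t : ℝ} (ht : 0 ≤ t) {Sh : X → X}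
    (hr : Function.RightInverse Sh (S t)) (φ ψ : X) :
    ‖Sh φ - Sh ψ‖ ^ 2 * Real.exp (∫ s in (0 : ℝ)..t, k s) ≤ metricSq B t (φ - ψ) := by
  simpa [hr φ, hr ψ] using h.metricSq_flow_ge hS ht (Sh φ) (Sh ψ)

lemma continuous_inverse (hS : IsFlow v S) {t : ℝ} (ht : 0 ≤ t) {Sh : X → X}
    (hr : Function.RightInverse Sh (S t)) : Continuous Sh := by
  rw [continuous_iff_continuousAt]
  intro φ
  rw [ContinuousAt, tendsto_iff_norm_sub_tendsto_zero]
  set e := Real.exp (∫ s in (0 : ℝ)..t, k s) with he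
  have he0 : 0 < e := Real.exp_pos _
  have h1 : Tendsto (fun ψ => √(metricSq B t (ψ - φ) / e)) (𝓝 φ) (𝓝 0) := by
    have : Continuous fun ψ => √(metricSq B t (ψ - φ) / e) := by
      unfold metricSq
      fun_prop
    simpa [metricSq] using this.tendsto φ
  refine squeeze_zero (fun _ => norm_nonneg _) (fun ψ => ?_) h1
  refine Real.le_sqrt_of_sq_le ?_
  rw [le_div_iff₀ he0]
  exact h.metricSq_inverse_ge hS ht hr ψ φ

/-- The inverse is already continuous, so invertibility of the derivative suffices. The estimate is
the expansion bound for the preimage of `f`. -/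
lemma hasFDerivAt_inverse (hS : IsFlow v S) {t : ℝ} (ht : 0 ≤ t) {Sh : X → X}
    (hr : Function.RightInverse Sh (S t)) (φ : X) :
    ∃ L : X →L[ℝ] X, HasFDerivAt Sh L φ ∧
      ∀ f, ‖L f‖ ^ 2 * Real.exp (∫ s in (0 : ℝ)..t, k s) ≤ metricSq B t f := by
  have h1 := (h.differentiableAt_flow hS ht (Sh φ)).hasFDerivAt
  set L := fderiv ℝ (S t) (Sh φ)
  have hdet := h.det_fderiv_flow_ne_zero hS ht h1
  set e := L.toContinuousLinearEquivOfDetNeZero hdet with he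
  have h2 : HasFDerivAt (S t) (e : X →L[ℝ] X) (Sh φ) := by
    rwa [he, ContinuousLinearMap.coe_toContinuousLinearEquivOfDetNeZero]
  refine ⟨e.symm, h2.of_local_left_inverse (h.continuous_inverse hS ht hr).continuousAt
    (Eventually.of_forall hr), fun f => ?_⟩
  simpa using h.metricSq_fderiv_flow_ge hS ht h2 (e.symm f)

end IsExpandingField

end Flow

/-! ### The transport field and conservation of mass. -/

section TransportField

variable {X : Type*} [NormedAddCommGroup X] [InnerProductSpace ℝ X] [FiniteDimensional ℝ X]
  [MeasurableSpace X] [BorelSpace X] {ι : Type*} [Fintype ι] (e : OrthonormalBasis ι ℝ X)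

/-- A covariance path staying below the inverse of the operator with eigenvalues `a`. -/
structure IsSubCovPath (a : ι → ℝ) (c cd : ℝ → ι → ℝ) : Prop extends IsCovPath c cd where
  coeff_pos : ∀ i, 0 < a i
  mul_lt_one : ∀ t, 0 ≤ t → ∀ i, a i * c t i < 1

/-- The eigenvalues of `(1 - A C_t) ^ (1/2)`. -/
noncomputable def scale (a : ι → ℝ) (c : ℝ → ι → ℝ) (t : ℝ) (i : ι) : ℝ := √(1 - a i * c t i)

/-- The eigenvalues of `(1/2) D_t Ċ_t`. -/
noncomputable def fieldCoeff (a : ι → ℝ) (c cd : ℝ → ι → ℝ) (t : ℝ) (i : ι) : ℝ :=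
  cd t i / (2 * scale a c t i)

/-- The field generating the transport flow. -/
noncomputable def transportField (a : ι → ℝ) (F : X → ℝ) (c cd : ℝ → ι → ℝ) (t : ℝ) (x : X) : X :=
  diagOp e (fieldCoeff a c cd t) (∇ (heatPotential e F (c t)) (diagOp e (scale a c t) x))

/-- The space derivative of the transport field. -/
noncomputable def transportFieldDeriv (a : ι → ℝ) (F : X → ℝ) (c cd : ℝ → ι → ℝ) (t : ℝ) (x : X) :
    X →L[ℝ] X :=
  diagOp e (fieldCoeff a c cd t) ∘L
    (hess (heatPotential e F (c t)) (diagOp e (scale a c t) x) ∘L diagOp e (scale a c t))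

/-- The Lebesgue density, up to normalisation, of the rescaled measure. -/
noncomputable def rescaledDensity (a : ι → ℝ) (F : X → ℝ) (c : ℝ → ι → ℝ) (t : ℝ) (x : X) : ℝ :=
  Real.exp (-(1 / 2) * ⟪x, diagOp e a x⟫) * heatExp e F (c t) (diagOp e (scale a c t) x)

namespace IsSubCovPath

variable {a : ι → ℝ} {c cd : ℝ → ι → ℝ} (hc : IsSubCovPath a c cd)
include hc

lemma scale_pos {t : ℝ} (ht : 0 ≤ t) (i : ι) : 0 < scale a c t i :=
  Real.sqrt_pos.2 (sub_pos.2 (hc.mul_lt_one t ht i))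

lemma nonneg {t : ℝ} (ht : 0 ≤ t) (i : ι) : 0 ≤ c t i := by
  rcases ht.eq_or_lt with rfl | ht
  · exact (hc.zero i).ge
  · exact (hc.apply_pos ht i).le

lemma scale_le_one {t : ℝ} (ht : 0 ≤ t) (i : ι) : scale a c t i ≤ 1 := by
  refine Real.sqrt_le_iff.2 ⟨zero_le_one, ?_⟩
  linarith [mul_nonneg (hc.coeff_pos i).le (hc.nonneg ht i)]

lemma scale_zero : scale a c 0 = 1 := by
  funext i
  simp [scale, hc.zero]

lemma hasDerivAt_scale {t : ℝ} (ht : 0 ≤ t) (i : ι) :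
    HasDerivAt (fun s => scale a c s i) (-(a i) * fieldCoeff a c cd t i) t := by
  have h1 := ((hc.deriv t ht i).const_mul (a i)).const_sub 1
  have h2 := h1.sqrt (sub_pos.2 (hc.mul_lt_one t ht i)).ne'
  refine h2.congr_deriv ?_
  rw [fieldCoeff, scale]
  ring

lemma continuousOn_scale : ContinuousOn (scale a c) (Ici 0) :=
  continuousOn_pi.2 fun i _ ht => (hc.hasDerivAt_scale ht i).continuousAt.continuousWithinAt

lemma continuousOn_fieldCoeff : ContinuousOn (fieldCoeff a c cd) (Ici 0) :=
  continuousOn_pi.2 fun i => (hc.cont i).div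
    (continuousOn_const.mul (continuousOn_pi.1 hc.continuousOn_scale i))
    fun _ ht => (mul_pos two_pos (hc.scale_pos ht i)).ne'

lemma continuousOn_scale_apply :
    ContinuousOn (fun p : ℝ × X => diagOp e (scale a c p.1) p.2) (Ici 0 ×ˢ univ) :=
  ((continuous_diagOp e).comp_continuousOn (hc.continuousOn_scale.comp continuous_fst.continuousOn
    fun _ hp => hp.1)).clm_apply continuous_snd.continuousOn

lemma continuousOn_scale_prod :
    ContinuousOn (fun p : ℝ × X => (p.1, diagOp e (scale a c p.1) p.2)) (Ici 0 ×ˢ univ) :=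
  continuous_fst.continuousOn.prodMk (hc.continuousOn_scale_apply e)

lemma norm_scale_apply_le {t : ℝ} (ht : 0 ≤ t) (x : X) : ‖diagOp e (scale a c t) x‖ ≤ ‖x‖ := by
  have := norm_diagOp_apply_le e zero_le_one (fun i => by
    rw [abs_of_pos (hc.scale_pos ht i)]; exact hc.scale_le_one ht i) x
  rwa [one_mul] at this

variable {F : X → ℝ} (hF : ContDiff ℝ 2 F) {M : ℝ} (hM : ∀ y, |F y| ≤ M) (hF0 : ∀ y, 0 < F y)
include hF hM hF0

lemma continuousOn_transportField :
    ContinuousOn (fun p : ℝ × X => transportField e a F c cd p.1 p.2) (Ici 0 ×ˢ univ) := by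
  have h1 := (hc.continuousOn_gradient_heatPotential e hF hM hF0).comp
    (hc.continuousOn_scale_prod e) fun p hp => ⟨hp.1, mem_univ _⟩
  exact ((continuous_diagOp e).comp_continuousOn (hc.continuousOn_fieldCoeff.comp
    continuous_fst.continuousOn fun p hp => hp.1)).clm_apply h1

lemma continuousOn_transportFieldDeriv :
    ContinuousOn (fun p : ℝ × X => transportFieldDeriv e a F c cd p.1 p.2) (Ici 0 ×ˢ univ) := by
  have h1 := (hc.continuousOn_hess_heatPotential e hF hM hF0).comp
    (hc.continuousOn_scale_prod e) fun p hp => ⟨hp.1, mem_univ _⟩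
  have h2 : ContinuousOn (fun p : ℝ × X => diagOp e (scale a c p.1)) (Ici 0 ×ˢ univ) :=
    (continuous_diagOp e).comp_continuousOn (hc.continuousOn_scale.comp
      continuous_fst.continuousOn fun p hp => hp.1)
  exact ((continuous_diagOp e).comp_continuousOn (hc.continuousOn_fieldCoeff.comp
    continuous_fst.continuousOn fun p hp => hp.1)).clm_comp (h1.clm_comp h2)

lemma hasFDerivAt_transportField {t : ℝ} (ht : 0 ≤ t) (x : X) :
    HasFDerivAt (transportField e a F c cd t) (transportFieldDeriv e a F c cd t x) x :=
  (diagOp e (fieldCoeff a c cd t)).hasFDerivAt.comp x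
    ((hc.hasFDerivAt_gradient_heatPotential' e hF hM hF0 ht _).comp x
      (diagOp e (scale a c t)).hasFDerivAt)

lemma transportField_growth (ε T : ℝ) (hε : 0 < ε) : ∃ K : ℝ, 0 ≤ K ∧
    ∀ t, ε ≤ t → t ≤ T → ∀ x, ‖transportField e a F c cd t x‖ ≤ K * (1 + ‖x‖) := by
  obtain ⟨K, hK0, hK⟩ := hc.exists_gradient_heatPotential_le e hF hM hF0 (T := T) hε
  obtain ⟨L, hL⟩ := (isCompact_Icc (a := 0) (b := T)).exists_bound_of_continuousOn
    (hc.continuousOn_fieldCoeff.mono Icc_subset_Ici_self)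
  refine ⟨|L| * K, by positivity, fun t h1 h2 x => ?_⟩
  have ht : 0 ≤ t := hε.le.trans h1
  have h3 : ∀ i, |fieldCoeff a c cd t i| ≤ |L| := fun i =>
    ((norm_le_pi_norm (fieldCoeff a c cd t) i).trans (hL t ⟨ht, h2⟩)).trans (le_abs_self L)
  refine (norm_diagOp_apply_le e (abs_nonneg L) h3 _).trans ?_
  rw [mul_assoc]
  refine mul_le_mul_of_nonneg_left ((hK t h1 h2 _).trans ?_) (abs_nonneg L)
  have := hc.norm_scale_apply_le e ht x
  gcongr

lemma isExpandingField {B : X →L[ℝ] X} {k : ℝ → ℝ} (symm : ∀ x y, ⟪B x, y⟫ = ⟪x, B y⟫)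
    (nonneg : ∀ x, 0 ≤ ⟪x, B x⟫)
    (integrable : ∀ t, 0 ≤ t → IntervalIntegrable k volume 0 t)
    (expand : ∀ t, 0 < t → ∀ x y, k t * (‖x - y‖ ^ 2 + t * ⟪x - y, B (x - y)⟫) ≤
      ⟪x - y, B (x - y)⟫ + 2 * ⟪(x - y) + t • B (x - y),
        transportField e a F c cd t x - transportField e a F c cd t y⟫) :
    IsExpandingField (transportField e a F c cd) (transportFieldDeriv e a F c cd) B k where
  cont := hc.continuousOn_transportField e hF hM hF0
  deriv _ ht := hc.hasFDerivAt_transportField e hF hM hF0 ht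
  cont_deriv := hc.continuousOn_transportFieldDeriv e hF hM hF0
  growth := hc.transportField_growth e hF hM hF0
  symm := symm
  nonneg := nonneg
  integrable := integrable
  expand := expand

lemma rescaledDensity_pos (t : ℝ) (x : X) : 0 < rescaledDensity e a F c t x :=
  mul_pos (Real.exp_pos _) (heatExp_pos e hF.continuous hM hF0 _ _)

/-- Conservation of mass along the flow. -/
lemma hasDerivAt_rescaledDensity_mul_det {t : ℝ} (ht : 0 < t) {x : ℝ → X} {J : ℝ → X →L[ℝ] X}
    (hx : HasDerivAt x (transportField e a F c cd t (x t)) t)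
    (hJ : HasDerivAt J (transportFieldDeriv e a F c cd t (x t) ∘L J t) t)
    (hdet : (J t).det ≠ 0) :
    HasDerivAt (fun s => rescaledDensity e a F c s (x s) * (J s).det) 0 t := by
  classical
  have hq : HasDerivAt (fun s => Real.exp (-(1 / 2) * ⟪x s, diagOp e a (x s)⟫))
      (Real.exp (-(1 / 2) * ⟪x t, diagOp e a (x t)⟫) *
        -⟪x t, diagOp e a (transportField e a F c cd t (x t))⟫) t := by
    have h1 := ((hx.inner ℝ ((diagOp e a).hasFDerivAt.comp_hasDerivAt t hx)).const_mul
      (-(1 / 2) : ℝ)).exp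
    refine h1.congr_deriv ?_
    have h2 : ⟪transportField e a F c cd t (x t), diagOp e a (x t)⟫ =
        ⟪x t, diagOp e a (transportField e a F c cd t (x t))⟫ := by
      rw [real_inner_comm, inner_diagOp_comm]
    simp only [Function.comp_apply, h2]
    ring
  have hz := (hasDerivAt_diagOp e (hc.hasDerivAt_scale ht.le)).clm_apply hx
  have hu := hc.hasDerivAt_heatExp_curve e hF hM ht hz
  have hd := hasDerivAt_det e hJ hdet
  refine ((hq.mul hu).mul hd).congr_deriv ?_
  rw [Pi.mul_apply]
  set z := diagOp e (scale a c t) (x t) with hzd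
  set u := heatExp e F (c t) z with hud
  have hu0 : u ≠ 0 := (heatExp_pos e hF.continuous hM hF0 (c t) z).ne'
  set g := ∇ (heatExp e F (c t)) z with hg
  set H := fderiv ℝ (∇ (heatExp e F (c t))) z with hH
  have hv : transportField e a F c cd t (x t) = diagOp e (fieldCoeff a c cd t) (-u⁻¹ • g) := by
    rw [transportField, hc.gradient_heatPotential e hF hM hF0 ht.le]
  have hDv : transportFieldDeriv e a F c cd t (x t) = diagOp e (fieldCoeff a c cd t) ∘L
      ((-u⁻¹ • H + (u ^ 2)⁻¹ • InnerProductSpace.rankOne ℝ g g) ∘L diagOp e (scale a c t)) := by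
    rw [transportFieldDeriv, hc.hess_heatPotential e hF hM hF0 ht.le]
  have hrp : ∀ i, fieldCoeff a c cd t i * scale a c t i = cd t i / 2 := fun i => by
    have := (hc.scale_pos ht.le i).ne'
    rw [fieldCoeff]; field_simp
  have htr : ∑ i, ⟪e i, transportFieldDeriv e a F c cd t (x t) (e i)⟫ =
      ∑ i, cd t i / 2 * (-u⁻¹ * ⟪e i, H (e i)⟫ + (u ^ 2)⁻¹ * ⟪e i, g⟫ ^ 2) := by
    refine Finset.sum_congr rfl fun i _ => ?_
    have he : diagOp e (scale a c t) (e i) = scale a c t i • e i := by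
      refine ext_coord e fun j => ?_
      rw [inner_diagOp, real_inner_smul_right, e.inner_eq_ite]
      split_ifs with h
      · rw [h]
      · simp
    rw [hDv]
    simp only [ContinuousLinearMap.comp_apply, he, inner_diagOp, map_smul, real_inner_smul_right,
      _root_.add_apply, _root_.smul_apply, inner_add_right, InnerProductSpace.rankOne_apply]
    rw [← hrp i, real_inner_comm g (e i)]
    ring
  have hin : ⟪x t, diagOp e a (transportField e a F c cd t (x t))⟫ =
      ∑ i, -(u⁻¹ * (a i * fieldCoeff a c cd t i * ⟪e i, x t⟫ * ⟪e i, g⟫)) := by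
    rw [hv, inner_diagOp_right]
    refine Finset.sum_congr rfl fun i _ => ?_
    rw [inner_diagOp, real_inner_smul_right]
    ring
  have hgz : ⟪g, diagOp e (fun i => -(a i) * fieldCoeff a c cd t i) (x t) +
        diagOp e (scale a c t) (transportField e a F c cd t (x t))⟫ =
      ∑ i, (-(a i * fieldCoeff a c cd t i * ⟪e i, x t⟫ * ⟪e i, g⟫) -
        cd t i / 2 * (u⁻¹ * ⟪e i, g⟫ ^ 2)) := by
    rw [hv, inner_add_right, inner_diagOp_right, inner_diagOp_right, ← Finset.sum_add_distrib]
    refine Finset.sum_congr rfl fun i _ => ?_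
    rw [inner_diagOp, real_inner_smul_right, ← hrp i]
    ring
  rw [htr, hin, hgz]
  set E := Real.exp (-(1 / 2) * ⟪x t, diagOp e a (x t)⟫)
  -- Three cancellations: the motion of `D_t⁻¹` against the Gaussian factor, the heat equation's
  -- Laplacian against the Hessian part of the divergence, and the two terms quadratic in `g`.
  have key : -(∑ i, -(u⁻¹ * (a i * fieldCoeff a c cd t i * ⟪e i, x t⟫ * ⟪e i, g⟫))) * u +
      (1 / 2 * ∑ i, cd t i * ⟪e i, H (e i)⟫ +
        ∑ i, (-(a i * fieldCoeff a c cd t i * ⟪e i, x t⟫ * ⟪e i, g⟫) -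
          cd t i / 2 * (u⁻¹ * ⟪e i, g⟫ ^ 2))) +
      u * ∑ i, cd t i / 2 * (-u⁻¹ * ⟪e i, H (e i)⟫ + (u ^ 2)⁻¹ * ⟪e i, g⟫ ^ 2) = 0 := by
    rw [← Finset.sum_neg_distrib, Finset.sum_mul, Finset.mul_sum, Finset.mul_sum,
      ← Finset.sum_add_distrib, ← Finset.sum_add_distrib, ← Finset.sum_add_distrib]
    refine Finset.sum_eq_zero fun i _ => ?_
    field_simp
    ring
  linear_combination (E * (J t).det) * key

end IsSubCovPath

end TransportField

/-! ### Change of variables and Gaussian rescaling. -/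

section Transport

variable {X : Type*} [NormedAddCommGroup X] [InnerProductSpace ℝ X] [FiniteDimensional ℝ X]
  [MeasurableSpace X] [BorelSpace X] {ι : Type*} [Fintype ι] (e : OrthonormalBasis ι ℝ X)

lemma map_withDensity_comp {Y Z : Type*} [MeasurableSpace Y] [MeasurableSpace Z] {μ : Measure Y}
    {D : Y → Z} (hD : Measurable D) {G : Z → ENNReal} (hG : Measurable G) :
    (μ.withDensity (G ∘ D)).map D = (μ.map D).withDensity G := by
  ext s hs
  rw [Measure.map_apply hD hs, withDensity_apply _ (hD hs), withDensity_apply _ hs,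
    setLIntegral_map hs hG hD]
  rfl

/-- Change of variables for densities along the inverse of a differentiable bijection. -/
lemma map_withDensity_inverse {S Sh : X → X} {DS : X → X →L[ℝ] X}
    (hl : Function.LeftInverse Sh S) (hr : Function.RightInverse Sh S)
    (hS : ∀ x, HasFDerivAt S (DS x) x) (hSh : Measurable Sh) {ρ ρ₀ : X → ℝ}
    (hρ : ∀ x, 0 ≤ ρ x) (hρ₀ : ∀ x, 0 ≤ ρ₀ x)
    (h : ∀ x, ρ (S x) * (DS x).det = ρ₀ x) :
    ((volume : Measure X).withDensity fun x => ENNReal.ofReal (ρ x)).map Sh =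
      (volume : Measure X).withDensity fun x => ENNReal.ofReal (ρ₀ x) := by
  ext s hs
  have himg : Sh ⁻¹' s = S '' s := by
    ext y
    constructor
    · intro hy
      exact ⟨Sh y, hy, hr y⟩
    · rintro ⟨x, hx, rfl⟩
      rwa [mem_preimage, hl x]
  rw [Measure.map_apply hSh hs, withDensity_apply _ (hSh hs), withDensity_apply _ hs, himg,
    lintegral_image_eq_lintegral_abs_det_fderiv_mul volume hs
      (fun x _ => (hS x).hasFDerivWithinAt) hl.injective.injOn]
  refine lintegral_congr fun x => ?_
  rw [← ENNReal.ofReal_mul (abs_nonneg _)]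
  congr 1
  -- Both densities are nonnegative, so the sign of the Jacobian need not be known.
  rw [← abs_of_nonneg (hρ₀ x), ← h x, abs_mul, abs_of_nonneg (hρ _), mul_comm]

namespace IsSubCovPath

variable {a : ι → ℝ} {c cd : ℝ → ι → ℝ} (hc : IsSubCovPath a c cd)
  {F : X → ℝ} (hF : ContDiff ℝ 2 F) {M : ℝ} (hM : ∀ y, |F y| ≤ M) (hF0 : ∀ y, 0 < F y)
include hc hF hM hF0

omit hF0 in
lemma continuousOn_rescaledDensity :
    ContinuousOn (fun p : ℝ × X => rescaledDensity e a F c p.1 p.2) (Ici 0 ×ˢ univ) := by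
  have h1 : ContinuousOn (fun p : ℝ × X => Real.exp (-(1 / 2) * ⟪p.2, diagOp e a p.2⟫))
      (Ici 0 ×ˢ univ) := Continuous.continuousOn (by fun_prop)
  exact h1.mul ((hc.continuousOn_heatExp e hF hM).comp (hc.continuousOn_scale_prod e)
    fun p hp => ⟨hp.1, mem_univ _⟩)

/-- The conserved quantity is differentiated at positive times only, where the heat equation holds;
continuity up to zero then reaches the initial value. -/
lemma rescaledDensity_flow {B : X →L[ℝ] X} {k : ℝ → ℝ}
    (h : IsExpandingField (transportField e a F c cd) (transportFieldDeriv e a F c cd) B k)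
    {S : ℝ → X → X} (hS : IsFlow (transportField e a F c cd) S) {t : ℝ} (ht : 0 ≤ t) {x : X}
    {L : X →L[ℝ] X} (hL : HasFDerivAt (S t) L x) :
    rescaledDensity e a F c t (S t x) * L.det = rescaledDensity e a F c 0 x := by
  rcases ht.eq_or_lt with rfl | ht
  · have h1 : HasFDerivAt (S 0) (1 : X →L[ℝ] X) x :=
      (hasFDerivAt_id x).congr_of_eventuallyEq (Eventually.of_forall hS.init)
    rw [hL.unique h1, hS.init]
    have h2 : (1 : X →L[ℝ] X).det = 1 := LinearMap.det_id
    rw [h2, mul_one]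
  obtain ⟨J, hJ0, hJ, hJS⟩ := h.exists_jacobian hS ht x
  have hdet : ∀ s ∈ Icc 0 t, (J s).det ≠ 0 := fun s hs =>
    h.det_fderiv_flow_ne_zero hS hs.1 (hJS s hs)
  have hx := hS.isSolOn x t
  have hcont : ContinuousOn (fun s => rescaledDensity e a F c s (S s x) * (J s).det) (Icc 0 t) :=
    ((hc.continuousOn_rescaledDensity e hF hM).comp (continuousOn_id.prodMk hx.continuousOn)
      fun s hs => ⟨hs.1, mem_univ _⟩).mul
      (ContinuousLinearMap.continuous_det.comp_continuousOn hJ.continuousOn)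
  obtain ⟨s, hs, hs'⟩ := exists_hasDerivAt_eq_slope _ (fun _ => (0 : ℝ)) ht hcont fun s hs =>
    hc.hasDerivAt_rescaledDensity_mul_det e hF hM hF0 hs.1 (hx.hasDerivAt hs) (hJ.hasDerivAt hs)
      (hdet s (Ioo_subset_Icc_self hs))
  rw [eq_comm, div_eq_zero_iff, or_iff_left (by linarith), sub_eq_zero] at hs'
  have h2 : (1 : X →L[ℝ] X).det = 1 := LinearMap.det_id
  rw [hL.unique (hJS t ⟨ht.le, le_rfl⟩), hs', hJ0, hS.init, h2, mul_one]

lemma map_rescaledDensity {B : X →L[ℝ] X} {k : ℝ → ℝ}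
    (h : IsExpandingField (transportField e a F c cd) (transportFieldDeriv e a F c cd) B k)
    {S : ℝ → X → X} (hS : IsFlow (transportField e a F c cd) S) {t : ℝ} (ht : 0 ≤ t) {Sh : X → X}
    (hl : Function.LeftInverse Sh (S t)) (hr : Function.RightInverse Sh (S t)) :
    ((volume : Measure X).withDensity fun x =>
      ENNReal.ofReal (rescaledDensity e a F c t x)).map Sh =
      (volume : Measure X).withDensity fun x => ENNReal.ofReal (rescaledDensity e a F c 0 x) :=
  map_withDensity_inverse hl hr (fun x => (h.differentiableAt_flow hS ht x).hasFDerivAt)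
    (h.continuous_inverse hS ht hr).measurable
    (fun x => (hc.rescaledDensity_pos e hF hM hF0 t x).le)
    (fun x => (hc.rescaledDensity_pos e hF hM hF0 0 x).le)
    fun x => hc.rescaledDensity_flow e hF hM hF0 h hS ht
      (h.differentiableAt_flow hS ht x).hasFDerivAt

end IsSubCovPath

section Measures

omit [BorelSpace X] in
lemma gaussian_diagOp (g : ι → ℝ) :
    gaussian (diagOp e g) = (stdGaussian X).map (diagOp e fun i => √(g i)) := by
  rw [gaussian, opSqrt_diagOp]

lemma gaussian_diagOp_inv {a : ι → ℝ} (ha : ∀ i, 0 < a i) :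
    gaussian (diagOp e a⁻¹) = (volume : Measure X).withDensity fun x =>
      ENNReal.ofReal (gaussNorm X * (∏ i, √(a⁻¹ i))⁻¹ *
        Real.exp (-(1 / 2) * ⟪x, diagOp e a x⟫)) := by
  have h := map_affine_stdGaussian e (c := a⁻¹) (fun i => inv_pos.2 (ha i)) 0
  simp only [zero_add] at h
  rw [gaussian_diagOp]
  refine h.trans (congrArg _ (funext fun x => ?_))
  rw [heatKernel, inner_diagOp_right]
  simp only [inner_zero_right, sub_zero, Pi.inv_apply, div_inv_eq_mul]
  congr 4
  exact Finset.sum_congr rfl fun i _ => by ring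

/-- The rescaling maps the remaining Gaussian measure to the full one. -/
lemma map_gaussian_rescaling {a c : ι → ℝ} (ha : ∀ i, 0 < a i) (hac : ∀ i, a i * c i < 1) :
    (gaussian (diagOp e a⁻¹ - diagOp e c)).map (diagOp e fun i => (√(1 - a i * c i))⁻¹) =
      gaussian (diagOp e a⁻¹) := by
  rw [diagOp_sub, gaussian_diagOp, gaussian_diagOp, Measure.map_map (by fun_prop) (by fun_prop)]
  congr 1
  funext x
  rw [Function.comp_apply, diagOp_diagOp]
  congr 2
  funext i
  have h1 : 0 < 1 - a i * c i := sub_pos.2 (hac i)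
  -- The eigenvalue form of `A⁻¹ - C = (1 - AC) A⁻¹`, whose square root cancels the rescaling.
  have h2 : (a⁻¹ - c) i = (1 - a i * c i) * (a i)⁻¹ := by
    have := (ha i).ne'
    rw [Pi.sub_apply, Pi.inv_apply]; field_simp
  have h3 := (Real.sqrt_pos.2 h1).ne'
  rw [Pi.mul_apply, h2, Real.sqrt_mul h1.le, ← mul_assoc, inv_mul_cancel₀ h3, one_mul, Pi.inv_apply]

end Measures

end Transport

/-! ### Reduction of the given objects to eigenvalues. -/

section DiagonalDecomposition

variable {X : Type*} [NormedAddCommGroup X] [InnerProductSpace ℝ X] [FiniteDimensional ℝ X]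
  [MeasurableSpace X] [BorelSpace X] {ι : Type*} [Fintype ι] (e : OrthonormalBasis ι ℝ X)

lemma smoothedPotential_diagOp {V₀ : X → ℝ} (hV : Continuous V₀) (g : ι → ℝ) :
    smoothedPotential (diagOp e g) V₀ = heatPotential e (fun x => Real.exp (-V₀ x)) g := by
  funext φ
  rw [smoothedPotential, integral_gaussian_diagOp e g (f := fun ζ => Real.exp (-V₀ (φ + ζ)))
    (by fun_prop)]
  rfl

lemma gaussian_withDensity {a : ι → ℝ} (ha : ∀ i, 0 < a i) {K : ℝ} (hK : 0 ≤ K) {f : X → ℝ}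
    (hf : Continuous f) :
    (gaussian (diagOp e a⁻¹)).withDensity (fun x => ENNReal.ofReal (K * f x)) =
      ENNReal.ofReal (gaussNorm X * (∏ i, √(a⁻¹ i))⁻¹ * K) • (volume : Measure X).withDensity
        fun x => ENNReal.ofReal (Real.exp (-(1 / 2) * ⟪x, diagOp e a x⟫) * f x) := by
  have hκ0 : 0 ≤ gaussNorm X * (∏ i, √(a⁻¹ i))⁻¹ := mul_nonneg gaussNorm_pos.le
    (inv_nonneg.2 (Finset.prod_nonneg fun i _ => Real.sqrt_nonneg _))
  set κ := gaussNorm X * (∏ i, √(a⁻¹ i))⁻¹ with hκ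
  have h1 : Measurable fun x : X => ENNReal.ofReal (κ * Real.exp (-(1 / 2) * ⟪x, diagOp e a x⟫)) :=
    (ENNReal.continuous_ofReal.comp (by fun_prop)).measurable
  have h2 : Measurable fun x : X => ENNReal.ofReal (K * f x) := (ENNReal.continuous_ofReal.comp (by fun_prop)).measurable
  have h3 : Measurable fun x : X =>
      ENNReal.ofReal (Real.exp (-(1 / 2) * ⟪x, diagOp e a x⟫) * f x) :=
    (ENNReal.continuous_ofReal.comp (by fun_prop)).measurable
  rw [gaussian_diagOp_inv e ha, ← withDensity_mul _ h1 h2, ← withDensity_smul _ h3]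
  congr 1
  funext x
  rw [Pi.mul_apply, Pi.smul_apply, smul_eq_mul,
    ← ENNReal.ofReal_mul (mul_nonneg hκ0 (Real.exp_pos _).le),
    ← ENNReal.ofReal_mul (mul_nonneg hκ0 hK)]
  congr 1
  ring

/-- The decomposition `Cdot` is diagonal in the basis `e`, with eigenvalues `cd`. -/
structure IsDiagonalDecomposition (a : ι → ℝ) (c cd : ℝ → ι → ℝ) (Cdot : ℝ → X →L[ℝ] X) :
    Prop extends IsSubCovPath a c cd where
  apply_eq : ∀ t, 0 ≤ t → Cdot t = diagOp e (cd t)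
  covInf_eq : covInf Cdot = diagOp e a⁻¹

namespace IsDiagonalDecomposition

variable {e} {a : ι → ℝ} {c cd : ℝ → ι → ℝ} {Cdot : ℝ → X →L[ℝ] X}
  (hC : IsDiagonalDecomposition e a c cd Cdot)
include hC

lemma cov_eq {t : ℝ} (ht : 0 ≤ t) : cov Cdot t = diagOp e (c t) := by
  have h1 : cov Cdot t = ∫ s in (0 : ℝ)..t, diagOp e (cd s) :=
    intervalIntegral.integral_congr fun s hs => by
      rw [uIcc_of_le ht] at hs
      exact hC.apply_eq s hs.1
  rw [h1, intervalIntegral.integral_of_le ht, integral_diagOp e fun i =>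
    (intervalIntegrable_iff_integrableOn_Ioc_of_le ht).1 (hC.intervalIntegrable_deriv ht i)]
  congr 1
  funext i
  rw [← intervalIntegral.integral_of_le ht, hC.integral_deriv ht]

lemma renormPotential_eq {V₀ : X → ℝ} (hV : Continuous V₀) {t : ℝ} (ht : 0 ≤ t) :
    renormPotential Cdot V₀ t = heatPotential e (fun x => Real.exp (-V₀ x)) (c t) := by
  rw [renormPotential, hC.cov_eq ht, smoothedPotential_diagOp e hV]

lemma rescaling_eq {t : ℝ} (ht : 0 ≤ t) :
    rescaling (diagOp e a) Cdot t = diagOp e (scale a c t)⁻¹ := by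
  rw [rescaling, hC.cov_eq ht, diagOp_mul, ← diagOp_one e, diagOp_sub, opSqrt_diagOp]
  exact inverse_diagOp e fun i => (hC.scale_pos ht i).ne'

lemma inverse_rescaling_eq {t : ℝ} (ht : 0 ≤ t) :
    Ring.inverse (rescaling (diagOp e a) Cdot t) = diagOp e (scale a c t) := by
  rw [hC.rescaling_eq ht, inverse_diagOp e (g := (scale a c t)⁻¹) fun i =>
    inv_ne_zero (hC.scale_pos ht i).ne', inv_inv]

lemma transportField_eq {V₀ : X → ℝ} (hV : Continuous V₀) {t : ℝ} (ht : 0 ≤ t) (x : X) :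
    (1 / 2 : ℝ) • rescaling (diagOp e a) Cdot t (Cdot t (∇ (renormPotential Cdot V₀ t)
      (Ring.inverse (rescaling (diagOp e a) Cdot t) x))) =
      transportField e a (fun x => Real.exp (-V₀ x)) c cd t x := by
  rw [hC.inverse_rescaling_eq ht, hC.rescaling_eq ht, hC.renormPotential_eq hV ht,
    hC.apply_eq t ht, transportField, diagOp_diagOp]
  refine ext_coord e fun i => ?_
  have := (hC.scale_pos ht i).ne'
  rw [real_inner_smul_right, inner_diagOp, inner_diagOp, fieldCoeff, Pi.mul_apply, Pi.inv_apply]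
  field_simp

lemma isTransportFlow_iff {V₀ : X → ℝ} (hV : Continuous V₀) {S : ℝ → X → X} :
    IsTransportFlow (diagOp e a) Cdot V₀ S ↔
      IsFlow (transportField e a (fun x => Real.exp (-V₀ x)) c cd) S := by
  constructor
  · intro h
    refine ⟨h.init, fun x t ht => ?_⟩
    rw [← hC.transportField_eq hV ht]
    exact h.evol x t ht
  · intro h
    refine ⟨h.init, fun x t ht => ?_⟩
    rw [hC.transportField_eq hV ht]
    exact h.evol x t ht

lemma covInf_sub_cov {t : ℝ} (ht : 0 ≤ t) :
    covInf Cdot - cov Cdot t = diagOp e a⁻¹ - diagOp e (c t) := by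
  rw [hC.covInf_eq, hC.cov_eq ht]

section Potential

variable {V₀ : X → ℝ} (hV : ContDiff ℝ 2 V₀) (hb : BddBelow (range V₀))

omit hC in
include hV in
lemma contDiff_exp_neg : ContDiff ℝ 2 fun x => Real.exp (-V₀ x) := hV.neg.exp

omit hC in
include hb in
lemma exists_exp_neg_le : ∃ M : ℝ, ∀ x, |Real.exp (-V₀ x)| ≤ M := by
  obtain ⟨m, hm⟩ := hb
  refine ⟨Real.exp (-m), fun x => ?_⟩
  rw [abs_of_pos (Real.exp_pos _), Real.exp_le_exp]
  exact neg_le_neg (hm ⟨x, rfl⟩)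

include hV hb

/-- Pushing forward by `D_t` restores the Gaussian of covariance `A⁻¹` and composes the potential
with `D_t⁻¹`. The prefactor is independent of `t` and the same as in `initialMeasure_eq`, so it
suffices to transport `rescaledDensity`. -/
lemma rescaledMeasure_eq {t : ℝ} (ht : 0 ≤ t) :
    rescaledMeasure (diagOp e a) Cdot V₀ t =
      ENNReal.ofReal (gaussNorm X * (∏ i, √(a⁻¹ i))⁻¹ *
        (heatExp e (fun x => Real.exp (-V₀ x)) a⁻¹ 0)⁻¹) •
        (volume : Measure X).withDensity fun x =>
          ENNReal.ofReal (rescaledDensity e a (fun x => Real.exp (-V₀ x)) c t x) := by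
  obtain ⟨M, hM⟩ := exists_exp_neg_le hb
  have hF := contDiff_exp_neg hV
  have hF0 : ∀ x, 0 < Real.exp (-V₀ x) := fun x => Real.exp_pos _
  set F : X → ℝ := fun x => Real.exp (-V₀ x) with hFd
  set Z := heatExp e F a⁻¹ 0 with hZ
  have hZ0 : 0 < Z := heatExp_pos e hF.continuous hM hF0 _ _
  have hu : Continuous (heatExp e F (c t)) :=
    (continuous_heatExp e hF.continuous hM).comp (Continuous.prodMk_right _)
  set D := diagOp e fun i => (√(1 - a i * c t i))⁻¹ with hD
  set G : X → ENNReal := fun x => ENNReal.ofReal (Z⁻¹ * heatExp e F (c t) (diagOp e (scale a c t) x))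
    with hG
  have hGm : Measurable G := (ENNReal.continuous_ofReal.comp
    (continuous_const.mul (hu.comp (diagOp e (scale a c t)).continuous))).measurable
  have h1 : (fun ζ => ENNReal.ofReal (Real.exp (smoothedPotential (covInf Cdot) V₀ 0) *
      Real.exp (-renormPotential Cdot V₀ t ζ))) = G ∘ D := by
    funext ζ
    have h2 : diagOp e (scale a c t) (D ζ) = ζ := by
      rw [hD, diagOp_diagOp]
      refine ext_coord e fun i => ?_
      have := (hC.scale_pos ht i).ne'
      rw [scale] at this
      rw [inner_diagOp, Pi.mul_apply, scale, mul_inv_cancel₀ this, one_mul]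
    rw [Function.comp_apply, hG]
    dsimp only
    rw [h2, hC.renormPotential_eq hV.continuous ht, hC.covInf_eq,
      smoothedPotential_diagOp e hV.continuous, heatPotential, heatPotential, neg_neg,
      Real.exp_neg, Real.exp_log hZ0, Real.exp_log (heatExp_pos e hF.continuous hM hF0 _ _)]
  rw [rescaledMeasure, renormMeasure, h1, hC.rescaling_eq ht,
    show diagOp e (scale a c t)⁻¹ = D from rfl, map_withDensity_comp D.continuous.measurable hGm,
    hC.covInf_sub_cov ht, hD, map_gaussian_rescaling e hC.coeff_pos (hC.mul_lt_one t ht), hG,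
    gaussian_withDensity e hC.coeff_pos (inv_pos.2 hZ0).le
      (f := fun x => heatExp e F (c t) (diagOp e (scale a c t) x))
      (hu.comp (diagOp e (scale a c t)).continuous)]
  rfl

lemma initialMeasure_eq :
    initialMeasure Cdot V₀ =
      ENNReal.ofReal (gaussNorm X * (∏ i, √(a⁻¹ i))⁻¹ *
        (heatExp e (fun x => Real.exp (-V₀ x)) a⁻¹ 0)⁻¹) •
        (volume : Measure X).withDensity fun x =>
          ENNReal.ofReal (rescaledDensity e a (fun x => Real.exp (-V₀ x)) c 0 x) := by
  obtain ⟨M, hM⟩ := exists_exp_neg_le hb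
  have hF := contDiff_exp_neg hV
  have hF0 : ∀ x, 0 < Real.exp (-V₀ x) := fun x => Real.exp_pos _
  set F : X → ℝ := fun x => Real.exp (-V₀ x) with hFd
  set Z := heatExp e F a⁻¹ 0 with hZ
  have hZ0 : 0 < Z := heatExp_pos e hF.continuous hM hF0 _ _
  have h1 : ∫ x, Real.exp (-V₀ x) ∂gaussian (diagOp e a⁻¹) = Z := by
    rw [integral_gaussian_diagOp e _ hF.continuous, hZ, heatExp]
    simp only [zero_add]
  have h2 : (fun x => ENNReal.ofReal (Real.exp (-V₀ x) / Z)) =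
      fun x => ENNReal.ofReal (Z⁻¹ * F x) := funext fun x => by rw [div_eq_inv_mul]
  have h3 : ∀ x, rescaledDensity e a F c 0 x =
      Real.exp (-(1 / 2) * ⟪x, diagOp e a x⟫) * F x := fun x => by
    rw [rescaledDensity, hC.apply_zero, heatExp_zero, hC.scale_zero, diagOp_one]
    rfl
  rw [initialMeasure, Measure.tilted, hC.covInf_eq, h1, h2,
    gaussian_withDensity e hC.coeff_pos (inv_pos.2 hZ0).le hF.continuous]
  simp only [h3]

/-- Existence, uniqueness, invertibility and transport properties of the flow. -/
theorem exists_transport {B : X →L[ℝ] X} {k : ℝ → ℝ}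
    (h : IsExpandingField (transportField e a (fun x => Real.exp (-V₀ x)) c cd)
      (transportFieldDeriv e a (fun x => Real.exp (-V₀ x)) c cd) B k) :
    ∃ S Shat : ℝ → X → X, IsTransportFlow (diagOp e a) Cdot V₀ S ∧
      (∀ S' : ℝ → X → X, IsTransportFlow (diagOp e a) Cdot V₀ S' → ∀ t, 0 ≤ t → S' t = S t) ∧
      ∀ t, 0 ≤ t → IsInverseTransport (diagOp e a) Cdot V₀ S Shat t ∧
        (∀ φ ψ, ‖Shat t φ - Shat t ψ‖ ^ 2 ≤
          Real.exp (-∫ s in (0 : ℝ)..t, k s) * metricSq B t (φ - ψ)) ∧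
        ∀ φ f, ‖fderiv ℝ (Shat t) φ f‖ ^ 2 ≤
          Real.exp (-∫ s in (0 : ℝ)..t, k s) * metricSq B t f := by
  obtain ⟨M, hM⟩ := exists_exp_neg_le hb
  have hF := contDiff_exp_neg hV
  have hF0 : ∀ x, 0 < Real.exp (-V₀ x) := fun x => Real.exp_pos _
  obtain ⟨S, hS⟩ := h.exists_isFlow
  have hex : ∀ t, 0 ≤ t → ∃ Sh : X → X, Function.LeftInverse Sh (S t) ∧
      Function.RightInverse Sh (S t) := fun t ht =>
    Function.bijective_iff_has_inverse.1 ⟨h.injective_flow hS ht, h.surjective_flow hS ht⟩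
  choose! Sh hl hr using hex
  have hexp : ∀ t y z : ℝ, y * Real.exp (∫ s in (0 : ℝ)..t, k s) ≤ z →
      y ≤ Real.exp (-∫ s in (0 : ℝ)..t, k s) * z := fun t y z hy => by
    rw [Real.exp_neg, inv_mul_eq_div, le_div_iff₀ (Real.exp_pos _)]
    exact hy
  refine ⟨S, Sh, (hC.isTransportFlow_iff hV.continuous).2 hS, fun S' hS' t ht =>
    h.isFlow_unique hS ((hC.isTransportFlow_iff hV.continuous).1 hS') ht, fun t ht =>
    ⟨⟨hl t ht, hr t ht, fun φ => ?_, ?_⟩, fun φ ψ =>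
      hexp _ _ _ (h.metricSq_inverse_ge hS ht (hr t ht) φ ψ), fun φ f => ?_⟩⟩
  · obtain ⟨L, hL, -⟩ := h.hasFDerivAt_inverse hS ht (hr t ht) φ
    exact hL.differentiableAt
  · rw [hC.rescaledMeasure_eq hV hb ht, hC.initialMeasure_eq hV hb, Measure.map_smul,
      hC.map_rescaledDensity e hF hM hF0 h hS ht (hl t ht) (hr t ht)]
  · obtain ⟨L, hL, hLf⟩ := h.hasFDerivAt_inverse hS ht (hr t ht) φ
    rw [hL.fderiv]
    exact hexp _ _ _ (hLf f)

end Potential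

end IsDiagonalDecomposition

end DiagonalDecomposition

/-! ### Decompositions generated by a scalar profile. -/

section ProfileDecompositions

variable {X : Type*} [NormedAddCommGroup X] [InnerProductSpace ℝ X] [FiniteDimensional ℝ X]
  {ι : Type*} [Fintype ι] {e : OrthonormalBasis ι ℝ X}

/-- A decreasing function from `1` to `0` on `[0, ∞)`, with derivative `-p`. -/
structure IsProfile (q p : ℝ → ℝ) : Prop where
  zero : q 0 = 1
  deriv : ∀ x, 0 ≤ x → HasDerivAt q (-p x) x
  cont : ContinuousOn p (Ici 0)
  deriv_pos : ∀ x, 0 ≤ x → 0 < p x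
  deriv_le_one : ∀ x, 0 ≤ x → p x ≤ 1
  pos : ∀ x, 0 ≤ x → 0 < q x
  tendsto : Tendsto q atTop (𝓝 0)

namespace IsProfile

variable {q p : ℝ → ℝ} (hq : IsProfile q p) {a : ι → ℝ} (ha : ∀ i, 0 < a i)
include hq ha

/-- The path is chosen so that `1 - a c = q (t a)`: the rescaling `D_t⁻¹` is then the square root of
the profile. Both decompositions have this form. -/
lemma isSubCovPath :
    IsSubCovPath a (fun t i => (1 - q (t * a i)) / a i) fun t i => p (t * a i) where
  zero i := by simp [hq.zero]
  deriv t ht i := by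
    have h1 := (hq.deriv (t * a i) (mul_nonneg ht (ha i).le)).comp t
      ((hasDerivAt_id t).mul_const (a i))
    refine ((h1.const_sub 1).div_const (a i)).congr_deriv ?_
    have := (ha i).ne'
    field_simp
  cont i := hq.cont.comp (continuous_id.mul continuous_const).continuousOn
    fun t ht => mul_nonneg ht (ha i).le
  pos t ht i := hq.deriv_pos _ (mul_nonneg ht (ha i).le)
  le_one t ht i := hq.deriv_le_one _ (mul_nonneg ht (ha i).le)
  coeff_pos := ha
  mul_lt_one t ht i := by
    rw [mul_div_cancel₀ _ (ha i).ne']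
    linarith [hq.pos _ (mul_nonneg ht (ha i).le)]

omit hq in
lemma scale_eq (t : ℝ) :
    scale a (fun t i => (1 - q (t * a i)) / a i) t = fun i => √(q (t * a i)) := by
  funext i
  rw [scale, mul_div_cancel₀ _ (ha i).ne', sub_sub_cancel]

/-- The improper integral of the derivative is the limit of `(1 - q (t a)) / a`, which is `a⁻¹`
because the profile vanishes at infinity. -/
lemma isDiagonalDecomposition {Cdot : ℝ → X →L[ℝ] X}
    (h : ∀ t, 0 ≤ t → Cdot t = diagOp e fun i => p (t * a i)) :
    IsDiagonalDecomposition e a (fun t i => (1 - q (t * a i)) / a i) (fun t i => p (t * a i))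
      Cdot where
  toIsSubCovPath := hq.isSubCovPath ha
  apply_eq := h
  covInf_eq := by
    have hc := hq.isSubCovPath ha
    have hlim : ∀ i, Tendsto (fun t => (1 - q (t * a i)) / a i) atTop (𝓝 (a i)⁻¹) := fun i => by
      have h1 := hq.tendsto.comp (tendsto_id.atTop_mul_const (ha i))
      simpa using (h1.const_sub 1).div_const (a i)
    have h1 : covInf Cdot = ∫ s in Ioi (0 : ℝ), diagOp e fun i => p (s * a i) :=
      setIntegral_congr_fun measurableSet_Ioi fun s hs => h s (le_of_lt hs)
    rw [h1, integral_diagOp e fun i => integrableOn_Ioi_deriv_of_nonneg'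
      (fun t ht => hc.deriv t ht i) (fun t ht => (hc.pos t (le_of_lt ht) i).le) (hlim i)]
    congr 1
    funext i
    rw [integral_Ioi_of_hasDerivAt_of_nonneg' (fun t ht => hc.deriv t ht i)
      (fun t ht => (hc.pos t (le_of_lt ht) i).le) (hlim i)]
    simp [hq.zero]

end IsProfile

lemma isProfile_resolvent : IsProfile (fun x => (1 + x)⁻¹) fun x => ((1 + x) ^ 2)⁻¹ where
  zero := by norm_num
  deriv x hx := by
    have h1 := ((hasDerivAt_id x).const_add 1).inv (show 1 + x ≠ 0 by positivity)
    refine h1.congr_deriv ?_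
    simp [neg_div]
  cont := ContinuousOn.inv₀ (by fun_prop) fun x (hx : 0 ≤ x) => by positivity
  deriv_pos x hx := by positivity
  deriv_le_one x hx := inv_le_one_of_one_le₀ (by nlinarith)
  pos x hx := by positivity
  tendsto := tendsto_inv_atTop_zero.comp (tendsto_atTop_add_const_left _ _ tendsto_id)

lemma isProfile_heat : IsProfile (fun x => Real.exp (-x)) fun x => Real.exp (-x) where
  zero := by simp
  deriv x _ := by simpa using (hasDerivAt_neg x).exp
  cont := by fun_prop
  deriv_pos x _ := Real.exp_pos _
  deriv_le_one x hx := Real.exp_le_one_iff.2 (neg_nonpos.2 hx)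
  pos x _ := Real.exp_pos _
  tendsto := Real.tendsto_exp_neg_atTop_nhds_zero

lemma resolventCdot_diagOp {a : ι → ℝ} (ha : ∀ i, 0 < a i) {t : ℝ} (ht : 0 ≤ t) :
    resolventCdot (diagOp e a) t = diagOp e fun i => ((1 + t * a i) ^ 2)⁻¹ := by
  have h1 : (t • diagOp e a + 1) ^ 2 = diagOp e fun i => (1 + t * a i) ^ 2 := by
    rw [← diagOp_one e, diagOp_smul, diagOp_add, diagOp_pow]
    congr 1
    funext i
    simp [add_comm]
  rw [resolventCdot, h1, inverse_diagOp e fun i => by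
    have := mul_nonneg ht (ha i).le
    positivity]
  rfl

lemma deriv_resolventCdot_diagOp {a : ι → ℝ} (ha : ∀ i, 0 < a i) {t : ℝ} (ht : 0 < t) :
    deriv (resolventCdot (diagOp e a)) t = diagOp e fun i => -2 * a i * ((1 + t * a i) ^ 3)⁻¹ := by
  have h1 : ∀ i, HasDerivAt (fun s => ((1 + s * a i) ^ 2)⁻¹)
      (-2 * a i * ((1 + t * a i) ^ 3)⁻¹) t := fun i => by
    have h0 : 1 + t * a i ≠ 0 := by
      have := mul_nonneg ht.le (ha i).le
      positivity
    have h2 := ((((hasDerivAt_id t).mul_const (a i)).const_add 1).pow 2).inv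
      (pow_ne_zero 2 h0)
    refine h2.congr_deriv ?_
    simp only [id, one_mul, Pi.pow_apply]
    generalize 1 + t * a i = d at h0
    field_simp
    norm_num
    ring
  have h2 := hasDerivAt_diagOp e h1
  refine (h2.congr_of_eventuallyEq ?_).deriv
  filter_upwards [lt_mem_nhds ht] with s hs
  exact resolventCdot_diagOp ha hs.le

lemma heatCdot_diagOp (a : ι → ℝ) (t : ℝ) :
    heatCdot (diagOp e a) t = diagOp e fun i => Real.exp (-(t * a i)) := by
  rw [heatCdot, diagOp_smul, diagOp_neg, exp_diagOp]
  rfl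

/-- A lower bound on the Hessian in the direction `p` integrates along the segment. -/
lemma le_inner_gradient_sub {V : X → ℝ} (hd : ∀ z, HasFDerivAt (∇ V) (hess V z) z) {κ : ℝ} {p : X}
    (h : ∀ z, κ ≤ ⟪p, hess V z p⟫) (z : X) : κ ≤ ⟪p, ∇ V (z + p) - ∇ V z⟫ := by
  have h1 : ∀ s : ℝ, HasDerivAt (fun s : ℝ => ⟪p, ∇ V (z + s • p)⟫)
      ⟪p, hess V (z + s • p) p⟫ s := fun s => by
    have h2 : HasDerivAt (fun s : ℝ => z + s • p) p s := by
      simpa using ((hasDerivAt_id s).smul_const p).const_add z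
    have h3 := (hasDerivAt_const s p).inner ℝ ((hd (z + s • p)).comp_hasDerivAt s h2)
    simpa using h3
  obtain ⟨s, -, hs⟩ := exists_hasDerivAt_eq_slope (fun s : ℝ => ⟪p, ∇ V (z + s • p)⟫)
    (fun s => ⟪p, hess V (z + s • p) p⟫) one_pos
    (fun s _ => (h1 s).continuousAt.continuousWithinAt) fun s _ => h1 s
  have h4 := h (z + s • p)
  rw [hs] at h4
  simpa [inner_sub_right] using h4

variable [MeasurableSpace X] [BorelSpace X]

/-- By `hB`, pairing the field with `(1 + tB) w` amounts to pairing `∇V_t` with `D_t⁻¹ w`. The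
Hessian bound `h` is integrated along the segment from `D_t⁻¹ y` to `D_t⁻¹ x`. -/
lemma IsSubCovPath.expand {a : ι → ℝ} {c cd : ℝ → ι → ℝ} (hc : IsSubCovPath a c cd)
    {F : X → ℝ} (hF : ContDiff ℝ 2 F) {M : ℝ} (hM : ∀ y, |F y| ≤ M) (hF0 : ∀ y, 0 < F y)
    {t κ : ℝ} (ht : 0 < t) {B : X →L[ℝ] X}
    (hB : ∀ w g, 2 * ⟪w + t • B w, diagOp e (fieldCoeff a c cd t) g⟫ =
      ⟪diagOp e (scale a c t) w, g⟫)
    (h : ∀ z w, κ * (‖w‖ ^ 2 + t * ⟪w, B w⟫) ≤ ⟪w, B w⟫ + ⟪diagOp e (scale a c t) w,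
      hess (heatPotential e F (c t)) z (diagOp e (scale a c t) w)⟫) (x y : X) :
    κ * (‖x - y‖ ^ 2 + t * ⟪x - y, B (x - y)⟫) ≤ ⟪x - y, B (x - y)⟫ +
      2 * ⟪(x - y) + t • B (x - y),
        transportField e a F c cd t x - transportField e a F c cd t y⟫ := by
  have h1 := le_inner_gradient_sub
    (fun z => hc.hasFDerivAt_gradient_heatPotential' e hF hM hF0 ht.le z)
    (p := diagOp e (scale a c t) (x - y))
    (κ := κ * (‖x - y‖ ^ 2 + t * ⟪x - y, B (x - y)⟫) - ⟪x - y, B (x - y)⟫)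
    (fun z => by linarith [h z (x - y)]) (diagOp e (scale a c t) y)
  rw [← map_add, add_sub_cancel] at h1
  rw [transportField, transportField, ← map_sub, hB]
  linarith

end ProfileDecompositions

/-! ### The two decompositions and the main theorem. -/

section MainResults

variable {X : Type*} [NormedAddCommGroup X] [InnerProductSpace ℝ X] [FiniteDimensional ℝ X]
  [MeasurableSpace X] [BorelSpace X] {ι : Type*} [Fintype ι] {e : OrthonormalBasis ι ℝ X}

lemma inner_diagOp_nonneg {a : ι → ℝ} (ha : ∀ i, 0 ≤ a i) (x : X) : 0 ≤ ⟪x, diagOp e a x⟫ := by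
  rw [inner_diagOp_right]
  exact Finset.sum_nonneg fun i _ => mul_nonneg (ha i) (mul_self_nonneg _)

lemma norm_opSqrt_one_add_sq {a : ι → ℝ} (ha : ∀ i, 0 ≤ a i) {t : ℝ} (ht : 0 ≤ t) (f : X) :
    ‖opSqrt (1 + t • diagOp e a) f‖ ^ 2 = ⟪f, (1 + t • diagOp e a) f⟫ := by
  rw [← diagOp_one e, diagOp_smul, diagOp_add, opSqrt_diagOp, norm_sq_eq_sum_coord e,
    inner_diagOp_right]
  refine Finset.sum_congr rfl fun i _ => ?_
  have h : 0 ≤ (1 + t • a) i := by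
    have := mul_nonneg ht (ha i)
    simp only [Pi.add_apply, Pi.one_apply, Pi.smul_apply, smul_eq_mul]
    positivity
  rw [inner_diagOp, mul_pow, Real.sq_sqrt h]
  ring

variable {a : ι → ℝ} (ha : ∀ i, 0 < a i) {V₀ : X → ℝ} (hV : ContDiff ℝ 2 V₀)
  (hb : BddBelow (range V₀))
include ha hV hb

/-- Here `D_t⁻¹ = (1 + tA)^{-1/2}` and the metric is `1 + tA`. The term with the second derivative
of `C_t` in the hypothesis supplies the time derivative `A` of the metric. -/
theorem exists_transport_resolvent {k : ℝ → ℝ}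
    (hk : ∀ t : ℝ, 0 ≤ t → IntervalIntegrable k volume 0 t)
    (h : ∀ t : ℝ, 0 < t → ∀ φ f : X,
      k t * ⟪f, resolventCdot (diagOp e a) t f⟫ ≤
        ⟪f, resolventCdot (diagOp e a) t
          (hess (renormPotential (resolventCdot (diagOp e a)) V₀ t) φ
            (resolventCdot (diagOp e a) t f))⟫
          - (1 / 2) * ⟪f, deriv (resolventCdot (diagOp e a)) t f⟫) :
    ∃ S Shat : ℝ → X → X, IsTransportFlow (diagOp e a) (resolventCdot (diagOp e a)) V₀ S ∧
      (∀ S' : ℝ → X → X, IsTransportFlow (diagOp e a) (resolventCdot (diagOp e a)) V₀ S' →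
        ∀ t, 0 ≤ t → S' t = S t) ∧
      ∀ t, 0 ≤ t → IsInverseTransport (diagOp e a) (resolventCdot (diagOp e a)) V₀ S Shat t ∧
        (∀ φ ψ, ‖Shat t φ - Shat t ψ‖ ^ 2 ≤
          Real.exp (-∫ s in (0 : ℝ)..t, k s) * metricSq (diagOp e a) t (φ - ψ)) ∧
        ∀ φ f, ‖fderiv ℝ (Shat t) φ f‖ ^ 2 ≤
          Real.exp (-∫ s in (0 : ℝ)..t, k s) * metricSq (diagOp e a) t f := by
  obtain ⟨M, hM⟩ := IsDiagonalDecomposition.exists_exp_neg_le hb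
  have hF := IsDiagonalDecomposition.contDiff_exp_neg hV
  have hF0 : ∀ x, 0 < Real.exp (-V₀ x) := fun x => Real.exp_pos _
  have hC := isProfile_resolvent.isDiagonalDecomposition (e := e) ha
    fun t ht => resolventCdot_diagOp ha ht
  refine hC.exists_transport hV hb (hC.isExpandingField e hF hM hF0
    (inner_diagOp_comm e a) (inner_diagOp_nonneg fun i => (ha i).le) hk fun t ht =>
    hC.expand hF hM hF0 ht (fun w g => ?_) fun z w => ?_)
  all_goals
    have hpos : ∀ i, 0 < 1 + t * a i := fun i => by
      have := mul_pos ht (ha i)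
      positivity
    have hq : ∀ i, √((1 + t * a i)⁻¹) ^ 2 = (1 + t * a i)⁻¹ := fun i =>
      Real.sq_sqrt (inv_pos.2 (hpos i)).le
    have hq0 : ∀ i, √((1 + t * a i)⁻¹) ≠ 0 := fun i =>
      (Real.sqrt_pos.2 (inv_pos.2 (hpos i))).ne'
  · rw [inner_eq_sum_coord e, inner_eq_sum_coord e, Finset.mul_sum]
    refine Finset.sum_congr rfl fun i _ => ?_
    rw [IsProfile.scale_eq (q := fun x => (1 + x)⁻¹) ha, inner_diagOp, inner_diagOp,
      inner_add_right, real_inner_smul_right, inner_diagOp, fieldCoeff,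
      IsProfile.scale_eq (q := fun x => (1 + x)⁻¹) ha]
    dsimp only
    have h1 := hq i
    have h2 := hq0 i
    have h3 := (hpos i).ne'
    set r := √((1 + t * a i)⁻¹) with hr
    have h4 : ((1 + t * a i) ^ 2)⁻¹ = r ^ 2 * r ^ 2 := by rw [h1, ← mul_inv, sq]
    have h5 : (1 + t * a i) * r ^ 2 = 1 := by rw [h1, mul_inv_cancel₀ h3]
    rw [h4]
    field_simp
    linear_combination (⟪e i, w⟫ * ⟪e i, g⟫) * h5
  · have hs := IsProfile.scale_eq (q := fun x => (1 + x)⁻¹) ha t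
    -- The test vector is `f = Ċ_t⁻¹ D_t⁻¹ w`. Then `Ċ_t f = D_t⁻¹ w`, `(f, Ċ_t f)` is the metric
    -- square of `w`, and the term with the second derivative contributes `(w, Aw)`.
    have h1 := h t ht z (diagOp e (fun i => (1 + t * a i) ^ 2 * √((1 + t * a i)⁻¹)) w)
    rw [hC.renormPotential_eq hV.continuous ht.le, deriv_resolventCdot_diagOp ha ht,
      resolventCdot_diagOp ha ht.le, ← inner_diagOp_comm e _ _ (hess _ _ _), diagOp_diagOp] at h1
    have h2 : ((fun i => ((1 + t * a i) ^ 2)⁻¹) *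
        fun i => (1 + t * a i) ^ 2 * √((1 + t * a i)⁻¹)) = fun i => √((1 + t * a i)⁻¹) := by
      funext i
      have := (hpos i).ne'
      rw [Pi.mul_apply]
      field_simp
    rw [h2] at h1
    rw [hs]
    have h3 : ⟪diagOp e (fun i => (1 + t * a i) ^ 2 * √((1 + t * a i)⁻¹)) w,
        diagOp e (fun i => √((1 + t * a i)⁻¹)) w⟫ = ‖w‖ ^ 2 + t * ⟪w, diagOp e a w⟫ := by
      rw [inner_eq_sum_coord e, norm_sq_eq_sum_coord e, inner_diagOp_right, Finset.mul_sum,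
        ← Finset.sum_add_distrib]
      refine Finset.sum_congr rfl fun i _ => ?_
      rw [inner_diagOp, inner_diagOp]
      have h1 := hq i
      have h3 := (hpos i).ne'
      have h5 : (1 + t * a i) * √((1 + t * a i)⁻¹) ^ 2 = 1 := by rw [h1, mul_inv_cancel₀ h3]
      linear_combination ((1 + t * a i) * ⟪e i, w⟫ ^ 2) * h5
    have h4 : ⟪diagOp e (fun i => (1 + t * a i) ^ 2 * √((1 + t * a i)⁻¹)) w,
        diagOp e (fun i => -2 * a i * ((1 + t * a i) ^ 3)⁻¹)
          (diagOp e (fun i => (1 + t * a i) ^ 2 * √((1 + t * a i)⁻¹)) w)⟫ =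
        -2 * ⟪w, diagOp e a w⟫ := by
      rw [inner_eq_sum_coord e, inner_diagOp_right, Finset.mul_sum]
      refine Finset.sum_congr rfl fun i _ => ?_
      rw [inner_diagOp, inner_diagOp, inner_diagOp]
      have h1 := hq i
      have h3 := (hpos i).ne'
      have h5 : (1 + t * a i) * √((1 + t * a i)⁻¹) ^ 2 = 1 := by rw [h1, mul_inv_cancel₀ h3]
      generalize √((1 + t * a i)⁻¹) = r at h5
      field_simp
      linear_combination (-a i * ⟪e i, w⟫ ^ 2) * h5
    rw [h3, h4] at h1
    linarith

/-- Here `D_t Ċ_t = D_t⁻¹ = Ċ_t^{1/2}`, so the flat metric suffices and the hypothesis is used at `f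
= w`. -/
theorem exists_transport_heat {k : ℝ → ℝ}
    (hk : ∀ t : ℝ, 0 ≤ t → IntervalIntegrable k volume 0 t)
    (h : ∀ t : ℝ, 0 < t → ∀ φ f : X,
      k t * ⟪f, f⟫ ≤ ⟪f, opSqrt (heatCdot (diagOp e a) t)
        (hess (renormPotential (heatCdot (diagOp e a)) V₀ t) φ
          (opSqrt (heatCdot (diagOp e a) t) f))⟫) :
    ∃ S Shat : ℝ → X → X, IsTransportFlow (diagOp e a) (heatCdot (diagOp e a)) V₀ S ∧
      (∀ S' : ℝ → X → X, IsTransportFlow (diagOp e a) (heatCdot (diagOp e a)) V₀ S' →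
        ∀ t, 0 ≤ t → S' t = S t) ∧
      ∀ t, 0 ≤ t → IsInverseTransport (diagOp e a) (heatCdot (diagOp e a)) V₀ S Shat t ∧
        (∀ φ ψ, ‖Shat t φ - Shat t ψ‖ ^ 2 ≤
          Real.exp (-∫ s in (0 : ℝ)..t, k s) * metricSq 0 t (φ - ψ)) ∧
        ∀ φ f, ‖fderiv ℝ (Shat t) φ f‖ ^ 2 ≤
          Real.exp (-∫ s in (0 : ℝ)..t, k s) * metricSq 0 t f := by
  obtain ⟨M, hM⟩ := IsDiagonalDecomposition.exists_exp_neg_le hb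
  have hF := IsDiagonalDecomposition.contDiff_exp_neg hV
  have hF0 : ∀ x, 0 < Real.exp (-V₀ x) := fun x => Real.exp_pos _
  have hC := isProfile_heat.isDiagonalDecomposition (e := e) ha
    fun t _ => heatCdot_diagOp a t
  refine hC.exists_transport hV hb (hC.isExpandingField e hF hM hF0
    (fun x y => by simp) (fun x => by simp) hk fun t ht =>
    hC.expand hF hM hF0 ht (fun w g => ?_) fun z w => ?_)
  · rw [IsProfile.scale_eq (q := fun x => Real.exp (-x)) ha, inner_eq_sum_coord e,
      inner_eq_sum_coord e, Finset.mul_sum]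
    refine Finset.sum_congr rfl fun i _ => ?_
    have h1 := Real.sq_sqrt (Real.exp_pos (-(t * a i))).le
    have h2 := (Real.sqrt_pos.2 (Real.exp_pos (-(t * a i)))).ne'
    rw [inner_diagOp, inner_diagOp, fieldCoeff,
      IsProfile.scale_eq (q := fun x => Real.exp (-x)) ha]
    simp only [_root_.zero_apply, smul_zero, add_zero]
    nth_rw 1 [← h1]
    field_simp
  · have h1 := h t ht z w
    rw [hC.renormPotential_eq hV.continuous ht.le, heatCdot_diagOp, opSqrt_diagOp,
      ← inner_diagOp_comm, real_inner_self_eq_norm_sq] at h1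
    rw [IsProfile.scale_eq (q := fun x => Real.exp (-x)) ha]
    simpa using h1

end MainResults

end PolchinskiFlow

theorem mainTheorem6 {X : Type*} [NormedAddCommGroup X] [InnerProductSpace ℝ X]
    [FiniteDimensional ℝ X] [MeasurableSpace X] [BorelSpace X]
    (A : X →L[ℝ] X) (hA_symm : ∀ x y : X, ⟪A x, y⟫ = ⟪x, A y⟫)
    (hA_pos : ∀ x : X, x ≠ 0 → 0 < ⟪x, A x⟫)
    (V₀ : X → ℝ) (hV_smooth : ContDiff ℝ 2 V₀) (hV_bdd : BddBelow (Set.range V₀)) :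
    -- the decomposition `Ċ_t = (tA + 1)⁻²`
    (∀ lamdot : ℝ → ℝ,
      (∀ t : ℝ, 0 ≤ t → IntervalIntegrable lamdot volume 0 t) →
      (∀ t : ℝ, 0 < t → ∀ φ f : X,
        lamdot t * ⟪f, PolchinskiFlow.resolventCdot A t f⟫ ≤
          ⟪f, PolchinskiFlow.resolventCdot A t
            (PolchinskiFlow.hess
              (PolchinskiFlow.renormPotential (PolchinskiFlow.resolventCdot A) V₀ t) φ
              (PolchinskiFlow.resolventCdot A t f))⟫
          - (1 / 2) * ⟪f, deriv (PolchinskiFlow.resolventCdot A) t f⟫) →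
      ∃ S Shat : ℝ → X → X,
        PolchinskiFlow.IsTransportFlow A (PolchinskiFlow.resolventCdot A) V₀ S ∧
        (∀ S' : ℝ → X → X,
          PolchinskiFlow.IsTransportFlow A (PolchinskiFlow.resolventCdot A) V₀ S' →
            ∀ t : ℝ, 0 ≤ t → S' t = S t) ∧
        ∀ t : ℝ, 0 ≤ t →
          PolchinskiFlow.IsInverseTransport A (PolchinskiFlow.resolventCdot A) V₀ S Shat t ∧
          ∀ φ f : X,
            ‖fderiv ℝ (Shat t) φ f‖ ^ 2 ≤
              Real.exp (-∫ s in (0 : ℝ)..t, lamdot s) *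
                ‖PolchinskiFlow.opSqrt (1 + t • A) f‖ ^ 2 ∧
            ‖PolchinskiFlow.opSqrt (1 + t • A) f‖ ^ 2 = ⟪f, (1 + t • A) f⟫) ∧
    -- the decomposition `Ċ_t = exp (-tA)`
    (∀ mudot : ℝ → ℝ,
      (∀ t : ℝ, 0 ≤ t → IntervalIntegrable mudot volume 0 t) →
      (∀ t : ℝ, 0 < t → ∀ φ f : X,
        mudot t * ⟪f, f⟫ ≤
          ⟪f, PolchinskiFlow.opSqrt (PolchinskiFlow.heatCdot A t)
            (PolchinskiFlow.hess
              (PolchinskiFlow.renormPotential (PolchinskiFlow.heatCdot A) V₀ t) φ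
              (PolchinskiFlow.opSqrt (PolchinskiFlow.heatCdot A t) f))⟫) →
      ∃ S Shat : ℝ → X → X,
        PolchinskiFlow.IsTransportFlow A (PolchinskiFlow.heatCdot A) V₀ S ∧
        (∀ S' : ℝ → X → X,
          PolchinskiFlow.IsTransportFlow A (PolchinskiFlow.heatCdot A) V₀ S' →
            ∀ t : ℝ, 0 ≤ t → S' t = S t) ∧
        ∀ t : ℝ, 0 ≤ t →
          PolchinskiFlow.IsInverseTransport A (PolchinskiFlow.heatCdot A) V₀ S Shat t ∧
          LipschitzWith (Real.toNNReal (Real.exp (-(1 / 2) * ∫ s in (0 : ℝ)..t, mudot s)))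
            (Shat t) ∧
          ∀ φ f : X,
            ‖fderiv ℝ (Shat t) φ f‖ ^ 2 ≤
              Real.exp (-(1 / 2) * ∫ s in (0 : ℝ)..t, mudot s) ^ 2 * ‖f‖ ^ 2) := by
  obtain ⟨e, a, ha, rfl⟩ := PolchinskiFlow.exists_eq_diagOp hA_symm hA_pos
  refine ⟨fun lamdot hk h => ?_, fun mudot hk h => ?_⟩
  · obtain ⟨S, Shat, hS, huniq, hinv⟩ :=
      PolchinskiFlow.exists_transport_resolvent ha hV_smooth hV_bdd hk h
    refine ⟨S, Shat, hS, huniq, fun t ht => ⟨(hinv t ht).1, fun φ f => ?_⟩⟩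
    have h1 := PolchinskiFlow.norm_opSqrt_one_add_sq (e := e) (fun i => (ha i).le) ht f
    refine ⟨?_, h1⟩
    have h2 : ⟪f, (1 + t • PolchinskiFlow.diagOp e a) f⟫ =
        PolchinskiFlow.metricSq (PolchinskiFlow.diagOp e a) t f := by
      rw [PolchinskiFlow.metricSq, ← real_inner_self_eq_norm_sq, ← real_inner_smul_right,
        ← inner_add_right]
      rfl
    rw [h1, h2]
    exact (hinv t ht).2.2 φ f
  · obtain ⟨S, Shat, hS, huniq, hinv⟩ :=
      PolchinskiFlow.exists_transport_heat ha hV_smooth hV_bdd hk h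
    have hm : ∀ t w, PolchinskiFlow.metricSq (0 : X →L[ℝ] X) t w = ‖w‖ ^ 2 := fun t w => by
      simp [PolchinskiFlow.metricSq]
    have hexp : ∀ t : ℝ, Real.exp (-∫ s in (0 : ℝ)..t, mudot s) =
        Real.exp (-(1 / 2) * ∫ s in (0 : ℝ)..t, mudot s) ^ 2 := fun t => by
      rw [← Real.exp_nat_mul]
      congr 1
      push_cast
      ring
    simp only [hm, hexp] at hinv
    refine ⟨S, Shat, hS, huniq, fun t ht => ⟨(hinv t ht).1,
      LipschitzWith.of_dist_le_mul fun φ ψ => ?_, (hinv t ht).2.2⟩⟩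
    rw [dist_eq_norm, dist_eq_norm, Real.coe_toNNReal _ (Real.exp_pos _).le]
    refine abs_le_of_sq_le_sq' ?_ (by positivity) |>.2
    rw [mul_pow]
    exact (hinv t ht).2.1 φ ψ
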